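/- Let $C$ be a smooth, irreducible, complex projective curve of genus $2$, let $r\ge 3$, and let $F$ be a semistable vector bundle on $C$ of rank $r-1$ and degree $r$, so that $[F]\in\mathcal U_C(r-1,r)$, where $\mathcal U_C(n,d)$ is the moduli space of $S$-equivalence classes of semistable vector bundles of rank $n$ and degree $d$. For $v\in\operatorname{Ext}^1(F,\mathcal O_C)$ let $0\to\mathcal O_C\to E_v\to F\to 0$ be the corresponding extension. Say that $[v]\in\mathbb P(\operatorname{Ext}^1(F,\mathcal O_C))$ extends a morphism $\iota\colon S\to F$ if $\iota$ factors through $E_v\to F$. Let $\Theta_r=\{[E]\in\mathcal U_C(r,r)\mid h^0(\operatorname{gr}(E))\ge 1\}$, and let $\Theta_r^s\subset\Theta_r$ be the subset of classes of stable bundles. Then: 1. For every point $p\in C$ and every nonzero linear form $\gamma\colon F_p\to\mathbb C$ on the fibre of $F$ at $p$, let $G_\gamma=\ker(F\to F_p\xrightarrow{\gamma}\mathbb C_p)$ be the elementary transformation of $F$ at $p$ defined by $[\gamma]\in\mathbb P(F_p^\vee)$. There is a unique $[v]\in\mathbb P(\operatorname{Ext}^1(F,\mathcal O_C))$ such that the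 inclusion $G_\gamma\hookrightarrow F$ lifts to $E_v$. 2. Let $1\le s\le r-2$ and let $\iota\colon S\hookrightarrow F$ be a maximal subbundle of rank $s$, that is, a subsheaf of rank $s$ and slope $1$. The set of classes $[v]$ that extend $\iota$ is a linear subspace of $\mathbb P(\operatorname{Ext}^1(F,\mathcal O_C))$ of (projective) dimension $2r-2s-2$. 3. In particular, for every inclusion $G_\gamma\hookrightarrow F$ as in 1 and every $\iota\colon S\hookrightarrow F$ as in 2, there is at least one class $[v]$ extending it, and for every such $[v]$ the bundle $E_v$ is semistable of rank $r$ and degree $r$ and $[E_v]\in\Theta_r\setminus\Theta_r^s$. -/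

import Mathlib

open CategoryTheory CategoryTheory.Limits AlgebraicGeometry

noncomputable section

namespace ThetaCurve

/-! ### The `ℂ`-linear structure on sheaves of modules over a complex scheme -/

/-- Multiplication by a global function, as an endomorphism of an `𝒪_X`-module. -/
def globalSmul {X : Scheme.{0}} (a : Γ(X, ⊤)) (M : X.Modules) : M ⟶ M where
  val := PresheafOfModules.homMk
    { app := fun U => M.smul (X.presheaf.map (homOfLE (le_top : U.unop ≤ ⊤)).op a)
      naturality := fun U V i => by
        have h := Scheme.Modules.map_comp_smul (M := M) i.unop
          (X.presheaf.map (homOfLE (le_top : U.unop ≤ ⊤)).op a)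
        rw [← CommRingCat.comp_apply, ← Functor.map_comp] at h
        exact h.symm }
    (fun U (r : Γ(X, U.unop)) (m : Γ(M, U.unop)) =>
      smul_comm (M := Γ(X, U.unop)) (N := Γ(X, U.unop))
        (X.presheaf.map (homOfLE (le_top : U.unop ≤ ⊤)).op a) r m)

/-- On sections over `U`, `globalSmul a M` is `m ↦ a|_U • m`. -/
lemma globalSmul_app {X : Scheme.{0}} (a : Γ(X, ⊤)) (M : X.Modules) (U : X.Opens)
    (m : Γ(M, U)) :
    (globalSmul a M).app U m = X.presheaf.map (homOfLE (le_top : U ≤ ⊤)).op a • m := rfl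

/-- Global functions act on the category of `𝒪_X`-modules. -/
def globalToCenter (X : Scheme.{0}) : Γ(X, ⊤) →+* CatCenter X.Modules where
  toFun a :=
    { app := fun M => globalSmul a M
      naturality := fun M N f => by
        apply Scheme.Modules.hom_ext
        intro U
        ext m
        exact (Scheme.Modules.Hom.app_smul f _ _).symm }
  map_one' := by
    ext M U m
    exact (globalSmul_app _ _ _ _).trans (by rw [map_one, one_smul]; rfl)
  map_mul' a b := by
    ext M U m
    refine (globalSmul_app _ _ _ _).trans ?_
    rw [map_mul, mul_smul]
    rfl
  map_zero' := by
    ext M U m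
    exact (globalSmul_app _ _ _ _).trans (by rw [map_zero, zero_smul]; rfl)
  map_add' a b := by
    ext M U m
    exact (globalSmul_app _ _ _ _).trans (by rw [map_add, add_smul]; rfl)

/-- The ring map `ℂ → Γ(X, 𝒪_X)` of a scheme over `Spec ℂ`. -/
def scalars (X : Scheme.{0}) [X.Over (Spec (.of ℂ))] : ℂ →+* Γ(X, ⊤) :=
  ((Scheme.ΓSpecIso (.of ℂ)).inv ≫ (X ↘ Spec (.of ℂ)).appTop).hom

/-- For a scheme `X` over `ℂ`, the category of `𝒪_X`-modules is `ℂ`-linear. -/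
instance linearModules (X : Scheme.{0}) [X.Over (Spec (.of ℂ))] : Linear ℂ X.Modules :=
  Linear.ofRingMorphism ((globalToCenter X).comp (scalars X))

/-- `Ext` groups of `𝒪_X`-modules exist. -/
instance hasExtModules (X : Scheme.{0}) : HasExt.{1} X.Modules := HasExt.standard _

/-- The `ℂ`-vector space `Ext¹(F, G)` in the category of `𝒪_X`-modules. -/
abbrev Ext1 {X : Scheme.{0}} (F G : X.Modules) : Type 1 := Abelian.Ext.{1} F G 1

/-- The structure sheaf as an `𝒪_X`-module. -/
abbrev structureSheaf (X : Scheme.{0}) : X.Modules := SheafOfModules.unit X.ringCatSheaf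

/-! ### Curves, cohomology, rank and degree -/

/-- `C` is a smooth, irreducible, projective curve over `ℂ` (for smooth curves over a field,
proper and projective are the same). -/
class IsSmoothProjectiveCurve (C : Scheme.{0}) [C.Over (Spec (.of ℂ))] : Prop where
  isIntegral : IsIntegral C
  isProper : IsProper (C ↘ Spec (.of ℂ))
  smooth : SmoothOfRelativeDimension 1 (C ↘ Spec (.of ℂ))

section

variable {C : Scheme.{0}} [C.Over (Spec (.of ℂ))]

/-- `hⁱ(E) = dim_ℂ Hⁱ(C, E)`, with `Hⁱ(C, E) = Extⁱ(𝒪_C, E)`. -/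
def h (i : ℕ) (E : C.Modules) : ℕ :=
  Module.finrank ℂ (Abelian.Ext.{1} (structureSheaf C) E i)

/-- The Euler characteristic `χ(E) = h⁰(E) - h¹(E)` of a coherent sheaf on a curve. -/
def eulerChar (E : C.Modules) : ℤ := (h 0 E : ℤ) - h 1 E

variable (C) in
/-- The genus `g = h¹(𝒪_C)`. -/
def genus : ℕ := h 1 (structureSheaf C)

/-- `E` is locally isomorphic to `𝒪^n`. -/
def IsLocallyFreeOfRank {X : Scheme.{0}} (E : X.Modules) (n : ℕ) : Prop :=
  ∀ x : X, ∃ U : X.Opens, x ∈ U ∧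
    Nonempty (E.restrict U.ι ≅ SheafOfModules.free (R := U.toScheme.ringCatSheaf) (Fin n))

/-- `E` is a vector bundle of rank `n` and degree `d`. The degree of a coherent sheaf of rank `n`
on a curve is `χ(E) - n χ(𝒪_C)`. -/
def IsVectorBundle (E : C.Modules) (n : ℕ) (d : ℤ) : Prop :=
  IsLocallyFreeOfRank E n ∧ d = eulerChar E - n * eulerChar (structureSheaf C)

/-- `E` is a nonzero vector bundle of slope `μ`. -/
def HasSlope (E : C.Modules) (μ : ℚ) : Prop :=
  ∃ (n : ℕ) (d : ℤ), 0 < n ∧ IsVectorBundle E n d ∧ μ = d / n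

/-- Semistability of a nonzero vector bundle: every nonzero subsheaf `S ⊆ E` has
`μ(S) ≤ μ(E)`. (Coherent subsheaves of a vector bundle on a smooth curve are locally free.) -/
def IsSemistable (E : C.Modules) : Prop :=
  ∃ (n : ℕ) (d : ℤ), 0 < n ∧ IsVectorBundle E n d ∧
    ∀ (S : C.Modules) (i : S ⟶ E) (m : ℕ) (e : ℤ), Mono i → IsVectorBundle S m e → 0 < m →
      (e : ℚ) / m ≤ (d : ℚ) / n

/-- Stability of a nonzero vector bundle: every subsheaf `S ⊆ E` with `0 < rk S < rk E` has
`μ(S) < μ(E)`. -/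
def IsStable (E : C.Modules) : Prop :=
  ∃ (n : ℕ) (d : ℤ), 0 < n ∧ IsVectorBundle E n d ∧
    ∀ (S : C.Modules) (i : S ⟶ E) (m : ℕ) (e : ℤ), Mono i → IsVectorBundle S m e → 0 < m →
      m < n → (e : ℚ) / m < (d : ℚ) / n

/-! ### The moduli sets `U_C(n, d)` and the theta divisor -/

/-- `IsGraded μ E G`: `E` has a Jordan-Hölder filtration with stable factors of slope `μ`, and
`G` is the direct sum `gr(E)` of its factors. -/
inductive IsGraded (μ : ℚ) : C.Modules → C.Modules → Prop
  | stable (E : C.Modules) (hE : IsStable E) (hμ : HasSlope E μ) : IsGraded μ E E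
  | extension (A E B G : C.Modules) (a : A ⟶ E) (b : E ⟶ B) (w : a ≫ b = 0)
      (hex : (ShortComplex.mk a b w).ShortExact) (hA : IsStable A) (hμ : HasSlope A μ)
      (hB : IsGraded μ B G) : IsGraded μ E (A ⊞ G)

variable (C) in
/-- A semistable vector bundle on `C` of rank `n` and degree `d`. -/
structure SemistableBundle (n : ℕ) (d : ℤ) where
  sheaf : C.Modules
  isVectorBundle : IsVectorBundle sheaf n d
  isSemistable : IsSemistable sheaf

/-- S-equivalence: isomorphic associated graded bundles. -/
def SEquivalent {n : ℕ} {d : ℤ} (E E' : SemistableBundle C n d) : Prop :=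
  ∃ G G' : C.Modules, IsGraded (d / n : ℚ) E.sheaf G ∧ IsGraded (d / n : ℚ) E'.sheaf G' ∧
    Nonempty (G ≅ G')

variable (C) in
/-- The points of the moduli space `U_C(n, d)`: S-equivalence classes of semistable vector
bundles of rank `n` and degree `d`. -/
def ModuliPoints (n : ℕ) (d : ℤ) : Type 1 := Quot (SEquivalent (C := C) (n := n) (d := d))

/-- The point `[E]` of the moduli space. -/
def SemistableBundle.point {n : ℕ} {d : ℤ} (E : SemistableBundle C n d) : ModuliPoints C n d :=
  Quot.mk _ E

variable (C) in
/-- `Θ_r = {[E] ∈ U_C(r, r) | h⁰(gr E) ≥ 1}`. -/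
def Theta (r : ℕ) : Set (ModuliPoints C r r) :=
  {x | ∃ (E : SemistableBundle C r r) (G : C.Modules),
    E.point = x ∧ IsGraded ((r : ℤ) / r : ℚ) E.sheaf G ∧ 1 ≤ h 0 G}

variable (C) in
/-- `Θ_r^s`, the stable points of `Θ_r`. -/
def ThetaStable (r : ℕ) : Set (ModuliPoints C r r) :=
  {x | x ∈ Theta C r ∧ ∃ E : SemistableBundle C r r, E.point = x ∧ IsStable E.sheaf}

/-! ### Extensions and lifts -/

/-- An extension `0 → G → E_v → F → 0` whose class is `v ∈ Ext¹(F, G)`. -/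
structure ExtensionWithClass {F G : C.Modules} (v : Ext1 F G) where
  E : C.Modules
  incl : G ⟶ E
  proj : E ⟶ F
  zero : incl ≫ proj = 0
  exact : (ShortComplex.mk incl proj zero).ShortExact
  class_eq : exact.extClass = v

/-- The morphism `f : S ⟶ F` can be lifted to `E_v`. (The extension `E_v` of class `v` is unique
up to an isomorphism of extensions.) -/
def LiftsTo {S F G : C.Modules} (f : S ⟶ F) (v : Ext1 F G) : Prop :=
  ∃ (X : ExtensionWithClass v) (l : S ⟶ X.E), l ≫ X.proj = f

open scoped LinearAlgebra.Projectivization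

/-- The set of classes `[v] ∈ ℙ(Ext¹(F, 𝒪_C))` that extend `f : S ⟶ F`, that is, such that `f`
lifts to `E_v`. -/
def extendingClasses {S F : C.Modules} (f : S ⟶ F) : Set (ℙ ℂ (Ext1 F (structureSheaf C))) :=
  {x | ∃ (v : Ext1 F (structureSheaf C)) (hv : v ≠ 0),
    Projectivization.mk ℂ v hv = x ∧ LiftsTo f v}

/-- The class `[v]` gives a point of `Θ_r ∖ Θ_r^s`: the extension `E_v` exists, is a semistable
vector bundle of rank `r` and degree `r`, and `[E_v] ∈ Θ_r ∖ Θ_r^s`. -/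
def GivesStrictlySemistablePoint {F : C.Modules} (r : ℕ)
    (x : ℙ ℂ (Ext1 F (structureSheaf C))) : Prop :=
  ∀ (v : Ext1 F (structureSheaf C)) (hv : v ≠ 0), Projectivization.mk ℂ v hv = x →
    Nonempty (ExtensionWithClass v) ∧ ∀ X : ExtensionWithClass v,
      ∃ E : SemistableBundle C r r, E.sheaf = X.E ∧ E.point ∈ Theta C r \ ThetaStable C r

/-- `W` is a linear subspace of projective dimension `k` of `ℙ(V)`. -/
def HasProjDim {V : Type*} [AddCommGroup V] [Module ℂ V] (W : Projectivization.Subspace ℂ V)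
    (k : ℤ) : Prop :=
  Module.Finite ℂ (Projectivization.Subspace.submodule W) ∧
    (Module.finrank ℂ (Projectivization.Subspace.submodule W) : ℤ) = k + 1

end

/-! ### Elementary transformations and maximal subbundles -/

section

variable {C : Scheme.{0}}

/-- The fibre `F_p` of `F` at `p`, as a module on `Spec κ(p)`. -/
abbrev fiber (F : C.Modules) (p : C) : (Spec (C.residueField p)).Modules :=
  (Scheme.Modules.pullback (C.fromSpecResidueField p)).obj F

/-- The skyscraper sheaf `κ(p)` at `p` (it is `ℂ_p` if `p` is a closed point of a complex
curve). -/
abbrev skyscraper (p : C) : C.Modules :=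
  (Scheme.Modules.pushforward (C.fromSpecResidueField p)).obj
    (structureSheaf (Spec (C.residueField p)))

/-- The restriction map `F ⟶ F_p` followed by a linear form `γ` on the fibre `F_p`. -/
def evalForm {F : C.Modules} {p : C} (γ : fiber F p ⟶ structureSheaf (Spec (C.residueField p))) :
    F ⟶ skyscraper p :=
  (Scheme.Modules.pullbackPushforwardAdjunction (C.fromSpecResidueField p)).unit.app F ≫
    (Scheme.Modules.pushforward (C.fromSpecResidueField p)).map γ

/-- The elementary transformation `G_γ = ker (F ⟶ F_p ⟶ ℂ_p)` of `F` at `p` defined by `γ`. -/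
abbrev elemTransf {F : C.Modules} {p : C}
    (γ : fiber F p ⟶ structureSheaf (Spec (C.residueField p))) : C.Modules :=
  kernel (evalForm γ)

/-- The inclusion `G_γ ↪ F`. -/
abbrev elemTransfIncl {F : C.Modules} {p : C}
    (γ : fiber F p ⟶ structureSheaf (Spec (C.residueField p))) : elemTransf γ ⟶ F :=
  kernel.ι (evalForm γ)

end

/-- `ι : S ⟶ F` is (the inclusion of) a maximal subbundle of rank `s` of a bundle `F` in
`U_C(r - 1, r)`: a subsheaf of slope `1` and rank `s` with `1 ≤ s ≤ r - 2`. -/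
structure IsMaximalSubbundle {C : Scheme.{0}} [C.Over (Spec (.of ℂ))] (r s : ℕ)
    {S F : C.Modules} (ι : S ⟶ F) : Prop where
  mono : Mono ι
  isLocallyFree : IsLocallyFreeOfRank S s
  slope : HasSlope S 1
  one_le : 1 ≤ s
  le : s + 2 ≤ r

end ThetaCurve

end

/-! By the long exact sequence of an extension, a morphism `i : A ⟶ F` lifts to `E_v` exactly when
`v` lies in the kernel of the pullback `Ext¹(F, 𝒪) → Ext¹(A, 𝒪)` (`liftsTo_iff`). The classes
extending `i` are therefore the points of a projectivized kernel, and everything in the dimension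
statements is the size of that kernel.

For `i` a monomorphism of bundles the pullback is surjective (`ext_precomp_surjective`): `𝒪 → 𝒦 →
𝒦/𝒪`, with `𝒦` the constant sheaf of rational functions, shows that each class comes from a morphism
to `𝒦/𝒪`, and such morphisms extend point by point. Riemann-Roch in the form `VB.dualChar` gives
`dim Hom(M, 𝒪) - dim Ext¹(M, 𝒪) = rk M · χ(𝒪) - deg M`, with `χ(𝒪) = -1` in genus two. Semistability
of `F`, whose slope is `r/(r-1)`, kills `Hom(F, 𝒪)` and `Hom(A, 𝒪)` when `A` has slope `1`
(`hom_structureSheaf_eq_zero`). So the kernel has dimension `(2 rk F + 1) - 2 rk A`: this is `1` for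
`G_γ`, of rank `r-1`, and `2r-2s-1` for a maximal subbundle of rank `s`.

For nonzero `v`, a subsheaf of `E_v` is an extension of a subsheaf `I` of `F` by a subsheaf of `𝒪`.
Semistability of `F` forces `deg I ≤ rk I` unless `I` has full rank, and a subsheaf violating
semistability of `E_v` would have to map isomorphically onto `F`, splitting the extension
(`ExtensionWithClass.isSemistable`). The section `𝒪 → E_v` puts `[E_v]` in the theta divisor, and a
lift of `A` is a proper subsheaf of slope `1`, so `E_v` is not stable. Stability is invariant under
S-equivalence, so the class itself is not a stable point (`givesStrictlySemistablePoint`).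

Riemann-Roch is obtained by comparing bundles through torsion quotients. If `A ⊆ B` have equal rank
and `T = B/A`, then `H¹(T) = 0` and `Ext¹(T, 𝒪)` has dimension `h⁰(T)`, by duality of torsion
modules over discrete valuation rings. Hence `χ(B) = χ(A) + h⁰(T)`, while the dual characteristic
drops by `h⁰(T)`, and their sum is unchanged. Any bundle and the free bundle of the same rank embed
in a common bundle of that rank (`exists_common_overbundle`), which transports both finiteness and
the sum from the free case. The same comparison makes degree additive in exact sequences
(`eulerChar_shortExact`) without using `H²`. -/

noncomputable section

namespace ThetaCurve

open TopologicalSpace Opposite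

set_option linter.unusedSectionVars false

section

variable {X : Scheme.{0}}

/-! ### Sections and stalks of sheaves of modules -/

/-- Restriction of sections. -/
def res (M : X.Modules) {U V : X.Opens} (i : V ≤ U) : Γ(M, U) →+ Γ(M, V) :=
  (M.presheaf.map (homOfLE i).op).hom

/-- Restriction of functions. -/
def resO {U V : X.Opens} (i : V ≤ U) : Γ(X, U) →+* Γ(X, V) :=
  (X.presheaf.map (homOfLE i).op).hom

lemma res_smul (M : X.Modules) {U V : X.Opens} (i : V ≤ U) (a : Γ(X, U)) (s : Γ(M, U)) :
    res M i (a • s) = resO i a • res M i s :=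
  Scheme.Modules.map_smul M (homOfLE i) a s

@[simp] lemma res_res (M : X.Modules) {U V W : X.Opens} (i : V ≤ U) (j : W ≤ V) (s : Γ(M, U)) :
    res M j (res M i s) = res M (j.trans i) s := by
  change (M.presheaf.map _ ≫ M.presheaf.map _) s = _
  rw [← Functor.map_comp]; rfl

@[simp] lemma res_self (M : X.Modules) {U : X.Opens} (i : U ≤ U) (s : Γ(M, U)) :
    res M i s = s := by
  change (M.presheaf.map (𝟙 _)) s = _
  rw [M.presheaf.map_id]; rfl

lemma app_res {M N : X.Modules} (f : M ⟶ N) {U V : X.Opens} (i : V ≤ U) (s : Γ(M, U)) :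
    f.app V (res M i s) = res N i (f.app U s) :=
  ConcreteCategory.congr_hom (f.mapPresheaf.naturality (homOfLE i).op) s

/-- The stalk of a sheaf of modules. -/
def stalk (M : X.Modules) (x : X) : Type := ↑(TopCat.Presheaf.stalk M.presheaf x)

instance (M : X.Modules) (x : X) : AddCommGroup (stalk M x) :=
  inferInstanceAs (AddCommGroup ↑(TopCat.Presheaf.stalk M.presheaf x))

instance (M : X.Modules) (x : X) : Module (X.presheaf.stalk x) (stalk M x) :=
  PresheafOfModules.instModuleCarrierStalkCommRingCatCarrierAbPresheafOpensCarrier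
    (R := X.presheaf) M.val x

/-- The germ of a section. -/
def germ (M : X.Modules) {U : X.Opens} (x : X) (hx : x ∈ U) : Γ(M, U) →+ stalk M x :=
  (TopCat.Presheaf.germ M.presheaf U x hx).hom

/-- The germ of a function. -/
def germO {U : X.Opens} (x : X) (hx : x ∈ U) : Γ(X, U) →+* X.presheaf.stalk x :=
  (X.presheaf.germ U x hx).hom

lemma germ_smul (M : X.Modules) {U : X.Opens} (x : X) (hx : x ∈ U) (a : Γ(X, U)) (s : Γ(M, U)) :
    germ M x hx (a • s) = germO x hx a • germ M x hx s :=
  PresheafOfModules.germ_smul (R := X.presheaf) M.val x U hx a s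

@[simp] lemma germ_res (M : X.Modules) {U V : X.Opens} (i : V ≤ U) (x : X) (hx : x ∈ V)
    (s : Γ(M, U)) : germ M x hx (res M i s) = germ M x (i hx) s :=
  TopCat.Presheaf.germ_res_apply M.presheaf (homOfLE i) x hx s

@[simp] lemma germO_resO {U V : X.Opens} (i : V ≤ U) (x : X) (hx : x ∈ V)
    (s : Γ(X, U)) : germO x hx (resO i s) = germO x (i hx) s :=
  TopCat.Presheaf.germ_res_apply X.presheaf (homOfLE i) x hx s

lemma exists_germ (M : X.Modules) {x : X} (t : stalk M x) :
    ∃ (U : X.Opens) (hx : x ∈ U) (s : Γ(M, U)), germ M x hx s = t := by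
  obtain ⟨U, hx, s, h⟩ := TopCat.Presheaf.exists_germ_eq M.presheaf (x := x) t
  exact ⟨U, hx, s, h⟩

lemma exists_germO {x : X} (t : X.presheaf.stalk x) :
    ∃ (U : X.Opens) (hx : x ∈ U) (s : Γ(X, U)), germO x hx s = t := by
  obtain ⟨U, hx, s, h⟩ := TopCat.Presheaf.exists_germ_eq X.presheaf (x := x) t
  exact ⟨U, hx, s, h⟩

lemma germ_eq (M : X.Modules) {U V : X.Opens} {x : X} (hU : x ∈ U) (hV : x ∈ V)
    {s : Γ(M, U)} {t : Γ(M, V)} (h : germ M x hU s = germ M x hV t) :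
    ∃ (W : X.Opens) (_ : x ∈ W) (i : W ≤ U) (j : W ≤ V), res M i s = res M j t := by
  obtain ⟨W, hW, i, j, e⟩ := TopCat.Presheaf.germ_eq M.presheaf x hU hV s t h
  exact ⟨W, hW, leOfHom i, leOfHom j, e⟩

lemma section_ext (M : X.Modules) {U : X.Opens} {s t : Γ(M, U)}
    (h : ∀ (x : X) (hx : x ∈ U), germ M x hx s = germ M x hx t) : s = t :=
  TopCat.Presheaf.section_ext ⟨M.presheaf, M.isSheaf⟩ U s t h

lemma sectionO_ext {U : X.Opens} {s t : Γ(X, U)}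
    (h : ∀ (x : X) (hx : x ∈ U), germO x hx s = germO x hx t) : s = t :=
  TopCat.Presheaf.section_ext X.sheaf U s t h

/-- Gluing of local sections, indexed by the points of `U`, that have compatible germs. -/
lemma exists_glue (M : X.Modules) {U : X.Opens} (τ : ∀ x : X, stalk M x)
    (h : ∀ x ∈ U, ∃ (V : X.Opens) (_ : x ∈ V) (_ : V ≤ U) (s : Γ(M, V)),
      ∀ (y : X) (hy : y ∈ V), germ M y hy s = τ y) :
    ∃ s : Γ(M, U), ∀ (y : X) (hy : y ∈ U), germ M y hy s = τ y := by
  choose V hV i s hs using h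
  let F : TopCat.Sheaf Ab X := ⟨M.presheaf, M.isSheaf⟩
  have cover : U ≤ iSup (fun x : U => V x.1 x.2) := fun x hx =>
    Opens.mem_iSup.2 ⟨⟨x, hx⟩, hV x hx⟩
  obtain ⟨t, ht, -⟩ := TopCat.Sheaf.existsUnique_gluing' F (fun x : U => V x.1 x.2) U
    (fun x => homOfLE (i x.1 x.2)) cover (fun x => s x.1 x.2) (by
      intro x y
      apply section_ext M
      intro z hz
      change germ M z hz (res M inf_le_left _) = germ M z hz (res M inf_le_right _)
      rw [germ_res, germ_res, hs, hs])
  refine ⟨t, fun y hy => ?_⟩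
  have := ht ⟨y, hy⟩
  rw [← hs y hy y (hV y hy), ← this]
  exact (germ_res M (i y hy) y (hV y hy) t).symm

/-- The map induced on stalks. -/
def stalkMap {M N : X.Modules} (f : M ⟶ N) (x : X) :
    stalk M x →ₗ[X.presheaf.stalk x] stalk N x where
  toFun := ((TopCat.Presheaf.stalkFunctor Ab x).map f.mapPresheaf).hom
  map_add' := map_add _
  map_smul' a m := by
    obtain ⟨U, hU, a, rfl⟩ := exists_germO a
    obtain ⟨V, hV, m, rfl⟩ := exists_germ M m
    have key : ∀ {W : X.Opens} (hW : x ∈ W) (s : Γ(M, W)),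
        ((TopCat.Presheaf.stalkFunctor Ab x).map f.mapPresheaf).hom (germ M x hW s) =
          germ N x hW (f.app W s) := fun hW s =>
      TopCat.Presheaf.stalkFunctor_map_germ_apply _ x hW f.mapPresheaf s
    have hW : x ∈ U ⊓ V := ⟨hU, hV⟩
    rw [← germO_resO inf_le_left x hW a, ← germ_res M inf_le_right x hW m]
    rw [← germ_smul, key, key, Scheme.Modules.Hom.app_smul, germ_smul]
    rfl

@[simp] lemma stalkMap_germ {M N : X.Modules} (f : M ⟶ N) {U : X.Opens} (x : X) (hx : x ∈ U)
    (s : Γ(M, U)) : stalkMap f x (germ M x hx s) = germ N x hx (f.app U s) :=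
  TopCat.Presheaf.stalkFunctor_map_germ_apply _ x hx f.mapPresheaf s

lemma stalkMap_comp {M N P : X.Modules} (f : M ⟶ N) (g : N ⟶ P) (x : X) (m : stalk M x) :
    stalkMap (f ≫ g) x m = stalkMap g x (stalkMap f x m) := by
  obtain ⟨U, hU, s, rfl⟩ := exists_germ M m
  simp

lemma stalkMap_id (M : X.Modules) (x : X) (m : stalk M x) :
    stalkMap (𝟙 M) x m = m := by
  obtain ⟨U, hU, s, rfl⟩ := exists_germ M m
  simp

lemma stalkMap_zero (M N : X.Modules) (x : X) : stalkMap (0 : M ⟶ N) x = 0 := by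
  ext m
  obtain ⟨U, hU, s, rfl⟩ := exists_germ M m
  simp

lemma stalkMap_add {M N : X.Modules} (f g : M ⟶ N) (x : X) :
    stalkMap (f + g) x = stalkMap f x + stalkMap g x := by
  ext m
  obtain ⟨U, hU, s, rfl⟩ := exists_germ M m
  simp

lemma hom_ext_stalk {M N : X.Modules} {f g : M ⟶ N} (h : ∀ x, stalkMap f x = stalkMap g x) :
    f = g := by
  apply Scheme.Modules.hom_ext
  intro U
  ext s
  apply section_ext N
  intro x hx
  have := congr($(h x) (germ M x hx s))
  simpa using this

/-- A morphism of sheaves of modules from a compatible family of linear maps. -/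
def homMk {M N : X.Modules} (φ : ∀ U : X.Opens, Γ(M, U) →+ Γ(N, U))
    (hs : ∀ U (a : Γ(X, U)) (s : Γ(M, U)), φ U (a • s) = a • φ U s)
    (hr : ∀ {U V : X.Opens} (i : V ≤ U) (s : Γ(M, U)), φ V (res M i s) = res N i (φ U s)) :
    M ⟶ N where
  val := PresheafOfModules.homMk
    { app := fun U => AddCommGrpCat.ofHom (φ U.unop)
      naturality := fun U V i => by
        ext s
        exact hr (leOfHom i.unop) s }
    (fun U a m => hs U.unop a m)

lemma mono_of_app_injective {M N : X.Modules} (f : M ⟶ N)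
    (h : ∀ U, Function.Injective (f.app U)) : Mono f where
  right_cancellation g₁ g₂ e := by
    apply Scheme.Modules.hom_ext
    intro U
    ext s
    exact h U (congr(($e).app U s))

lemma app_injective {M N : X.Modules} (f : M ⟶ N) [Mono f] (U : X.Opens) :
    Function.Injective (f.app U) := by
  have : Mono ((Scheme.Modules.toPresheaf X).map f) := inferInstance
  have h2 := (NatTrans.mono_iff_mono_app _).1 this (op U)
  exact (AddCommGrpCat.mono_iff_injective _).1 h2

lemma stalkMap_injective {M N : X.Modules} (f : M ⟶ N) [Mono f] (x : X) :
    Function.Injective (stalkMap f x) :=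
  TopCat.Presheaf.stalkFunctor_map_injective_of_app_injective
    (f := f.mapPresheaf) (fun U => app_injective f U) x

lemma mono_of_stalkMap_injective {M N : X.Modules} (f : M ⟶ N)
    (h : ∀ x, Function.Injective (stalkMap f x)) : Mono f := by
  apply mono_of_app_injective
  intro U s t e
  apply section_ext M
  intro x hx
  apply h
  simp [e]

lemma epi_of_stalkMap_surjective {M N : X.Modules} (f : M ⟶ N)
    (h : ∀ x, Function.Surjective (stalkMap f x)) : Epi f where
  left_cancellation g₁ g₂ e := by
    apply hom_ext_stalk
    intro x
    ext n
    obtain ⟨m, rfl⟩ := h x n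
    rw [← stalkMap_comp, ← stalkMap_comp, e]

lemma isIso_of_stalkMap_bijective {M N : X.Modules} (f : M ⟶ N)
    (h : ∀ x, Function.Bijective (stalkMap f x)) : IsIso f := by
  have := mono_of_stalkMap_injective f (fun x => (h x).1)
  have := epi_of_stalkMap_surjective f (fun x => (h x).2)
  exact isIso_of_mono_of_epi f

end

section

variable {X : Scheme.{0}}

/-! ### Skyscraper sheaves of modules -/

/-- A linear map out of a stalk is determined by compatible maps on sections. -/
lemma exists_stalkLift (M : X.Modules) (x : X) {A : Type*} [AddCommGroup A]
    (φ : ∀ U : X.Opens, x ∈ U → (Γ(M, U) →+ A))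
    (hφ : ∀ {U V : X.Opens} (i : V ≤ U) (hV : x ∈ V) (s : Γ(M, U)),
      φ V hV (res M i s) = φ U (i hV) s) :
    ∃ ψ : stalk M x →+ A, ∀ (U : X.Opens) (hU : x ∈ U) (s : Γ(M, U)),
      ψ (germ M x hU s) = φ U hU s := by
  choose U hU s hs using fun t : stalk M x => exists_germ M t
  have key : ∀ {V W : X.Opens} (hV : x ∈ V) (hW : x ∈ W) (s : Γ(M, V)) (t : Γ(M, W)),
      germ M x hV s = germ M x hW t → φ V hV s = φ W hW t := by
    intro V W hV hW s t e
    obtain ⟨Z, hZ, i, j, e⟩ := germ_eq M hV hW e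
    rw [← hφ i hZ, ← hφ j hZ, e]
  refine ⟨AddMonoidHom.mk' (fun t => φ _ (hU t) (s t)) fun a b => ?_, fun V hV t => ?_⟩
  · have hW : x ∈ U a ⊓ U b := ⟨hU a, hU b⟩
    rw [← hφ inf_le_left hW (s a), ← hφ inf_le_right hW (s b), ← map_add]
    apply key
    rw [hs, map_add, germ_res, germ_res, hs, hs]
  · exact key _ _ _ _ (hs _)

/-- Sections of a skyscraper sheaf. -/
def SkySec (x : X) (M : Type) (U : X.Opens) : Type := PLift (x ∈ U) → M

instance (x : X) (M : Type) [AddCommGroup M] (U : X.Opens) : AddCommGroup (SkySec x M U) :=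
  inferInstanceAs (AddCommGroup (PLift (x ∈ U) → M))

instance (x : X) (M : Type) [AddCommGroup M] [Module (X.presheaf.stalk x) M] (U : X.Opens) :
    Module Γ(X, U) (SkySec x M U) where
  smul a m := fun h => germO x h.down a • m h
  one_smul m := by
    funext h; change germO x h.down 1 • m h = m h; rw [map_one, one_smul]
  mul_smul a b m := by
    funext h
    change germO x h.down (a * b) • m h = germO x h.down a • germO x h.down b • m h
    rw [map_mul, mul_smul]
  smul_zero a := by funext h; exact smul_zero (germO x h.down a)
  smul_add a m n := by funext h; exact smul_add (germO x h.down a) (m h) (n h)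
  add_smul a b m := by
    funext h
    change germO x h.down (a + b) • m h = germO x h.down a • m h + germO x h.down b • m h
    rw [map_add, add_smul]
  zero_smul m := by
    funext h; change germO x h.down 0 • m h = 0; rw [map_zero, zero_smul]

/-- The presheaf of sections of a skyscraper sheaf. -/
def skyPresheaf (x : X) (M : Type) [AddCommGroup M] : TopCat.Presheaf Ab.{0} X where
  obj U := AddCommGrpCat.of (SkySec x M U.unop)
  map {U V} i := AddCommGrpCat.ofHom (X := SkySec x M U.unop) (Y := SkySec x M V.unop)
    { toFun := fun m h => m ⟨leOfHom i.unop h.down⟩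
      map_zero' := rfl
      map_add' := fun _ _ => rfl }
  map_id _ := rfl
  map_comp _ _ := rfl

/-- The value over a union containing `x` can be read off on any member containing `x`;
compatibility on overlaps makes the choice irrelevant. -/
lemma skyPresheaf_isSheaf (x : X) (M : Type) [AddCommGroup M] : (skyPresheaf x M).IsSheaf := by
  rw [TopCat.Presheaf.isSheaf_iff_isSheafUniqueGluing]
  intro ι U (sf : ∀ i, SkySec x M (U i)) hsf
  let s : SkySec x M (iSup U) := fun h =>
    sf (Opens.mem_iSup.1 h.down).choose ⟨(Opens.mem_iSup.1 h.down).choose_spec⟩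
  refine ⟨(s : SkySec x M (iSup U)), fun i => ?_, fun (t : SkySec x M (iSup U)) ht => ?_⟩
  · refine funext fun (h : PLift (x ∈ U i)) => ?_
    have hx : x ∈ iSup U := Opens.mem_iSup.2 ⟨i, h.down⟩
    exact congr_fun (hsf (Opens.mem_iSup.1 hx).choose i)
      ⟨(Opens.mem_iSup.1 hx).choose_spec, h.down⟩
  · refine funext fun (h : PLift (x ∈ iSup U)) => ?_
    exact congr_fun (ht (Opens.mem_iSup.1 h.down).choose) ⟨(Opens.mem_iSup.1 h.down).choose_spec⟩

/-- The skyscraper sheaf at `x` of an `𝒪_{X,x}`-module. -/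
def sky (x : X) (M : Type) [AddCommGroup M] [Module (X.presheaf.stalk x) M] : X.Modules where
  val :=
    letI : ∀ U : (X.Opens)ᵒᵖ, Module (X.ringCatSheaf.obj.obj U) ((skyPresheaf x M).obj U) :=
      fun U => inferInstanceAs (Module Γ(X, U.unop) (SkySec x M U.unop))
    PresheafOfModules.ofPresheaf (R := X.ringCatSheaf.obj) (skyPresheaf x M) (by
      intro U V f r m
      refine funext fun (h : PLift (x ∈ V.unop)) => ?_
      have := germO_resO (leOfHom f.unop) x h.down r
      change germO x (leOfHom f.unop h.down) r • (show SkySec x M U.unop from m) _ =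
        germO x h.down (resO (leOfHom f.unop) r) • (show SkySec x M U.unop from m) _
      rw [this])
  isSheaf := skyPresheaf_isSheaf x M

section

variable (x : X) (M : Type) [AddCommGroup M] [Module (X.presheaf.stalk x) M]

/-- The value of a section of a skyscraper sheaf. -/
def skyEval (U : X.Opens) (h : x ∈ U) : Γ(sky x M, U) →+ M where
  toFun m := (show SkySec x M U from m) ⟨h⟩
  map_zero' := rfl
  map_add' _ _ := rfl

/-- The section of a skyscraper sheaf with a given value. -/
def skyMk (U : X.Opens) (m : x ∈ U → M) : Γ(sky x M, U) :=
  show SkySec x M U from fun h => m h.down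

@[simp] lemma skyEval_skyMk (U : X.Opens) (h : x ∈ U) (m : x ∈ U → M) :
    skyEval x M U h (skyMk x M U m) = m h := rfl

lemma sky_ext (U : X.Opens) {m n : Γ(sky x M, U)}
    (h : ∀ hx : x ∈ U, skyEval x M U hx m = skyEval x M U hx n) : m = n :=
  funext fun hx : PLift (x ∈ U) => h hx.down

lemma skyEval_smul (U : X.Opens) (a : Γ(X, U)) (m : Γ(sky x M, U)) (h : x ∈ U) :
    skyEval x M U h (a • m) = germO x h a • skyEval x M U h m := rfl

lemma exists_skyCounit : ∃ ε : stalk (sky x M) x →ₗ[X.presheaf.stalk x] M,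
    ∀ (U : X.Opens) (hU : x ∈ U) (m : Γ(sky x M, U)),
      ε (germ _ x hU m) = skyEval x M U hU m := by
  obtain ⟨ψ, hψ⟩ := exists_stalkLift (sky x M) x (A := M)
    (fun U hU => skyEval x M U hU) (fun i hV s => rfl)
  refine ⟨{ ψ with map_smul' := fun a t => ?_ }, hψ⟩
  obtain ⟨U, hU, a, rfl⟩ := exists_germO a
  obtain ⟨V, hV, t, rfl⟩ := exists_germ _ t
  have hW : x ∈ U ⊓ V := ⟨hU, hV⟩
  rw [← germO_resO inf_le_left x hW a, ← germ_res _ inf_le_right x hW t, ← germ_smul]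
  change ψ _ = _ • ψ _
  rw [hψ, hψ, skyEval_smul, RingHom.id_apply]

/-- The canonical map from the stalk of a skyscraper sheaf. -/
def skyCounit : stalk (sky x M) x →ₗ[X.presheaf.stalk x] M := (exists_skyCounit x M).choose

@[simp] lemma skyCounit_germ {U : X.Opens} (hU : x ∈ U) (m : Γ(sky x M, U)) :
    skyCounit x M (germ _ x hU m) = skyEval x M U hU m :=
  (exists_skyCounit x M).choose_spec U hU m

lemma skyCounit_bijective : Function.Bijective (skyCounit x M) := by
  constructor
  · rw [injective_iff_map_eq_zero]
    intro t ht
    obtain ⟨U, hU, t, rfl⟩ := exists_germ _ t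
    rw [skyCounit_germ] at ht
    have : t = (0 : Γ(sky x M, U)) := sky_ext x M U fun h => by rw [ht, map_zero]
    rw [this, map_zero]
  · intro m
    exact ⟨germ (sky x M) x (U := ⊤) trivial (skyMk x M ⊤ fun _ => m),
      skyCounit_germ x M _ _⟩

variable {x M} in
/-- The morphism to a skyscraper sheaf defined by a linear map on the stalk. -/
def skyLift {E : X.Modules} (φ : stalk E x →ₗ[X.presheaf.stalk x] M) : E ⟶ sky x M :=
  homMk (fun U =>
    { toFun := fun s => skyMk x M U fun h => φ (germ E x h s)
      map_zero' := sky_ext x M U fun h => by simp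
      map_add' := fun s t => sky_ext x M U fun h => by simp })
    (fun U a s => sky_ext x M U fun h => by
      change φ (germ E x h (a • s)) = germO x h a • φ (germ E x h s)
      rw [germ_smul, map_smul])
    (fun i s => sky_ext x M _ fun h => by
      change φ (germ E x h (res E i s)) = φ (germ E x (i h) s)
      rw [germ_res])

@[simp] lemma skyLift_app {E : X.Modules} (φ : stalk E x →ₗ[X.presheaf.stalk x] M) (U : X.Opens)
    (s : Γ(E, U)) (h : x ∈ U) :
    skyEval x M U h ((skyLift φ).app U s) = φ (germ E x h s) := rfl

@[simp] lemma skyCounit_stalkMap_skyLift {E : X.Modules} (φ : stalk E x →ₗ[X.presheaf.stalk x] M)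
    (t : stalk E x) : skyCounit x M (stalkMap (skyLift φ) x t) = φ t := by
  obtain ⟨U, hU, t, rfl⟩ := exists_germ _ t
  rw [stalkMap_germ, skyCounit_germ, skyLift_app]

lemma sky_hom_ext {E : X.Modules} {f g : E ⟶ sky x M}
    (h : stalkMap f x = stalkMap g x) : f = g := by
  apply Scheme.Modules.hom_ext
  intro U
  ext s
  refine sky_ext x M U fun hx => ?_
  have := congr(skyCounit x M ($h (germ E x hx s)))
  simpa using this

lemma sky_hom_ext_of_comp {E : X.Modules} {f g : E ⟶ sky x M}
    (h : (skyCounit x M).comp (stalkMap f x) = (skyCounit x M).comp (stalkMap g x)) : f = g := by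
  apply sky_hom_ext
  ext t
  exact (skyCounit_bijective x M).1 congr($h t)

lemma comp_skyLift {E E' : X.Modules} (f : E' ⟶ E) (φ : stalk E x →ₗ[X.presheaf.stalk x] M) :
    f ≫ skyLift φ = skyLift (φ.comp (stalkMap f x)) := by
  apply sky_hom_ext_of_comp
  ext t
  simp [stalkMap_comp]

lemma skyLift_counit {E : X.Modules} (f : E ⟶ sky x M) :
    skyLift ((skyCounit x M).comp (stalkMap f x)) = f := by
  apply sky_hom_ext_of_comp
  ext t
  simp

/-- The cokernel of the stalk map defines a skyscraper sheaf. The projection to it and the zero map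
agree after precomposing with the epimorphism `f`, so the cokernel vanishes. -/
lemma stalkMap_surjective {E F : X.Modules} (f : E ⟶ F) [Epi f] (x : X) :
    Function.Surjective (stalkMap f x) := by
  let N := LinearMap.range (stalkMap f x)
  have h : skyLift N.mkQ = skyLift 0 := by
    rw [← cancel_epi f, comp_skyLift, comp_skyLift]
    congr 1
    ext t
    simp [N]
  intro y
  have h2 := congr(skyCounit x _ (stalkMap $h x y))
  simpa [N] using h2

lemma exists_lift_of_epi {E F : X.Modules} (f : E ⟶ F) [Epi f] {U : X.Opens} (s : Γ(F, U))
    {x : X} (hx : x ∈ U) : ∃ (V : X.Opens) (_ : x ∈ V) (i : V ≤ U) (t : Γ(E, V)),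
      f.app V t = res F i s := by
  obtain ⟨t, ht⟩ := stalkMap_surjective f x (germ F x hx s)
  obtain ⟨W, hW, t, rfl⟩ := exists_germ E t
  rw [stalkMap_germ] at ht
  obtain ⟨V, hV, i, j, e⟩ := germ_eq F hW hx ht
  exact ⟨V, hV, j, res E i t, by rw [app_res, e]⟩

/-- Maps to a skyscraper are maps out of the stalk, and taking stalks preserves monomorphisms, so
injectivity passes from the module to the sheaf. -/
instance sky_injective [Module.Injective (X.presheaf.stalk x) M] : Injective (sky x M) where
  factors {A B} g f _ := by
    obtain ⟨ψ, hψ⟩ := Module.Injective.out (stalkMap f x) (stalkMap_injective f x)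
      ((skyCounit x M).comp (stalkMap g x))
    refine ⟨skyLift ψ, ?_⟩
    conv_rhs => rw [← skyLift_counit x M g]
    rw [comp_skyLift]
    congr 1
    ext t
    exact hψ t

end

/-- Godement's construction: embed every stalk in an injective module and take the product of the
resulting skyscrapers. -/
instance enoughInjectives_modules : EnoughInjectives X.Modules where
  presentation E := by
    let J (x : X) := (EnoughInjectives.presentation
      (ModuleCat.of (X.presheaf.stalk x) (stalk E x))).some
    have hJ (x : X) : Module.Injective (X.presheaf.stalk x) (J x).J :=
      haveI : Injective (ModuleCat.of (X.presheaf.stalk x) (J x).J) := (J x).injective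
      Module.injective_module_of_injective_object _ _
    let f : E ⟶ ∏ᶜ fun x : X => sky x (J x).J := Pi.lift fun x => skyLift (J x).f.hom
    have hf : Mono f := by
      constructor
      intro Z a b e
      apply hom_ext_stalk
      intro x
      have h1 : a ≫ skyLift (J x).f.hom = b ≫ skyLift (J x).f.hom := by
        have := e =≫ Pi.π (fun x : X => sky x (J x).J) x
        simpa [f] using this
      ext t
      have h2 := congr(skyCounit x _ (stalkMap $h1 x t))
      rw [stalkMap_comp, stalkMap_comp, skyCounit_stalkMap_skyLift,
        skyCounit_stalkMap_skyLift] at h2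
      exact (ModuleCat.mono_iff_injective _).1 (J x).mono h2
    exact ⟨⟨∏ᶜ fun x : X => sky x (J x).J, inferInstance, f, hf⟩⟩

/-! ### Exact sequences -/

/-- Taking sections over `U` preserves limits, hence kernels. -/
lemma exact_app {S : ShortComplex X.Modules} (hS : S.Exact) [Mono S.f] (U : X.Opens)
    (s : Γ(S.X₂, U)) (hs : S.g.app U s = 0) : ∃ t : Γ(S.X₁, U), S.f.app U t = s := by
  let F : X.Modules ⥤ Ab := Scheme.Modules.toPresheaf X ⋙ (evaluation _ _).obj (op U)
  have hF : F.PreservesZeroMorphisms := ⟨fun _ _ => rfl⟩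
  have hl0 : PreservesLimits ((evaluation X.Opensᵒᵖ Ab.{0}).obj (op U)) :=
    ⟨fun {J} _ => Limits.evaluation_preservesLimitsOfShape _⟩
  have hl : PreservesLimits F :=
    comp_preservesLimits (Scheme.Modules.toPresheaf X) ((evaluation _ _).obj (op U))
  have h1 := hS.map_of_mono_of_preservesKernel F inferInstance inferInstance
  rw [ShortComplex.ab_exact_iff] at h1
  exact h1 s hs

lemma exact_stalk {S : ShortComplex X.Modules} (hS : S.Exact) [Mono S.f] (x : X)
    (s : stalk S.X₂ x) (hs : stalkMap S.g x s = 0) : ∃ t, stalkMap S.f x t = s := by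
  obtain ⟨U, hU, s, rfl⟩ := exists_germ _ s
  rw [stalkMap_germ, ← map_zero (germ S.X₃ x hU)] at hs
  obtain ⟨W, hW, i, j, e⟩ := germ_eq _ hU hU hs
  rw [← app_res, map_zero] at e
  obtain ⟨t, ht⟩ := exact_app hS W _ e
  exact ⟨germ _ x hW t, by rw [stalkMap_germ, ht, germ_res]⟩

end

section

/-! ### Geometry of a smooth projective curve -/

/-! ### Smooth local rings of relative dimension one are discrete valuation rings. -/

section Algebra

open IsLocalRing KaehlerDifferential TensorProduct Module

/-- In characteristic zero the residue field is formally smooth over `k`, so `𝔪/𝔪²` injects into `κ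
⊗ Ω[R⁄k]`, which is one-dimensional. If the cotangent space were zero, `R` would be a field, so `𝔪 =
0` in `A` and `A` would be finite over the algebraically closed `k`; then `A = k` and `Ω[A⁄k] = 0`,
against its rank one. -/
lemma isDiscreteValuationRing_of_smooth (k A R : Type) [Field k] [IsAlgClosed k] [CharZero k] [CommRing A] 
    [IsDomain A] [Algebra k A] [Algebra.IsStandardSmoothOfRelativeDimension 1 k A] [CommRing R] [IsDomain R]
    [IsLocalRing R]
    [Algebra A R] [Algebra k R] [IsScalarTower k A R] (m : Ideal A) [m.IsMaximal]
    [IsLocalization.AtPrime R m] : IsDiscreteValuationRing R := by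
  have hss : Algebra.IsStandardSmooth k A :=
    Algebra.IsStandardSmoothOfRelativeDimension.isStandardSmooth 1
  have hfp : Algebra.FinitePresentation k A := inferInstance
  have : IsNoetherianRing A := Algebra.FiniteType.isNoetherianRing k A
  have : IsNoetherianRing R := IsLocalization.isNoetherianRing m.primeCompl R inferInstance
  have hfsA : Algebra.FormallySmooth k A := inferInstance
  have : Algebra.FormallyEtale A R := Algebra.FormallyEtale.of_isLocalization m.primeCompl
  have : Algebra.FormallySmooth k R := Algebra.FormallySmooth.comp k A R
  have : Algebra.EssFiniteType A R := Algebra.EssFiniteType.of_isLocalization R m.primeCompl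
  have : Algebra.EssFiniteType k R := Algebra.EssFiniteType.comp k A R
  have : Algebra.EssFiniteType R (ResidueField R) := inferInstance
  have : Algebra.EssFiniteType k (ResidueField R) := Algebra.EssFiniteType.comp k R _
  have : Algebra.FormallySmooth k (ResidueField R) := inferInstance
  have : Subsingleton (Algebra.H1Cotangent k (ResidueField R)) := inferInstance
  have hinj := (Algebra.FormallySmooth.kerCotangentToTensor_injective_iff (R := k) (P := R)
    (A := ResidueField R) residue_surjective).2 this
  have hrk : Module.rank A (Ω[A⁄k]) = 1 := by
    simpa using Algebra.IsStandardSmoothOfRelativeDimension.rank_kaehlerDifferential (R := k) (S := A) 1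
  have : Module.Free A Ω[A⁄k] := inferInstance
  have hb := KaehlerDifferential.isBaseChange_of_formallyEtale k A R
  have : Module.Free R Ω[R⁄k] := Module.Free.of_equiv hb.equiv
  have hrkR : finrank R (Ω[R⁄k]) = 1 := by
    rw [← hb.equiv.finrank_eq, Module.finrank_baseChange, finrank, hrk]; simp
  have : Module.Finite R Ω[R⁄k] := inferInstance
  have h1 : finrank (ResidueField R) (ResidueField R ⊗[R] Ω[R⁄k]) = 1 := by
    rw [Module.finrank_baseChange, hrkR]
  have hle : finrank (ResidueField R) (CotangentSpace R) ≤ 1 := by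
    obtain ⟨g, hg⟩ : ∃ g : (maximalIdeal R).Cotangent →ₗ[R] ResidueField R ⊗[R] Ω[R⁄k],
        Function.Injective g := by
      have e : RingHom.ker (algebraMap R (ResidueField R)) = maximalIdeal R :=
        IsLocalRing.ker_residue
      rw [← e]
      exact ⟨_, hinj⟩
    rw [← h1]
    exact LinearMap.finrank_le_finrank_of_injective
      (f := g.extendScalarsOfSurjective residue_surjective) hg
  have hnf : ¬ IsField R := by
    intro hR
    have hm : m = ⊥ := by
      refine (Submodule.eq_bot_iff _).2 fun a ha => ?_
      have h2 : algebraMap A R a ∈ maximalIdeal R :=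
        (IsLocalization.AtPrime.to_map_mem_maximal_iff R m a).2 ha
      rw [isField_iff_maximalIdeal_eq.1 hR, Ideal.mem_bot] at h2
      exact (IsLocalization.injective R m.primeCompl_le_nonZeroDivisors) (by rw [h2, map_zero])
    have hA : IsField A := by
      subst hm
      exact Ring.isField_iff_maximal_bot.2 ‹_›
    let := hA.toField
    have : Module.Finite k A := finite_of_finite_type_of_isJacobsonRing k A
    have hs : Function.Surjective (algebraMap k A) :=
      (IsAlgClosed.algebraMap_bijective_of_isIntegral (k := k) (K := A)).2
    have : Subsingleton (Ω[A⁄k]) := KaehlerDifferential.subsingleton_of_surjective k A hs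
    rw [rank_subsingleton'] at hrk
    exact zero_ne_one hrk
  rw [← finrank_CotangentSpace_eq_one_iff]
  refine le_antisymm hle (Nat.one_le_iff_ne_zero.2 fun h0 => hnf ?_)
  exact finrank_cotangentSpace_eq_zero_iff.1 h0

end Algebra

section

variable {C : Scheme.{0}} [C.Over (Spec (.of ℂ))] [hC : IsSmoothProjectiveCurve C]

instance : IsIntegral C := hC.isIntegral

instance : IsProper (C ↘ Spec (.of ℂ)) := hC.isProper

instance : SmoothOfRelativeDimension 1 (C ↘ Spec (.of ℂ)) := hC.smooth

lemma isDVR_stalk {p : C} (hp : IsClosed ({p} : Set C)) :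
    IsDiscreteValuationRing (C.presheaf.stalk p) := by
  obtain ⟨U, hU, V, hV, hx, e, hf⟩ :=
    SmoothOfRelativeDimension.exists_isStandardSmoothOfRelativeDimension (n := 1)
      (f := C ↘ Spec (.of ℂ)) p
  -- `Spec ℂ` has one point, so the standard smooth chart is over all of the base.
  have hUtop : U = ⊤ := by
    ext y
    have : y = (C ↘ Spec (.of ℂ)) p := Subsingleton.elim (α := PrimeSpectrum ℂ) _ _
    simpa [this] using e hx
  subst hUtop
  let φ : ℂ →+* Γ(C, V) :=
    ((C ↘ Spec (.of ℂ)).appLE ⊤ V e).hom.comp (Scheme.ΓSpecIso (.of ℂ)).inv.hom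
  have hφ : RingHom.IsStandardSmoothOfRelativeDimension 1 φ :=
    RingHom.isStandardSmoothOfRelativeDimension_respectsIso.2 _
      (Scheme.ΓSpecIso (.of ℂ)).symm.commRingCatIsoToRingEquiv hf
  have : Nonempty V := ⟨⟨p, hx⟩⟩
  let := φ.toAlgebra
  let : Algebra Γ(C, V) (C.presheaf.stalk p) := (C.presheaf.germ V p hx).hom.toAlgebra
  let : Algebra ℂ (C.presheaf.stalk p) :=
    ((C.presheaf.germ V p hx).hom.comp φ).toAlgebra
  have : IsScalarTower ℂ Γ(C, V) (C.presheaf.stalk p) := .of_algebraMap_eq fun _ => rfl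
  have : Algebra.IsStandardSmoothOfRelativeDimension 1 ℂ Γ(C, V) := hφ
  have h1 := hV.primeIdealOf_isMaximal_of_isClosed ⟨p, hx⟩ hp
  have h2 : IsLocalization.AtPrime (C.presheaf.stalk p) (hV.primeIdealOf ⟨p, hx⟩).asIdeal :=
    hV.isLocalization_stalk ⟨p, hx⟩
  exact isDiscreteValuationRing_of_smooth ℂ Γ(C, V) _ (hV.primeIdealOf ⟨p, hx⟩).asIdeal

/-- By compactness `x` specializes to a closed point `p`. Both `x` and the generic point then come
from the spectrum of the local ring at `p`, and a discrete valuation ring has only two primes. -/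
lemma eq_genericPoint_or_isClosed (x : C) : x = genericPoint C ∨ IsClosed ({x} : Set C) := by
  have : CompactSpace C := QuasiCompact.compactSpace_of_compactSpace (C ↘ Spec (.of ℂ))
  obtain ⟨p, hp, hcl⟩ := IsClosed.exists_closed_singleton (S := closure {x}) isClosed_closure
    ⟨x, subset_closure rfl⟩
  have hxp : x ⤳ p := specializes_iff_mem_closure.2 hp
  have := isDVR_stalk hcl
  have hηp : genericPoint C ⤳ p := genericPoint_specializes p
  have hr := Scheme.range_fromSpecStalk (X := C) (x := p)
  obtain ⟨q, hq⟩ := hr.symm.subset hxp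
  obtain ⟨q', hq'⟩ := hr.symm.subset hηp
  by_cases hq0 : q.asIdeal = ⊥
  · left
    have : q ⤳ q' := by
      refine (PrimeSpectrum.le_iff_specializes q q').1 ?_
      change q.asIdeal ≤ q'.asIdeal
      rw [hq0]
      exact bot_le
    have h3 := this.map (C.fromSpecStalk p).continuous
    rw [hq, hq'] at h3
    exact (h3.antisymm (genericPoint_specializes x)).eq
  · right
    have hm := (IsDiscreteValuationRing.iff_pid_with_one_nonzero_prime _).1 this |>.2
    have h4 : q = IsLocalRing.closedPoint _ := by
      refine PrimeSpectrum.ext ?_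
      exact hm.unique ⟨hq0, q.isPrime⟩ ⟨IsDiscreteValuationRing.not_a_field _, inferInstance⟩
    rw [h4, Scheme.fromSpecStalk_closedPoint] at hq
    rwa [← hq]

/-- The complement is a finite union of irreducible closed sets. The generic point of each lies
outside `U`, so it is a closed point and the component is that point. -/
lemma finite_compl (U : C.Opens) (hU : genericPoint C ∈ U) : ((U : Set C)ᶜ).Finite := by
  have : IsLocallyNoetherian C := LocallyOfFiniteType.isLocallyNoetherian (C ↘ Spec (.of ℂ))
  have : CompactSpace C := QuasiCompact.compactSpace_of_compactSpace (C ↘ Spec (.of ℂ))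
  have : IsNoetherian C := {}
  obtain ⟨S, hS, h1, h2, h3⟩ := NoetherianSpace.exists_finite_set_isClosed_irreducible
    (isClosed_compl_iff.2 U.isOpen)
  rw [h3]
  refine Set.Finite.sUnion hS fun Z hZ => ?_
  obtain ⟨y, hy⟩ := QuasiSober.sober (h2 Z hZ) (h1 Z hZ)
  have hyZ : y ∈ Z := hy.mem
  have hyU : y ∈ (U : Set C)ᶜ := by rw [h3]; exact ⟨Z, hZ, hyZ⟩
  rcases eq_genericPoint_or_isClosed y with h | h
  · exact absurd (h ▸ hU) hyU
  · rw [← hy.def, h.closure_eq]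
    exact Set.finite_singleton y

/-- This is the Nullstellensatz `κ(p) = ℂ`; the proof checks, after applying `Spec`, that the
isomorphism is the map induced by `scalars`. -/
lemma scalars_residue {p : C} (hp : IsClosed ({p} : Set C)) :
    Function.Bijective ((IsLocalRing.residue (C.presheaf.stalk p)).comp
      ((germO (U := ⊤) p trivial).comp (scalars C))) := by
  have h1 : (residueFieldIsoBase (C ↘ Spec (.of ℂ)) p hp).inv =
      (Scheme.ΓSpecIso (.of ℂ)).inv ≫ (C ↘ Spec (.of ℂ)).appTop ≫
        C.presheaf.germ ⊤ p trivial ≫ C.residue p := by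
    apply Spec.map_injective
    rw [SpecMap_residueFieldIsoBase_inv]
    simp only [Spec.map_comp, Category.assoc]
    rw [← Scheme.fromSpecStalk_toSpecΓ_assoc, ← Scheme.toSpecΓ_naturality_assoc,
      toSpecΓ_SpecMap_ΓSpecIso_inv, Category.comp_id]
    rfl
  have h2 : IsIso ((Scheme.ΓSpecIso (.of ℂ)).inv ≫ (C ↘ Spec (.of ℂ)).appTop ≫
        C.presheaf.germ ⊤ p trivial ≫ C.residue p) := by rw [← h1]; infer_instance
  exact (ConcreteCategory.isIso_iff_bijective _).1 h2

end

end

section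

variable {X : Scheme.{0}}

/-! ### The structure sheaf as a module, and frames -/

lemma mem_inf {U V : X.Opens} {x : X} (hU : x ∈ U) (hV : x ∈ V) : x ∈ U ⊓ V := ⟨hU, hV⟩

lemma mem_top (x : X) : x ∈ (⊤ : X.Opens) := trivial

instance : HasFiniteBiproducts X.Modules := Abelian.hasFiniteBiproducts

/-- A function as a section of the structure sheaf. -/
def toSec {U : X.Opens} (a : Γ(X, U)) : Γ(structureSheaf X, U) := a

/-- A section of the structure sheaf as a function. -/
def ofSec {U : X.Opens} (a : Γ(structureSheaf X, U)) : Γ(X, U) := a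

@[simp] lemma ofSec_toSec {U : X.Opens} (a : Γ(X, U)) : ofSec (toSec a) = a := rfl
@[simp] lemma toSec_ofSec {U : X.Opens} (a : Γ(structureSheaf X, U)) : toSec (ofSec a) = a := rfl
@[simp] lemma ofSec_zero {U : X.Opens} : ofSec (0 : Γ(structureSheaf X, U)) = 0 := rfl
lemma ofSec_add {U : X.Opens} (a b : Γ(structureSheaf X, U)) :
    ofSec (a + b) = ofSec a + ofSec b := rfl
lemma smul_toSec {U : X.Opens} (a b : Γ(X, U)) : a • toSec b = toSec (a * b) := rfl
lemma toSec_eq_smul {U : X.Opens} (a : Γ(X, U)) : toSec a = a • toSec 1 := by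
  rw [smul_toSec, mul_one]
lemma res_toSec {U V : X.Opens} (i : V ≤ U) (a : Γ(X, U)) :
    res (structureSheaf X) i (toSec a) = toSec (resO i a) := rfl
lemma ofSec_res {U V : X.Opens} (i : V ≤ U) (a : Γ(structureSheaf X, U)) :
    ofSec (res (structureSheaf X) i a) = resO i (ofSec a) := rfl
lemma ofSec_smul {U : X.Opens} (a : Γ(X, U)) (b : Γ(structureSheaf X, U)) :
    ofSec (a • b) = a * ofSec b := rfl

lemma exists_glueO {U : X.Opens} (τ : ∀ x : X, X.presheaf.stalk x)
    (h : ∀ x ∈ U, ∃ (V : X.Opens) (_ : x ∈ V) (_ : V ≤ U) (s : Γ(X, V)),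
      ∀ (y : X) (hy : y ∈ V), germO y hy s = τ y) :
    ∃ s : Γ(X, U), ∀ (y : X) (hy : y ∈ U), germO y hy s = τ y := by
  choose V hV i s hs using h
  have cover : U ≤ iSup (fun x : U => V x.1 x.2) := fun x hx =>
    Opens.mem_iSup.2 ⟨⟨x, hx⟩, hV x hx⟩
  obtain ⟨t, ht, -⟩ := TopCat.Sheaf.existsUnique_gluing' X.sheaf (fun x : U => V x.1 x.2) U
    (fun x => homOfLE (i x.1 x.2)) cover (fun x => s x.1 x.2) (by
      intro x y
      apply sectionO_ext
      intro z hz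
      change germO z hz (resO inf_le_left _) = germO z hz (resO inf_le_right _)
      rw [germO_resO, germO_resO, hs, hs])
  refine ⟨t, fun y hy => ?_⟩
  have := ht ⟨y, hy⟩
  rw [← hs y hy y (hV y hy), ← this]
  exact (germO_resO (i y hy) y (hV y hy) t).symm

/-- The morphism `𝒪 ⟶ M` defined by a global section. -/
def ofSection {M : X.Modules} (s : Γ(M, ⊤)) : structureSheaf X ⟶ M :=
  homMk (fun U =>
    { toFun := fun a => ofSec a • res M le_top s
      map_zero' := by rw [ofSec_zero, zero_smul]
      map_add' := fun a b => by rw [ofSec_add, add_smul] })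
    (fun U a t => by
      change ofSec (a • t) • res M le_top s = a • (ofSec t • res M le_top s : Γ(M, U))
      rw [ofSec_smul, mul_smul])
    (fun {U V} i t => by
      change ofSec (res (structureSheaf X) i t) • res M le_top s =
        res M i (ofSec t • res M le_top s)
      rw [ofSec_res, res_smul, res_res])

@[simp] lemma ofSection_app {M : X.Modules} (s : Γ(M, ⊤)) (U : X.Opens)
    (a : Γ(structureSheaf X, U)) : (ofSection s).app U a = ofSec a • res M le_top s := rfl

lemma hom_structureSheaf_app {M : X.Modules} (f : structureSheaf X ⟶ M) {U : X.Opens}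
    (a : Γ(structureSheaf X, U)) :
    f.app U a = ofSec a • res M le_top (f.app ⊤ (toSec 1)) := by
  rw [← app_res, res_toSec, map_one, ← Scheme.Modules.Hom.app_smul, smul_toSec, mul_one,
    toSec_ofSec]

lemma hom_structureSheaf_ext {M : X.Modules} {f g : structureSheaf X ⟶ M}
    (h : f.app ⊤ (toSec 1) = g.app ⊤ (toSec 1)) : f = g := by
  apply Scheme.Modules.hom_ext
  intro U
  ext a
  exact (hom_structureSheaf_app f a).trans (by rw [h, ← hom_structureSheaf_app])

/-- The linear combination of the germs of some sections. -/
def comb (M : X.Modules) {n : ℕ} {U : X.Opens} (e : Fin n → Γ(M, U)) (y : X) (hy : y ∈ U) :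
    (Fin n → X.presheaf.stalk y) →ₗ[X.presheaf.stalk y] stalk M y :=
  Fintype.linearCombination (X.presheaf.stalk y) fun j => germ M y hy (e j)

lemma comb_apply (M : X.Modules) {n : ℕ} {U : X.Opens} (e : Fin n → Γ(M, U)) (y : X) (hy : y ∈ U)
    (c : Fin n → X.presheaf.stalk y) : comb M e y hy c = ∑ j, c j • germ M y hy (e j) := rfl

lemma comb_germ (M : X.Modules) {n : ℕ} {U V : X.Opens} (i : V ≤ U) (e : Fin n → Γ(M, U)) (y : X)
    (hy : y ∈ V) (a : Fin n → Γ(X, V)) :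
    comb M e y (i hy) (fun j => germO y hy (a j)) = germ M y hy (∑ j, a j • res M i (e j)) := by
  rw [comb_apply, map_sum]
  refine Finset.sum_congr rfl fun j _ => ?_
  rw [germ_smul, germ_res]

/-- Sections that form a basis of all stalks over `U`. -/
def IsFrame (M : X.Modules) {n : ℕ} {U : X.Opens} (e : Fin n → Γ(M, U)) : Prop :=
  ∀ (y : X) (hy : y ∈ U), Function.Bijective (comb M e y hy)

/-- Finitely many germs of functions are defined on a common neighborhood. -/
lemma exists_common_germO {n : ℕ} {x : X} (U : X.Opens) (hU : x ∈ U)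
    (c : Fin n → X.presheaf.stalk x) :
    ∃ (V : X.Opens) (hx : x ∈ V) (_ : V ≤ U) (a : Fin n → Γ(X, V)),
      ∀ j, germO x hx (a j) = c j := by
  induction n with
  | zero => exact ⟨U, hU, le_rfl, Fin.elim0, fun j => j.elim0⟩
  | succ n ih =>
    obtain ⟨V, hV, i, a, ha⟩ := ih (fun j => c j.succ)
    obtain ⟨W, hW, b, hb⟩ := exists_germO (c 0)
    refine ⟨V ⊓ W, mem_inf hV hW, inf_le_left.trans i,
      Fin.cons (resO inf_le_right b) fun j => resO inf_le_left (a j), fun j => ?_⟩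
    refine Fin.cases ?_ (fun j => ?_) j
    · rw [Fin.cons_zero, germO_resO, hb]
    · rw [Fin.cons_succ, germO_resO, ha]

lemma exists_common_germ (M : X.Modules) {n : ℕ} {x : X} (U : X.Opens) (hU : x ∈ U)
    (c : Fin n → stalk M x) :
    ∃ (V : X.Opens) (hx : x ∈ V) (_ : V ≤ U) (a : Fin n → Γ(M, V)),
      ∀ j, germ M x hx (a j) = c j := by
  induction n with
  | zero => exact ⟨U, hU, le_rfl, Fin.elim0, fun j => j.elim0⟩
  | succ n ih =>
    obtain ⟨V, hV, i, a, ha⟩ := ih (fun j => c j.succ)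
    obtain ⟨W, hW, b, hb⟩ := exists_germ M (c 0)
    refine ⟨V ⊓ W, mem_inf hV hW, inf_le_left.trans i,
      Fin.cons (res M inf_le_right b) fun j => res M inf_le_left (a j), fun j => ?_⟩
    refine Fin.cases ?_ (fun j => ?_) j
    · rw [Fin.cons_zero, germ_res, hb]
    · rw [Fin.cons_succ, germ_res, ha]

/-- Coefficients with respect to a frame are unique on stalks, so coefficient functions found
locally agree and glue. -/
lemma IsFrame.bijective {M : X.Modules} {n : ℕ} {U V : X.Opens} {e : Fin n → Γ(M, U)}
    (h : IsFrame M e) (i : V ≤ U) :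
    Function.Bijective (fun a : Fin n → Γ(X, V) => ∑ j, a j • res M i (e j)) := by
  constructor
  · intro a b hab
    have key : ∀ (y : X) (hy : y ∈ V), (fun j => germO y hy (a j)) = fun j => germO y hy (b j) := by
      intro y hy
      apply (h y (i hy)).1
      rw [comb_germ, comb_germ]
      exact congrArg _ hab
    funext j
    exact sectionO_ext fun y hy => congr_fun (key y hy) j
  · intro s
    have hc : ∀ y : X, ∃ c : Fin n → X.presheaf.stalk y, ∀ hy : y ∈ V,
        comb M e y (i hy) c = germ M y hy s := by
      intro y
      by_cases hy : y ∈ V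
      · obtain ⟨c, hc⟩ := (h y (i hy)).2 (germ M y hy s)
        exact ⟨c, fun _ => hc⟩
      · exact ⟨0, fun h => absurd h hy⟩
    choose c hc using hc
    have hj : ∀ j, ∃ a : Γ(X, V), ∀ (y : X) (hy : y ∈ V), germO y hy a = c y j := by
      intro j
      apply exists_glueO (fun y => c y j)
      intro x hx
      obtain ⟨W, hW, k, a, ha⟩ := exists_common_germO V hx (c x)
      have h1 : germ M x hx s =
          germ M x hW (∑ j, a j • res M (k.trans i) (e j)) := by
        rw [← hc x hx, ← comb_germ]
        simp_rw [ha]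
      obtain ⟨Z, hZ, i1, i2, e12⟩ := germ_eq M hx hW h1
      refine ⟨Z, hZ, i1, resO i2 (a j), fun y hy => ?_⟩
      have : (fun j => germO y (i2 hy) (a j)) = c y := by
        apply (h y (i (i1 hy))).1
        rw [hc y (i1 hy), comb_germ M (k.trans i) e y (i2 hy), ← germ_res M i2 y hy, ← e12,
          germ_res]
      rw [germO_resO]
      exact congr_fun this j
    choose a ha using hj
    refine ⟨a, section_ext M fun y hy => ?_⟩
    dsimp only
    rw [← comb_germ, ← hc y hy]
    congr 1
    funext j
    exact ha j y hy

lemma isFrame_of_bijective {M : X.Modules} {n : ℕ} {U : X.Opens} {e : Fin n → Γ(M, U)}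
    (h : ∀ (V : X.Opens) (i : V ≤ U),
      Function.Bijective (fun a : Fin n → Γ(X, V) => ∑ j, a j • res M i (e j))) :
    IsFrame M e := by
  intro y hy
  constructor
  · rw [injective_iff_map_eq_zero]
    intro c hc
    obtain ⟨V, hV, i, a, ha⟩ := exists_common_germO U hy c
    have h1 : germ M y hV (∑ j, a j • res M i (e j)) = germ M y hV 0 := by
      rw [← comb_germ M i e y hV a, map_zero, ← hc]
      simp_rw [ha]
    obtain ⟨W, hW, k, k2, h2⟩ := germ_eq M hV hV h1
    have h3 := (h W (k.trans i)).1 (a₁ := fun j => resO k (a j)) (a₂ := 0) (by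
      simpa [map_sum, res_smul] using h2)
    funext j
    rw [← ha j, ← germO_resO k y hW, congr_fun h3 j]
    simp
  · intro m
    obtain ⟨V, hV, s, rfl⟩ := exists_germ M m
    obtain ⟨a, ha⟩ := (h (V ⊓ U) inf_le_right).2 (res M inf_le_left s)
    refine ⟨fun j => germO y (mem_inf hV hy) (a j), ?_⟩
    rw [comb_germ M inf_le_right e y (mem_inf hV hy), ← germ_res M inf_le_left y (mem_inf hV hy)]
    exact congrArg _ ha

lemma isFrame_toSec_one (U : X.Opens) :
    IsFrame (structureSheaf X) (fun _ : Fin 1 => (toSec 1 : Γ(structureSheaf X, U))) := by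
  apply isFrame_of_bijective
  intro V i
  have : (fun a : Fin 1 → Γ(X, V) =>
      ∑ j, a j • res (structureSheaf X) i (toSec 1 : Γ(structureSheaf X, U))) =
      fun a => toSec (a 0) := by
    funext a
    simp only [Finset.univ_unique, Fin.default_eq_zero, Fin.isValue, Finset.sum_singleton]
    rw [res_toSec, map_one, ← toSec_eq_smul]
  rw [this]
  exact ⟨fun a b h => by funext j; rw [Subsingleton.elim j 0]; exact h,
    fun s => ⟨fun _ => ofSec s, rfl⟩⟩

/-! ### Free sheaves and their standard sections. -/

section Biproduct

variable (X) in
/-- The free sheaf `𝒪^n`. -/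
abbrev freeSheaf (n : ℕ) : X.Modules := ⨁ fun _ : Fin n => structureSheaf X

lemma freeSheaf_app (n : ℕ) {U : X.Opens} (s : Γ(freeSheaf X n, U)) :
    s = ∑ j, (biproduct.ι (fun _ : Fin n => structureSheaf X) j).app U
      ((biproduct.π (fun _ : Fin n => structureSheaf X) j).app U s) := by
  have h := biproduct.total (f := fun _ : Fin n => structureSheaf X)
  let φ : (freeSheaf X n ⟶ freeSheaf X n) →+ (Γ(freeSheaf X n, U) ⟶ Γ(freeSheaf X n, U)) :=
    { toFun := fun f => f.app U
      map_zero' := rfl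
      map_add' := fun _ _ => rfl }
  have h2 := congr((φ $h) s)
  rw [map_sum] at h2
  have h3 : ∀ (t : Finset (Fin n)) (f : Fin n → (Γ(freeSheaf X n, U) ⟶ Γ(freeSheaf X n, U))),
      (∑ j ∈ t, f j) s = ∑ j ∈ t, f j s := by
    intro t f
    induction t using Finset.cons_induction with
    | empty => rfl
    | cons a t ha ih =>
      rw [Finset.sum_cons, Finset.sum_cons, ← ih]; rfl
  rw [h3] at h2
  exact h2.symm

lemma freeSheaf_π_ι (n : ℕ) (i j : Fin n) {U : X.Opens} (s : Γ(structureSheaf X, U)) :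
    (biproduct.π (fun _ : Fin n => structureSheaf X) j).app U
      ((biproduct.ι (fun _ : Fin n => structureSheaf X) i).app U s) = if i = j then s else 0 := by
  have h := biproduct.ι_π (fun _ : Fin n => structureSheaf X) i j
  have h2 := congr(($h).app U s)
  rw [Scheme.Modules.Hom.comp_app] at h2
  refine h2.trans ?_
  split_ifs with hij
  · subst hij; rfl
  · rfl

/-- The standard frame of `𝒪^n`. -/
def stdSec (n : ℕ) (U : X.Opens) (j : Fin n) : Γ(freeSheaf X n, U) :=
  (biproduct.ι (fun _ : Fin n => structureSheaf X) j).app U (toSec 1)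

lemma sum_smul_stdSec (n : ℕ) (U : X.Opens) (a : Fin n → Γ(X, U)) :
    ∑ j, a j • stdSec n U j =
      ∑ j, (biproduct.ι (fun _ : Fin n => structureSheaf X) j).app U (toSec (a j)) := by
  refine Finset.sum_congr rfl fun j _ => ?_
  rw [stdSec, ← Scheme.Modules.Hom.app_smul, ← toSec_eq_smul]

lemma π_sum_smul_stdSec (n : ℕ) (U : X.Opens) (a : Fin n → Γ(X, U)) (j : Fin n) :
    ofSec ((biproduct.π (fun _ : Fin n => structureSheaf X) j).app U
      (∑ j, a j • stdSec n U j)) = a j := by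
  rw [sum_smul_stdSec, map_sum]
  simp_rw [freeSheaf_π_ι]
  simp

lemma stdSec_bijective (n : ℕ) (U : X.Opens) :
    Function.Bijective (fun a : Fin n → Γ(X, U) => ∑ j, a j • stdSec n U j) := by
  constructor
  · intro a b h
    funext j
    dsimp only at h
    rw [← π_sum_smul_stdSec n U a j, h, π_sum_smul_stdSec]
  · intro s
    refine ⟨fun j => ofSec ((biproduct.π (fun _ : Fin n => structureSheaf X) j).app U s), ?_⟩
    dsimp only
    rw [sum_smul_stdSec]
    exact (freeSheaf_app n s).symm

lemma res_stdSec (n : ℕ) {U V : X.Opens} (i : V ≤ U) (j : Fin n) :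
    res _ i (stdSec n U j) = stdSec n V j := by
  rw [stdSec, ← app_res, res_toSec, map_one]; rfl

/-- The morphism `𝒪^n ⟶ M` defined by global sections. -/
def ofSections {M : X.Modules} {n : ℕ} (e : Fin n → Γ(M, ⊤)) : freeSheaf X n ⟶ M :=
  biproduct.desc fun j => ofSection (e j)

lemma ofSections_app {M : X.Modules} {n : ℕ} (e : Fin n → Γ(M, ⊤)) (U : X.Opens)
    (a : Fin n → Γ(X, U)) :
    (ofSections e).app U (∑ j, a j • stdSec n U j) = ∑ j, a j • res M le_top (e j) := by
  rw [map_sum]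
  refine Finset.sum_congr rfl fun j _ => ?_
  rw [Scheme.Modules.Hom.app_smul, stdSec]
  have h : biproduct.ι (fun _ : Fin n => structureSheaf X) j ≫ ofSections e = ofSection (e j) := by
    simp [ofSections]
  have h2 := congr(($h).app U (toSec 1))
  rw [Scheme.Modules.Hom.comp_app, ofSection_app, ofSec_toSec, one_smul] at h2
  exact congrArg _ h2

end Biproduct

/-! ### Local freeness in terms of frames. -/

lemma smul_restrict (M : X.Modules) (U : X.Opens) (W : U.toScheme.Opens) (a : Γ(U.toScheme, W))
    (s : Γ(M.restrict U.ι, W)) :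
    a • s = (((show Γ(X, U.ι ''ᵁ W) from a) • (show Γ(M, U.ι ''ᵁ W) from s) :
      Γ(M, U.ι ''ᵁ W)) : Γ(M.restrict U.ι, W)) := by
  have h : a • s = ((((U.ι.appIso W).inv a) • (show Γ(M, U.ι ''ᵁ W) from s) :
      Γ(M, U.ι ''ᵁ W)) : Γ(M.restrict U.ι, W)) := rfl
  rw [h, Scheme.Opens.ι_appIso]
  rfl

/-- A trivialization carries the standard sections to a frame, and a frame defines an isomorphism
from `𝒪^n`. This replaces restricted sheaves by sections of `M` itself in what follows. -/
lemma isLocallyFree_iff_frame (M : X.Modules) (n : ℕ) :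
    IsLocallyFreeOfRank M n ↔
      ∀ x : X, ∃ (U : X.Opens) (_ : x ∈ U) (e : Fin n → Γ(M, U)), IsFrame M e := by
  constructor
  · intro h x
    obtain ⟨U, hx, ⟨φ⟩⟩ := h x
    let ψ : freeSheaf U.toScheme n ≅ M.restrict U.ι :=
      biproduct.isoCoproduct (fun _ : Fin n => structureSheaf U.toScheme) ≪≫ φ.symm
    let e : Fin n → Γ(M, U.ι ''ᵁ ⊤) := fun j => ψ.hom.app ⊤ (stdSec n ⊤ j)
    refine ⟨U.ι ''ᵁ ⊤, ⟨⟨x, hx⟩, trivial, rfl⟩, e, isFrame_of_bijective fun V i => ?_⟩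
    obtain ⟨W, rfl⟩ : ∃ W : U.toScheme.Opens, V = U.ι ''ᵁ W := by
      refine ⟨U.ι ⁻¹ᵁ V, ?_⟩
      rw [Scheme.Hom.image_preimage_eq_opensRange_inf]
      simpa using i
    have hb : Function.Bijective (ψ.hom.app W) :=
      (ConcreteCategory.isIso_iff_bijective _).1 inferInstance
    have := hb.comp (stdSec_bijective (X := U.toScheme) n W)
    have key : ((ψ.hom.app W) ∘ (fun a : Fin n → Γ(U.toScheme, W) => ∑ j, a j • stdSec n W j)) =
        fun a : Fin n → Γ(U.toScheme, W) =>
          (∑ j, a j • res (M.restrict U.ι) (le_top : W ≤ ⊤) (e j) : Γ(M.restrict U.ι, W)) := by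
      funext a
      dsimp only [Function.comp]
      rw [map_sum]
      refine Finset.sum_congr rfl fun j _ => ?_
      rw [Scheme.Modules.Hom.app_smul, ← res_stdSec n (le_top : W ≤ ⊤), app_res]
    rw [key] at this
    have key2 : (fun a : Fin n → Γ(U.toScheme, W) =>
          (∑ j, a j • res (M.restrict U.ι) (le_top : W ≤ ⊤) (e j) : Γ(M.restrict U.ι, W))) =
        fun a : Fin n → Γ(X, U.ι ''ᵁ W) => (∑ j, a j • res M i (e j) : Γ(M, U.ι ''ᵁ W)) := by
      funext a
      exact Finset.sum_congr rfl fun j _ => smul_restrict M U W (a j) _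
    exact key2 ▸ this
  · intro h x
    obtain ⟨U, hx, e, he⟩ := h x
    refine ⟨U, hx, ?_⟩
    have hU : U.ι ''ᵁ ⊤ ≤ U := by simp
    let e' : Fin n → Γ(M.restrict U.ι, ⊤) := fun j =>
      (res M hU (e j) : Γ(M, U.ι ''ᵁ ⊤))
    let ψ := ofSections e'
    have : IsIso ψ := by
      rw [Scheme.Modules.Hom.isIso_iff_isIso_app]
      intro W
      rw [ConcreteCategory.isIso_iff_bijective]
      have hW : U.ι ''ᵁ W ≤ U := U.ι_image_le W
      have h1 := he.bijective hW
      have h2 : (fun a : Fin n → Γ(X, U.ι ''ᵁ W) => ∑ j, a j • res M hW (e j)) =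
          (ψ.app W) ∘ (fun a : Fin n → Γ(U.toScheme, W) => ∑ j, a j • stdSec n W j) := by
        funext a
        refine Eq.trans ?_ (ofSections_app e' W a).symm
        refine Finset.sum_congr rfl fun j _ => ?_
        have : res (M.restrict U.ι) (le_top : W ≤ ⊤) (e' j) =
          (res M hW (e j) : Γ(M, U.ι ''ᵁ W)) := by
          change res M (Scheme.Hom.image_mono _ le_top) (res M hU (e j)) = _
          rw [res_res]
        rw [this]
        exact (smul_restrict M U W (a j) _).symm
      rw [h2] at h1
      exact (Function.Bijective.of_comp_iff _ (stdSec_bijective n W)).1 h1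
    exact ⟨(asIso ψ).symm ≪≫ biproduct.isoCoproduct (fun _ : Fin n => structureSheaf U.toScheme)⟩

end

section

variable {X : Scheme.{0}}

/-! ### Finitely generated sheaves -/

lemma comb_res (M : X.Modules) {n : ℕ} {U V : X.Opens} (i : V ≤ U) (e : Fin n → Γ(M, U)) (y : X)
    (hy : y ∈ V) : comb M (fun j => res M i (e j)) y hy = comb M e y (i hy) := by
  ext c
  simp [comb_apply]

lemma comb_app {M N : X.Modules} (f : M ⟶ N) {n : ℕ} {U : X.Opens} (e : Fin n → Γ(M, U)) (y : X)
    (hy : y ∈ U) (c) : comb N (fun j => f.app U (e j)) y hy c = stalkMap f y (comb M e y hy c) := by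
  simp [comb_apply]

/-- Local generation of all stalks by finitely many sections. -/
def FG (M : X.Modules) : Prop :=
  ∀ x : X, ∃ (U : X.Opens) (_ : x ∈ U) (n : ℕ) (e : Fin n → Γ(M, U)),
    ∀ (y : X) (hy : y ∈ U), Function.Surjective (comb M e y hy)

lemma FG_of_isLocallyFree {M : X.Modules} {n : ℕ} (h : IsLocallyFreeOfRank M n) : FG M := by
  intro x
  obtain ⟨U, hx, e, he⟩ := (isLocallyFree_iff_frame M n).1 h x
  exact ⟨U, hx, n, e, fun y hy => (he y hy).2⟩

lemma finite_stalk {M : X.Modules} (h : FG M) (x : X) :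
    Module.Finite (X.presheaf.stalk x) (stalk M x) := by
  obtain ⟨U, hx, n, e, he⟩ := h x
  exact Module.Finite.of_surjective _ (he _ hx)

lemma exists_common_nhds {x : X} {n : ℕ} (U : X.Opens) (hU : x ∈ U) (P : Fin n → X.Opens → Prop)
    (hP : ∀ j V W, W ≤ V → P j V → P j W) (h : ∀ j, ∃ W, x ∈ W ∧ P j W) :
    ∃ W, x ∈ W ∧ W ≤ U ∧ ∀ j, P j W := by
  induction n with
  | zero => exact ⟨U, hU, le_rfl, fun j => j.elim0⟩
  | succ n ih =>
    obtain ⟨W, hW, i, h1⟩ := ih (fun j => P j.succ) (fun j => hP j.succ) (fun j => h j.succ)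
    obtain ⟨V, hV, h2⟩ := h 0
    refine ⟨W ⊓ V, mem_inf hW hV, inf_le_left.trans i, fun j => ?_⟩
    refine Fin.cases ?_ (fun j => ?_) j
    · exact hP 0 _ _ inf_le_right h2
    · exact hP j.succ _ _ inf_le_left (h1 j)

/-- A linear relation between germs extends to a neighborhood. -/
lemma exists_relation_near (M : X.Modules) {k : ℕ} {U V : X.Opens} (s : Fin k → Γ(M, V)) {x : X}
    (hV : x ∈ V) (hU : x ∈ U) (m : Γ(M, U)) (c : Fin k → X.presheaf.stalk x)
    (hc : comb M s x hV c = germ M x hU m) :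
    ∃ (W : X.Opens) (_ : x ∈ W) (a : Fin k → Γ(X, W)) (i : W ≤ V) (j : W ≤ U),
      res M j m = ∑ l, a l • res M i (s l) := by
  obtain ⟨W, hW, i, a, ha⟩ := exists_common_germO V hV c
  have h1 : germ M x hW (∑ l, a l • res M i (s l)) = germ M x hU m := by
    rw [← comb_germ, ← hc]
    congr 1
    exact funext ha
  obtain ⟨Z, hZ, i1, i2, h2⟩ := germ_eq M hW hU h1
  refine ⟨Z, hZ, fun l => resO i1 (a l), i1.trans i, i2, ?_⟩
  rw [← h2, map_sum]
  exact Finset.sum_congr rfl fun l _ => by rw [res_smul, res_res]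

lemma mem_range_comb_near (M : X.Modules) {k : ℕ} {U V : X.Opens} (s : Fin k → Γ(M, V)) {x : X}
    (hV : x ∈ V) (hU : x ∈ U) (m : Γ(M, U)) (hc : germ M x hU m ∈ LinearMap.range (comb M s x hV)) :
    ∃ W : X.Opens, x ∈ W ∧ ∀ (y : X) (_ : y ∈ W) (hy : y ∈ V) (hy' : y ∈ U),
      germ M y hy' m ∈ LinearMap.range (comb M s y hy) := by
  obtain ⟨c, hc⟩ := hc
  obtain ⟨W, hW, a, i, j, h⟩ := exists_relation_near M s hV hU m c hc
  refine ⟨W, hW, fun y hyW hy hy' => ⟨fun l => germO y hyW (a l), ?_⟩⟩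
  rw [comb_germ M i s y hyW, ← h, germ_res]

lemma surjective_comb_iff {M : X.Modules} {n : ℕ} {U : X.Opens} {e : Fin n → Γ(M, U)} {x : X}
    (hx : x ∈ U) (h : Function.Surjective (comb M e x hx)) (N : Submodule (X.presheaf.stalk x)
      (stalk M x)) (hN : ∀ j, germ M x hx (e j) ∈ N) : N = ⊤ := by
  rw [eq_top_iff]
  rintro m -
  obtain ⟨c, rfl⟩ := h m
  rw [comb_apply]
  exact Submodule.sum_mem _ fun j _ => Submodule.smul_mem _ _ (hN j)

/-- Sections of a finitely generated sheaf that generate a stalk generate all nearby stalks. -/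
lemma surjective_near {M : X.Modules} (h : FG M) {k : ℕ} {V : X.Opens} (s : Fin k → Γ(M, V)) {x : X}
    (hV : x ∈ V) (hs : Function.Surjective (comb M s x hV)) :
    ∃ (W : X.Opens) (_ : x ∈ W) (i : W ≤ V), ∀ (y : X) (hy : y ∈ W),
      Function.Surjective (comb M s y (i hy)) := by
  obtain ⟨U, hU, n, e, he⟩ := h x
  obtain ⟨W, hW, i, hj⟩ := exists_common_nhds (U ⊓ V) (mem_inf hU hV)
    (fun (j : Fin n) W => ∀ (y : X) (_ : y ∈ W) (hy : y ∈ V) (hy' : y ∈ U),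
      germ M y hy' (e j) ∈ LinearMap.range (comb M s y hy))
    (fun j V W hVW h y hy => h y (hVW hy))
    (fun j => mem_range_comb_near M s hV hU (e j) (hs _))
  refine ⟨W, hW, i.trans inf_le_right, fun y hy => ?_⟩
  rw [← LinearMap.range_eq_top]
  exact surjective_comb_iff (i hy).1 (he y (i hy).1) _ fun j => hj j y hy _ _

variable [IsIntegral X]

/-! ### The generic stalk, finite generation and torsion-freeness -/

lemma genericPoint_mem {U : X.Opens} {x : X} (hx : x ∈ U) : genericPoint X ∈ U :=
  (genericPoint_specializes x).mem_open U.2 hx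

/-- The map from the stalk at `x` to the generic stalk. -/
def sp (M : X.Modules) (x : X) : stalk M x →+ stalk M (genericPoint X) :=
  (M.presheaf.stalkSpecializes (genericPoint_specializes x)).hom

@[simp] lemma sp_germ (M : X.Modules) {U : X.Opens} (x : X) (hx : x ∈ U) (s : Γ(M, U)) :
    sp M x (germ M x hx s) = germ M (genericPoint X) (genericPoint_mem hx) s :=
  TopCat.Presheaf.germ_stalkSpecializes_apply M.presheaf hx (genericPoint_specializes x) s

@[simp] lemma algebraMap_germO {U : X.Opens} (x : X) (hx : x ∈ U) (a : Γ(X, U)) :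
    algebraMap (X.presheaf.stalk x) X.functionField (germO x hx a) =
      germO (genericPoint X) (genericPoint_mem hx) a :=
  TopCat.Presheaf.germ_stalkSpecializes_apply X.presheaf hx (genericPoint_specializes x) a

lemma sp_smul (M : X.Modules) (x : X) (a : X.presheaf.stalk x) (m : stalk M x) :
    sp M x (a • m) = algebraMap (X.presheaf.stalk x) X.functionField a • sp M x m := by
  obtain ⟨U, hU, a, rfl⟩ := exists_germO a
  obtain ⟨V, hV, m, rfl⟩ := exists_germ M m
  have hW : x ∈ U ⊓ V := ⟨hU, hV⟩
  rw [← germO_resO inf_le_left x hW a, ← germ_res M inf_le_right x hW m, ← germ_smul, sp_germ,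
    sp_germ, algebraMap_germO, germ_smul]

lemma sp_stalkMap {M N : X.Modules} (f : M ⟶ N) (x : X) (m : stalk M x) :
    sp N x (stalkMap f x m) = stalkMap f (genericPoint X) (sp M x m) := by
  obtain ⟨V, hV, m, rfl⟩ := exists_germ M m
  simp

/-- Torsion-freeness: germs are determined by their image in the generic stalk. -/
def TF (M : X.Modules) : Prop := ∀ x, Function.Injective (sp M x)

/-- The dimension of the generic stalk. -/
def grank (M : X.Modules) : ℕ := Module.finrank X.functionField (stalk M (genericPoint X))

lemma sp_comb (M : X.Modules) {n : ℕ} {U : X.Opens} (e : Fin n → Γ(M, U)) (y : X) (hy : y ∈ U)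
    (c : Fin n → X.presheaf.stalk y) :
    sp M y (comb M e y hy c) = comb M e (genericPoint X) (genericPoint_mem hy)
      (fun j => algebraMap (X.presheaf.stalk y) X.functionField (c j)) := by
  rw [comb_apply, map_sum, comb_apply]
  refine Finset.sum_congr rfl fun j _ => ?_
  rw [sp_smul, sp_germ]

lemma algebraMap_injective (x : X) :
    Function.Injective (algebraMap (X.presheaf.stalk x) X.functionField) :=
  IsFractionRing.injective _ _

lemma TF_of_isLocallyFree {M : X.Modules} {n : ℕ} (h : IsLocallyFreeOfRank M n) : TF M := by
  intro x
  obtain ⟨U, hx, e, he⟩ := (isLocallyFree_iff_frame M n).1 h x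
  rw [injective_iff_map_eq_zero]
  intro m hm
  obtain ⟨c, rfl⟩ := (he x hx).2 m
  rw [sp_comb] at hm
  have h0 := (he _ (genericPoint_mem hx)).1 (hm.trans (map_zero _).symm)
  have : c = 0 := by
    funext j
    exact algebraMap_injective x ((congr_fun h0 j).trans (map_zero _).symm)
  rw [this, map_zero]

lemma grank_of_isLocallyFree {M : X.Modules} {n : ℕ} (h : IsLocallyFreeOfRank M n) :
    grank M = n := by
  obtain ⟨U, hx, e, he⟩ := (isLocallyFree_iff_frame M n).1 h (genericPoint X)
  have := (LinearEquiv.ofBijective _ (he _ hx)).finrank_eq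
  rw [Module.finrank_fin_fun] at this
  exact this.symm

/-- Every finite-dimensional vector in the generic stalk has a multiple that is a germ. -/
lemma finite_generic {M : X.Modules} (h : FG M) :
    Module.Finite X.functionField (stalk M (genericPoint X)) := by
  obtain ⟨U, hx, n, e, he⟩ := h (genericPoint X)
  exact Module.Finite.of_surjective _ (he _ hx)

/-- Clearing denominators: elements of the generic stalk are fractions of germs at `x`. -/
lemma exists_smul_eq_sp {M : X.Modules} (h : FG M) (x : X) (m : stalk M (genericPoint X)) :
    ∃ (a : X.presheaf.stalk x) (m' : stalk M x), a ≠ 0 ∧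
      algebraMap (X.presheaf.stalk x) X.functionField a • m = sp M x m' := by
  obtain ⟨U, hx, n, e, he⟩ := h x
  obtain ⟨c, rfl⟩ := he _ (genericPoint_mem hx) m
  obtain ⟨b, hb⟩ := IsLocalization.exist_integer_multiples_of_finite
    (nonZeroDivisors (X.presheaf.stalk x)) (S := X.functionField) c
  choose d hd using hb
  refine ⟨b, comb M e x hx d, nonZeroDivisors.ne_zero b.2, ?_⟩
  rw [sp_comb]
  refine ((comb M e (genericPoint X) (genericPoint_mem hx)).map_smul _ c).symm.trans ?_
  congr 1
  funext j
  exact ((hd j).trans (Algebra.smul_def _ _)).symm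

/-- The stalk at `x` is finitely generated and torsion-free over a principal ideal ring, hence free.
A basis lifts to sections that generate all nearby stalks. Their independence passes from `x` to the
generic stalk, and from there to every nearby stalk because local rings inject into the function
field. -/
lemma isLocallyFree_of_FG_TF [∀ x : X, IsPrincipalIdealRing (X.presheaf.stalk x)]
    {M : X.Modules} (h : FG M) (h' : TF M) : IsLocallyFreeOfRank M (grank M) := by
  rw [isLocallyFree_iff_frame]
  intro x
  have hf := finite_stalk h x
  have htf : Module.IsTorsionFree (X.presheaf.stalk x) (stalk M x) := by
    rw [Module.isTorsionFree_iff_smul_eq_zero]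
    intro a m ham
    by_contra! hne
    have h1 := sp_smul M x a m
    rw [ham, map_zero] at h1
    rcases smul_eq_zero.1 h1.symm with h2 | h2
    · exact hne.1 (algebraMap_injective x (h2.trans (map_zero _).symm))
    · exact hne.2 (h' x (h2.trans (map_zero _).symm))
  have hfree : Module.Free (X.presheaf.stalk x) (stalk M x) := Module.free_of_finite_type_torsion_free'
  generalize hk : Module.finrank (X.presheaf.stalk x) (stalk M x) = k
  have b : Module.Basis (Fin k) (X.presheaf.stalk x) (stalk M x) :=
    (Module.finBasis _ _).reindex (finCongr hk)
  obtain ⟨V, hV, -, s, hs⟩ := exists_common_germ M ⊤ trivial b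
  have hcomb : ∀ c, comb M s x hV c = b.equivFun.symm c := fun c => by
    rw [comb_apply, Module.Basis.equivFun_symm_apply]
    simp_rw [hs]
  have hsurj : Function.Surjective (comb M s x hV) := fun m =>
    ⟨b.equivFun m, by rw [hcomb, LinearEquiv.symm_apply_apply]⟩
  have hinj : Function.Injective (comb M s x hV) := fun c d hcd => by
    rw [hcomb, hcomb] at hcd
    exact b.equivFun.symm.injective hcd
  obtain ⟨W, hW, i, hsW⟩ := surjective_near h s hV hsurj
  -- A relation over the function field becomes a relation at `x` after clearing denominators.
  have hη : Function.Injective (comb M s (genericPoint X) (genericPoint_mem hV)) := by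
    rw [injective_iff_map_eq_zero]
    intro c hc
    obtain ⟨a, ha⟩ := IsLocalization.exist_integer_multiples_of_finite
      (nonZeroDivisors (X.presheaf.stalk x)) (S := X.functionField) c
    choose d hd using ha
    have h1 : (fun j => algebraMap (X.presheaf.stalk x) X.functionField (d j)) =
        algebraMap (X.presheaf.stalk x) X.functionField a • c := by
      funext j
      exact (hd j).trans (Algebra.smul_def _ _)
    have h2 : d = 0 := by
      apply hinj
      apply h' x
      rw [sp_comb, h1, map_zero, map_zero]
      refine ((comb M s (genericPoint X) (genericPoint_mem hV)).map_smul _ c).trans ?_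
      rw [hc, smul_zero]
    have ha0 : algebraMap (X.presheaf.stalk x) X.functionField a ≠ 0 := by
      rw [Ne, ← map_zero (algebraMap (X.presheaf.stalk x) X.functionField),
        (algebraMap_injective x).eq_iff]
      exact nonZeroDivisors.ne_zero a.2
    funext j
    have h3 := congr_fun h1 j
    rw [h2] at h3
    simp only [Pi.zero_apply, map_zero, Pi.smul_apply, smul_eq_mul] at h3
    exact (mul_eq_zero.1 h3.symm).resolve_left ha0
  have hk' : k = grank M := by
    have h1 := (LinearEquiv.ofBijective _
      ⟨hη, hsW _ (genericPoint_mem hW)⟩).finrank_eq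
    rw [Module.finrank_fin_fun] at h1
    exact h1
  rw [← hk']
  refine ⟨W, hW, fun j => res M i (s j), fun y hy => ?_⟩
  rw [comb_res]
  refine ⟨?_, hsW y hy⟩
  rw [injective_iff_map_eq_zero]
  intro c hc
  have h1 := congrArg (sp M y) hc
  rw [sp_comb, map_zero] at h1
  have h2 := hη (h1.trans (map_zero _).symm)
  funext j
  exact algebraMap_injective y ((congr_fun h2 j).trans (map_zero _).symm)

lemma TF_of_mono {M N : X.Modules} (f : M ⟶ N) [Mono f] (h : TF N) : TF M := by
  intro x
  have h1 := (h x).comp (stalkMap_injective f x)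
  have h2 : sp N x ∘ stalkMap f x = stalkMap f (genericPoint X) ∘ sp M x :=
    funext fun m => sp_stalkMap f x m
  rw [h2] at h1
  exact h1.of_comp

lemma FG_of_epi {M N : X.Modules} (f : M ⟶ N) [Epi f] (h : FG M) : FG N := by
  intro x
  obtain ⟨U, hx, n, e, he⟩ := h x
  refine ⟨U, hx, n, fun j => f.app U (e j), fun y hy m => ?_⟩
  obtain ⟨m, rfl⟩ := stalkMap_surjective f y m
  obtain ⟨c, rfl⟩ := he y hy m
  exact ⟨c, comb_app f e y hy c⟩

lemma TF_of_shortExact {S : ShortComplex X.Modules} (hS : S.ShortExact) (h1 : TF S.X₁)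
    (h3 : TF S.X₃) : TF S.X₂ := by
  have := hS.mono_f
  intro x
  rw [injective_iff_map_eq_zero]
  intro m hm
  have h : stalkMap S.g x m = 0 := by
    apply h3 x
    rw [sp_stalkMap, hm, map_zero, map_zero]
  obtain ⟨a, rfl⟩ := exact_stalk hS.exact x m h
  rw [sp_stalkMap] at hm
  have := stalkMap_injective S.f _ (hm.trans (map_zero _).symm)
  rw [h1 x (this.trans (map_zero _).symm), map_zero]

/-- Sections can be lifted locally along an epimorphism. -/
lemma exists_lift_family {M N : X.Modules} (f : M ⟶ N) [Epi f] {n : ℕ} {U : X.Opens}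
    (e : Fin n → Γ(N, U)) {x : X} (hx : x ∈ U) :
    ∃ (V : X.Opens) (_ : x ∈ V) (i : V ≤ U) (s : Fin n → Γ(M, V)),
      ∀ j, f.app V (s j) = res N i (e j) := by
  obtain ⟨V, hV, i, h⟩ := exists_common_nhds U hx
    (fun (j : Fin n) V => ∃ (i : V ≤ U) (s : Γ(M, V)), f.app V s = res N i (e j))
    (fun j V W hW h => by
      obtain ⟨i, s, hs⟩ := h
      exact ⟨hW.trans i, res M hW s, by rw [app_res, hs, res_res]⟩)
    (fun j => by
      obtain ⟨V, hV, i, s, hs⟩ := exists_lift_of_epi f (e j) hx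
      exact ⟨V, hV, i, s, hs⟩)
  choose k s hs using h
  exact ⟨V, hV, i, s, hs⟩

/-- A relation for a family of sections holds near a point. -/
lemma exists_relations_near {M : X.Modules} {k n : ℕ} {V : X.Opens} (s : Fin k → Γ(M, V))
    (m : Fin n → Γ(M, V)) {x : X} (hV : x ∈ V) (hs : Function.Surjective (comb M s x hV)) :
    ∃ (W : X.Opens) (_ : x ∈ W) (i : W ≤ V) (a : Fin n → Fin k → Γ(X, W)),
      ∀ j, res M i (m j) = ∑ l, a j l • res M i (s l) := by
  obtain ⟨W, hW, i, h⟩ := exists_common_nhds V hV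
    (fun (j : Fin n) W => ∃ (i : W ≤ V) (a : Fin k → Γ(X, W)),
      res M i (m j) = ∑ l, a l • res M i (s l))
    (fun j V W hW h => by
      obtain ⟨i, a, ha⟩ := h
      refine ⟨hW.trans i, fun l => resO hW (a l), ?_⟩
      rw [← res_res M i hW, ha, map_sum]
      exact Finset.sum_congr rfl fun l _ => by rw [res_smul, res_res])
    (fun j => by
      obtain ⟨c, hc⟩ := hs (germ M x hV (m j))
      obtain ⟨W, hW, a, i, i2, ha⟩ := exists_relation_near M s hV hV (m j) c hc
      exact ⟨W, hW, i, a, ha⟩)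
  choose k a ha using h
  exact ⟨W, hW, i, a, ha⟩

lemma FG_of_shortExact {S : ShortComplex X.Modules} (hS : S.ShortExact) (h1 : FG S.X₁)
    (h3 : FG S.X₃) : FG S.X₂ := by
  have := hS.mono_f
  have := hS.epi_g
  intro x
  obtain ⟨U, hx, n, e, he⟩ := h1 x
  obtain ⟨V, hV, m, c, hc⟩ := h3 x
  obtain ⟨W, hW, i, s, hs⟩ := exists_lift_family S.g c hV
  refine ⟨U ⊓ W, mem_inf hx hW, n + m, Fin.append (fun j => res S.X₂ inf_le_left (S.f.app U (e j)))
    (fun j => res S.X₂ inf_le_right (s j)), fun y hy b => ?_⟩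
  obtain ⟨α, hα⟩ := hc y (i hy.2) (stalkMap S.g y b)
  have h0 : stalkMap S.g y (b - comb S.X₂ s y hy.2 α) = 0 := by
    rw [map_sub, sub_eq_zero, ← hα, ← comb_app S.g s y hy.2, ← comb_res S.X₃ i c y hy.2]
    simp_rw [hs]
  obtain ⟨a, ha⟩ := exact_stalk hS.exact y _ h0
  obtain ⟨β, rfl⟩ := he y hy.1 a
  refine ⟨Fin.append β α, ?_⟩
  rw [comb_apply, Fin.sum_univ_add]
  simp only [Fin.append_left, Fin.append_right, germ_res]
  rw [← comb_app, comb_apply, comb_apply] at ha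
  exact eq_sub_iff_add_eq.1 ha

/-- Lift a frame `c` of the quotient to sections `b`, and let `e j` generate the middle term with
image `∑ a j l • c l`. The corrected sections `e j - ∑ a j l • b l` lie in the kernel and generate
it. -/
lemma FG_of_kernel {S : ShortComplex X.Modules} (hS : S.ShortExact) (h2 : FG S.X₂) {n : ℕ}
    (h3 : IsLocallyFreeOfRank S.X₃ n) : FG S.X₁ := by
  have := hS.mono_f
  have := hS.epi_g
  intro x
  obtain ⟨U, hx, c, hc⟩ := (isLocallyFree_iff_frame _ n).1 h3 x
  obtain ⟨V, hV, i, b, hb⟩ := exists_lift_family S.g c hx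
  obtain ⟨V', hV', m, e, he⟩ := h2 x
  obtain ⟨W, hW, k, a, ha⟩ := exists_relations_near (V := V' ⊓ V)
    (fun j => res S.X₃ (inf_le_right.trans i) (c j))
    (fun j => res S.X₃ inf_le_left (S.g.app V' (e j)))
    (mem_inf hV' hV) (by rw [comb_res]; exact (hc _ _).2)
  have hk1 : W ≤ V' := k.trans inf_le_left
  have hk2 : W ≤ V := k.trans inf_le_right
  have hker : ∀ j, S.g.app W (res S.X₂ hk1 (e j) - ∑ l, a j l • res S.X₂ hk2 (b l)) = 0 := by
    intro j
    have := ha j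
    simp only [res_res] at this
    rw [map_sub, app_res, this, map_sum, sub_eq_zero]
    refine Finset.sum_congr rfl fun l _ => ?_
    rw [Scheme.Modules.Hom.app_smul, app_res, hb, res_res]
  choose t ht using fun j => exact_app hS.exact W _ (hker j)
  refine ⟨W, hW, m, t, fun y hy α => ?_⟩
  obtain ⟨β, hβ⟩ := he y (hk1 hy) (stalkMap S.f y α)
  refine ⟨β, stalkMap_injective S.f y ?_⟩
  have hga : ∀ j, stalkMap S.g y (germ S.X₂ y (hk1 hy) (e j)) =
      ∑ l, germO y hy (a j l) • germ S.X₃ y (i (hk2 hy)) (c l) := by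
    intro j
    have := congrArg (germ S.X₃ y hy) (ha j)
    simp only [res_res, map_sum, germ_smul, germ_res] at this
    rw [stalkMap_germ, this]
  -- A combination of the `e j` that lies in the kernel needs no correction: its total coefficient
  -- at each frame element `c l` is zero.
  have hzero : (fun l => ∑ j, β j * germO y hy (a j l)) = 0 := by
    apply (hc y (i (hk2 hy))).1
    have h0 : stalkMap S.g y (stalkMap S.f y α) = 0 := by
      rw [← stalkMap_comp, S.zero, stalkMap_zero]; rfl
    rw [map_zero, ← h0, ← hβ, comb_apply, comb_apply, map_sum]
    simp_rw [map_smul, hga, Finset.smul_sum, Finset.sum_smul, mul_smul]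
    exact Finset.sum_comm
  rw [← hβ, ← comb_app, comb_apply, comb_apply]
  simp_rw [ht, map_sub, map_sum, germ_smul, germ_res, smul_sub, Finset.sum_sub_distrib,
    Finset.smul_sum, smul_smul]
  rw [Finset.sum_comm, sub_eq_self]
  simp_rw [← Finset.sum_smul]
  exact Finset.sum_eq_zero fun l _ => by rw [congr_fun hzero l, Pi.zero_apply, zero_smul]

lemma grank_shortExact {S : ShortComplex X.Modules} (hS : S.ShortExact) (h2 : FG S.X₂) :
    grank S.X₂ = grank S.X₁ + grank S.X₃ := by
  have := hS.mono_f
  have := hS.epi_g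
  have := finite_generic h2
  have h := LinearMap.finrank_range_add_finrank_ker (K := X.functionField)
    (stalkMap S.g (genericPoint X))
  rw [LinearMap.range_eq_top.2 (stalkMap_surjective _ _), finrank_top] at h
  have h4 : LinearMap.ker (stalkMap S.g (genericPoint X)) =
      LinearMap.range (stalkMap S.f (genericPoint X)) := by
    ext m
    refine ⟨fun hm => exact_stalk hS.exact _ m hm, ?_⟩
    rintro ⟨a, rfl⟩
    rw [LinearMap.mem_ker, ← stalkMap_comp, S.zero, stalkMap_zero]; rfl
  rw [h4, LinearMap.finrank_range_of_inj (stalkMap_injective _ _)] at h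
  rw [grank, ← h, add_comm]; rfl

end

section

/-! ### Modules over a principal ideal domain and duality for torsion modules -/

section Duality

variable {R : Type} [CommRing R] [IsDomain R] [IsPrincipalIdealRing R]
  {V Q : Type} [AddCommGroup V] [Module R V] [AddCommGroup Q] [Module R Q]

/-- In Baer's criterion only principal ideals occur, and extending a map from a nonzero ideal `(a)`
amounts to dividing by `a`. -/
lemma injective_of_divisible (hQ : ∀ (a : R) (q : Q), a ≠ 0 → ∃ q', a • q' = q) :
    Module.Injective R Q := by
  rw [← Module.Baer.iff_injective]
  intro I g
  obtain ⟨a, rfl⟩ := (IsPrincipalIdealRing.principal I).principal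
  by_cases ha : a = 0
  · refine ⟨0, fun x hx => ?_⟩
    have : (⟨x, hx⟩ : R ∙ a) = 0 := by
      rw [ha, Submodule.span_zero_singleton] at hx
      exact Subtype.ext hx
    rw [this, map_zero, LinearMap.zero_apply]
  · obtain ⟨q, hq⟩ := hQ a (g ⟨a, Submodule.mem_span_singleton_self a⟩) ha
    refine ⟨LinearMap.toSpanSingleton R Q q, fun x hx => ?_⟩
    obtain ⟨r, rfl⟩ := Submodule.mem_span_singleton.1 hx
    have : (⟨r • a, hx⟩ : R ∙ a) = r • ⟨a, Submodule.mem_span_singleton_self a⟩ := rfl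
    rw [this, LinearMap.map_smul g, ← hq, LinearMap.toSpanSingleton_apply, smul_smul, smul_eq_mul]

variable (π : V →ₗ[R] Q) (v : V)

/-- Put `w = v / a`. A linear map from `R/a` is an element of `Q = V/Rv` killed by `a`; these
elements are the multiples of the class of `w`, and that class has annihilator exactly `(a)`. -/
lemma nonempty_dual_cyclic (hπ : Function.Surjective π) (hker : LinearMap.ker π = R ∙ v)
    (hdiv : ∀ (a : R) (x : V), a ≠ 0 → ∃ y, a • y = x)
    (htf : ∀ (a : R) (x : V), a • x = 0 → a = 0 ∨ x = 0) (hv : v ≠ 0) (a : R) (ha : a ≠ 0) :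
    Nonempty (((R ⧸ R ∙ a) →ₗ[R] Q) ≃ₗ[R] (R ⧸ R ∙ a)) := by
  obtain ⟨w, hw⟩ := hdiv a v ha
  have hv0 : π v = 0 := by
    have : v ∈ LinearMap.ker π := hker ▸ Submodule.mem_span_singleton_self v
    exact this
  let ψ : (R ⧸ R ∙ a) →ₗ[R] Q := (R ∙ a).liftQ (LinearMap.toSpanSingleton R Q (π w)) (by
    rw [Submodule.span_singleton_le_iff_mem, LinearMap.mem_ker,
      LinearMap.toSpanSingleton_apply, ← map_smul, hw, hv0])
  have hψ : ∀ r : R, ψ (Submodule.Quotient.mk r) = r • π w := fun r => rfl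
  let L : R →ₗ[R] ((R ⧸ R ∙ a) →ₗ[R] Q) := LinearMap.toSpanSingleton R _ ψ
  have hL : ∀ r s : R, L r (Submodule.Quotient.mk s) = π ((r * s) • w) := fun r s => by
    change r • ψ _ = _
    rw [hψ, smul_smul, map_smul]
  have hkL : LinearMap.ker L = R ∙ a := by
    ext r
    rw [LinearMap.mem_ker, Submodule.mem_span_singleton]
    constructor
    · intro hr
      have h1 := hL r 1
      rw [hr, LinearMap.zero_apply, mul_one] at h1
      have h2 : r • w ∈ LinearMap.ker π := h1.symm
      rw [hker, Submodule.mem_span_singleton] at h2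
      obtain ⟨s, hs⟩ := h2
      refine ⟨s, ?_⟩
      have h3 : (s * a - r) • w = 0 := by
        rw [sub_smul, mul_smul, hw, hs, sub_self]
      rcases htf _ _ h3 with h4 | h4
      · exact sub_eq_zero.1 h4
      · rw [h4, smul_zero] at hw
        exact absurd hw.symm hv
    · rintro ⟨s, rfl⟩
      refine LinearMap.ext fun x => ?_
      obtain ⟨x, rfl⟩ := Submodule.Quotient.mk_surjective _ x
      rw [hL, smul_eq_mul, mul_right_comm, mul_smul, hw, map_smul, hv0, smul_zero,
        LinearMap.zero_apply]
  have hsL : Function.Surjective L := by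
    intro φ
    obtain ⟨x, hx⟩ := hπ (φ (Submodule.Quotient.mk 1))
    have h1 : a • x ∈ LinearMap.ker π := by
      rw [LinearMap.mem_ker, map_smul, hx, ← map_smul, ← Submodule.Quotient.mk_smul]
      have : (Submodule.Quotient.mk (a • (1 : R)) : R ⧸ R ∙ a) = 0 := by
        rw [Submodule.Quotient.mk_eq_zero, smul_eq_mul, mul_one]
        exact Submodule.mem_span_singleton_self a
      rw [this, map_zero]
    rw [hker, Submodule.mem_span_singleton] at h1
    obtain ⟨s, hs⟩ := h1
    have h2 : x = s • w := by
      have h3 : a • (x - s • w) = 0 := by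
        rw [smul_sub, ← hs, smul_comm, hw, sub_self]
      exact sub_eq_zero.1 ((htf _ _ h3).resolve_left ha)
    refine ⟨s, LinearMap.ext fun y => ?_⟩
    obtain ⟨y, rfl⟩ := Submodule.Quotient.mk_surjective _ y
    have h4 : (Submodule.Quotient.mk y : R ⧸ R ∙ a) = y • Submodule.Quotient.mk 1 := by
      rw [← Submodule.Quotient.mk_smul, smul_eq_mul, mul_one]
    rw [hL, h4, LinearMap.map_smul φ, ← hx, h2, ← LinearMap.map_smul π, smul_smul, mul_comm]
  exact ⟨((Submodule.quotEquivOfEq _ _ hkL.symm).trans (L.quotKerEquivOfSurjective hsL)).symm⟩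

/-- A finitely generated torsion module is isomorphic to its dual with values in `V / R v`, where
`V` is divisible and torsion-free. -/
lemma nonempty_dual (hπ : Function.Surjective π) (hker : LinearMap.ker π = R ∙ v)
    (hdiv : ∀ (a : R) (x : V), a ≠ 0 → ∃ y, a • y = x)
    (htf : ∀ (a : R) (x : V), a • x = 0 → a = 0 ∨ x = 0) (hv : v ≠ 0)
    (M : Type) [AddCommGroup M] [Module R M] [Module.Finite R M]
    (hM : ∀ m : M, ∃ a : R, a ≠ 0 ∧ a • m = 0) :
    Nonempty ((M →ₗ[R] Q) ≃ₗ[R] M) := by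
  classical
  have hM' : Module.IsTorsion R M := fun {m} => by
    obtain ⟨a, ha, h⟩ := hM m
    exact ⟨⟨a, mem_nonZeroDivisors_of_ne_zero ha⟩, h⟩
  obtain ⟨ι, _, p, hp, e, ⟨φ⟩⟩ := Module.equiv_directSum_of_isTorsion hM'
  have ψ := fun i => (nonempty_dual_cyclic π v hπ hker hdiv htf hv (p i ^ e i)
    (pow_ne_zero _ (hp i).ne_zero)).some
  -- The structure theorem reduces to cyclic summands; the dual of a finite direct sum is the
  -- product of the duals. The isomorphism is not canonical, but only dimensions are used later.
  exact ⟨(φ.congrLeft Q R).trans <| (DFinsupp.lsum R).symm.trans <|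
    (LinearEquiv.piCongrRight ψ).trans <|
    (DirectSum.linearEquivFunOnFintype R ι _).symm.trans φ.symm⟩

end Duality

/-- Finitely generated torsion modules over a discrete valuation ring with residue field `k` are
finite-dimensional over `k`. -/
lemma finite_of_torsion {k R : Type} [Field k] [CommRing R] [IsDomain R]
    [IsDiscreteValuationRing R] [Algebra k R]
    (hk : Function.Surjective ((IsLocalRing.residue R).comp (algebraMap k R)))
    (M : Type) [AddCommGroup M] [Module R M] [Module k M] [IsScalarTower k R M]
    [Module.Finite R M] (hM : ∀ m : M, ∃ a : R, a ≠ 0 ∧ a • m = 0) : Module.Finite k M := by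
  classical
  obtain ⟨t, ht⟩ := IsDiscreteValuationRing.exists_irreducible R
  have hdec : ∀ r : R, ∃ (c : k) (s : R), r = algebraMap k R c + s * t := by
    intro r
    obtain ⟨c, hc⟩ := hk (IsLocalRing.residue R r)
    have : r - algebraMap k R c ∈ IsLocalRing.maximalIdeal R := by
      rw [← IsLocalRing.residue_eq_zero_iff, map_sub, sub_eq_zero]
      exact hc.symm
    rw [ht.maximalIdeal_eq, Ideal.mem_span_singleton'] at this
    obtain ⟨s, hs⟩ := this
    exact ⟨c, s, by rw [hs]; ring⟩
  -- Induction on the power of the uniformizer killing `N`. Since every scalar is `c + s t` with `c`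
  -- in `k`, `N` is the `k`-span of its generators plus `tN`.
  have main : ∀ (n : ℕ) (N : Submodule R M), N.FG → (∀ m ∈ N, t ^ n • m = 0) →
      (N.restrictScalars k).FG := by
    intro n
    induction n with
    | zero =>
      intro N _ hN
      have : N.restrictScalars k = ⊥ := by
        rw [eq_bot_iff]
        intro m hm
        simpa using hN m hm
      rw [this]
      exact Submodule.fg_bot
    | succ n ih =>
      intro N hN htN
      have h1 := ih (N.map (LinearMap.lsmul R M t)) (hN.map _) (by
        rintro _ ⟨m, hm, rfl⟩
        rw [LinearMap.lsmul_apply, smul_smul, ← pow_succ]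
        exact htN m hm)
      obtain ⟨S, hS⟩ := hN
      have h2 : N.restrictScalars k =
          Submodule.span k (S : Set M) ⊔ (N.map (LinearMap.lsmul R M t)).restrictScalars k := by
        apply le_antisymm
        · intro m hm'
          have hm : m ∈ Submodule.span R (S : Set M) := hS ▸ hm'
          clear hm'
          induction hm using Submodule.span_induction with
          | mem x hx => exact Submodule.mem_sup_left (Submodule.subset_span hx)
          | zero => exact zero_mem _
          | add x y _ _ hx hy => exact add_mem hx hy
          | smul r x hx hx' =>
            obtain ⟨c, s, rfl⟩ := hdec r
            rw [add_smul, algebraMap_smul]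
            refine add_mem (Submodule.smul_mem _ c hx') (Submodule.mem_sup_right ?_)
            refine ⟨s • x, N.smul_mem s (hS ▸ hx), ?_⟩
            rw [LinearMap.lsmul_apply, smul_smul, mul_comm]
        · rw [sup_le_iff, Submodule.span_le]
          refine ⟨fun x hx => hS ▸ Submodule.subset_span hx, ?_⟩
          rintro _ ⟨m, hm, rfl⟩
          exact N.smul_mem t hm
      rw [h2]
      exact (Submodule.fg_span S.finite_toSet).sup h1
  obtain ⟨S, hS⟩ := Module.Finite.fg_top (R := R) (M := M)
  choose a ha0 ha using hM
  -- The product of annihilators of the generators kills the whole module, and up to a unit it is a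
  -- power of `t`.
  have hA : (∏ m ∈ S, a m) ≠ 0 := Finset.prod_ne_zero_iff.2 fun m _ => ha0 m
  obtain ⟨n, u, hu⟩ := IsDiscreteValuationRing.eq_unit_mul_pow_irreducible hA ht
  have hkill : ∀ m : M, (∏ m ∈ S, a m) • m = 0 := by
    intro m
    have hm : m ∈ Submodule.span R (S : Set M) := hS ▸ Submodule.mem_top
    induction hm using Submodule.span_induction with
    | mem x hx =>
      rw [← Finset.prod_erase_mul _ _ (Finset.mem_coe.1 hx), mul_smul, ha, smul_zero]
    | zero => exact smul_zero _
    | add x y _ _ hx hy => rw [smul_add, hx, hy, add_zero]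
    | smul r x _ hx => rw [smul_comm, hx, smul_zero]
  have := main n ⊤ Module.Finite.fg_top (fun m _ => by
    have h1 := hkill m
    rw [hu, mul_smul] at h1
    have h2 := congrArg (fun x => (↑u⁻¹ : R) • x) h1
    simpa [smul_smul] using h2)
  exact ⟨this⟩

end

section

section Scalars

variable {C : Scheme.{0}} [C.Over (Spec (.of ℂ))]

/-! ### Complex scalars on stalks -/

instance (x : C) : Algebra ℂ (C.presheaf.stalk x) :=
  ((germO (U := ⊤) x (mem_top x)).comp (scalars C)).toAlgebra

instance (M : C.Modules) (x : C) : Module ℂ (stalk M x) :=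
  Module.compHom _ (algebraMap ℂ (C.presheaf.stalk x))

instance (M : C.Modules) (x : C) : IsScalarTower ℂ (C.presheaf.stalk x) (stalk M x) where
  smul_assoc c a m := by
    rw [Algebra.smul_def, mul_smul]; rfl

lemma smul_hom_app {M N : C.Modules} (c : ℂ) (f : M ⟶ N) {U : C.Opens} (s : Γ(M, U)) :
    (c • f).app U s = resO (le_top : U ≤ ⊤) (scalars C c) • f.app U s := by
  have h : c • f = f ≫ globalSmul (scalars C c) N :=
    Linear.smulOfRingMorphism_smul_eq' ((globalToCenter C).comp (scalars C)) c f
  rw [h, Scheme.Modules.Hom.comp_app]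
  rfl

lemma stalkMap_smul {M N : C.Modules} (c : ℂ) (f : M ⟶ N) (x : C) :
    stalkMap (c • f) x = c • stalkMap f x := by
  ext m
  obtain ⟨U, hU, s, rfl⟩ := exists_germ M m
  rw [stalkMap_germ, smul_hom_app, germ_smul, germO_resO, LinearMap.smul_apply, stalkMap_germ]
  rfl

/-- The map on stalks as a `ℂ`-linear map. -/
def stalkMapLinear (M N : C.Modules) (x : C) :
    (M ⟶ N) →ₗ[ℂ] (stalk M x →ₗ[C.presheaf.stalk x] stalk N x) where
  toFun f := stalkMap f x
  map_add' f g := stalkMap_add f g x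
  map_smul' c f := stalkMap_smul c f x

end Scalars

variable {C : Scheme.{0}} [C.Over (Spec (.of ℂ))] [hC : IsSmoothProjectiveCurve C]

/-! ### Torsion sheaves on curves -/

lemma isClosed_of_ne {x : C} (hx : x ≠ genericPoint C) : IsClosed ({x} : Set C) :=
  (eq_genericPoint_or_isClosed x).resolve_left hx

/-- A neighborhood of `x` that avoids finitely many other closed points. -/
lemma exists_avoid (D : Set C) (hD : D.Finite) (hη : genericPoint C ∉ D) (x : C) :
    ∃ V : C.Opens, x ∈ V ∧ ∀ y ∈ V, y ∈ D → y = x := by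
  have hcl : IsClosed (D \ {x}) := by
    rw [← Set.biUnion_of_singleton (D \ {x})]
    refine (hD.subset Set.sdiff_subset).isClosed_biUnion fun y hy => isClosed_of_ne ?_
    rintro rfl
    exact hη hy.1
  refine ⟨⟨(D \ {x})ᶜ, hcl.isOpen_compl⟩, fun h => h.2 rfl, fun y hy hyD => ?_⟩
  by_contra hne
  exact hy ⟨hyD, hne⟩

/-- A section that vanishes at the generic point vanishes outside of a finite set. -/
lemma exists_support {T : C.Modules} {U : C.Opens} (s : Γ(T, U)) (hη : genericPoint C ∈ U)
    (hs : germ T (genericPoint C) hη s = 0) :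
    ∃ D : Set C, D.Finite ∧ genericPoint C ∉ D ∧ ∀ (y : C) (hy : y ∈ U), y ∉ D →
      germ T y hy s = 0 := by
  obtain ⟨W, hW, i, j, e⟩ := germ_eq T hη hη (hs.trans (map_zero (germ T _ hη)).symm)
  refine ⟨(W : Set C)ᶜ, finite_compl W hW, fun h => h hW, fun y hy hyD => ?_⟩
  have hyW : y ∈ W := by
    by_contra h
    exact hyD h
  have h1 := congrArg (germ T y hyW) e
  rwa [germ_res, germ_res, map_zero] at h1

lemma exists_support_hom {Q R : C.Modules} (f : Q ⟶ R) (hQ : FG Q)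
    (hf : stalkMap f (genericPoint C) = 0) :
    ∃ D : Set C, D.Finite ∧ genericPoint C ∉ D ∧ ∀ y ∉ D, stalkMap f y = 0 := by
  obtain ⟨U, hU, n, e, he⟩ := hQ (genericPoint C)
  have := fun j => exists_support (f.app U (e j)) hU (by
    rw [← stalkMap_germ, hf, LinearMap.zero_apply])
  choose D hD hηD h0 using this
  refine ⟨(U : Set C)ᶜ ∪ ⋃ j, D j, (finite_compl U hU).union (Set.finite_iUnion hD), ?_, ?_⟩
  · rintro (h | h)
    · exact h hU
    · obtain ⟨j, hj⟩ := Set.mem_iUnion.1 h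
      exact hηD j hj
  · intro y hy
    rw [Set.mem_union, not_or, Set.mem_iUnion, not_exists] at hy
    have hyU : y ∈ U := by
      by_contra h
      exact hy.1 h
    ext m
    obtain ⟨c, rfl⟩ := he y hyU m
    rw [← comb_app, comb_apply, LinearMap.zero_apply]
    exact Finset.sum_eq_zero fun j _ => by rw [h0 j y hyU (hy.2 j), smul_zero]

/-- A morphism to a sheaf with zero generic stalk can be prescribed on finitely many stalks. -/
lemma exists_hom_of_stalks {P T : C.Modules} (hT : ∀ t : stalk T (genericPoint C), t = 0)
    (D : Set C) (hD : D.Finite) (hη : genericPoint C ∉ D)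
    (φ : ∀ p : C, stalk P p →ₗ[C.presheaf.stalk p] stalk T p) :
    ∃ f : P ⟶ T, (∀ p ∈ D, stalkMap f p = φ p) ∧ ∀ p ∉ D, stalkMap f p = 0 := by
  classical
  let ψ : ∀ p : C, stalk P p →ₗ[C.presheaf.stalk p] stalk T p := fun p => if p ∈ D then φ p else 0
  have hτ : ∀ (U : C.Opens) (s : Γ(P, U)), ∃ t : Γ(T, U), ∀ (y : C) (hy : y ∈ U),
      germ T y hy t = ψ y (germ P y hy s) := by
    intro U s
    obtain ⟨t, ht⟩ := exists_glue T (U := U)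
      (fun y => if hy : y ∈ U then ψ y (germ P y hy s) else 0) (by
        intro x hx
        by_cases hxD : x ∈ D
        · obtain ⟨W, hW, t, ht⟩ := exists_germ T (φ x (germ P x hx s))
          obtain ⟨D', hD', hη', h0⟩ := exists_support t (genericPoint_mem hW) (hT _)
          obtain ⟨V, hV, hVD⟩ := exists_avoid (D ∪ D') (hD.union hD')
            (by rintro (h | h); exacts [hη h, hη' h]) x
          refine ⟨V ⊓ (W ⊓ U), mem_inf hV (mem_inf hW hx), inf_le_right.trans inf_le_right,
            res T (inf_le_right.trans inf_le_left) t, fun y hy => ?_⟩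
          have hyU : y ∈ U := hy.2.2
          rw [germ_res, dif_pos hyU]
          by_cases hyx : y = x
          · subst hyx
            rw [ht]
            simp only [ψ, if_pos hxD]
          · have h1 : y ∉ D ∪ D' := fun h => hyx (hVD y hy.1 h)
            rw [Set.mem_union, not_or] at h1
            rw [h0 y _ h1.2]
            simp only [ψ, if_neg h1.1]
            rfl
        · obtain ⟨V, hV, hVD⟩ := exists_avoid D hD hη x
          refine ⟨V ⊓ U, mem_inf hV hx, inf_le_right, 0, fun y hy => ?_⟩
          have hyU : y ∈ U := hy.2
          have hyD : y ∉ D := fun h => hxD (hVD y hy.1 h ▸ h)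
          rw [map_zero, dif_pos hyU]
          simp only [ψ, if_neg hyD]
          rfl)
    exact ⟨t, fun y hy => by rw [ht y hy, dif_pos hy]⟩
  choose t ht using hτ
  let f : P ⟶ T := homMk (fun U =>
      { toFun := t U
        map_zero' := section_ext T fun y hy => by rw [ht, map_zero, map_zero, map_zero]
        map_add' := fun a b => section_ext T fun y hy => by
          rw [ht, map_add, map_add, map_add, ht, ht] })
    (fun U a s => section_ext T fun y hy => by
      change germ T y hy (t U (a • s)) = germ T y hy (a • t U s)
      rw [ht, germ_smul, germ_smul, ht, map_smul])
    (fun {U V} i s => section_ext T fun y hy => by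
      change germ T y hy (t V (res P i s)) = germ T y hy (res T i (t U s))
      rw [ht, germ_res, germ_res, ht])
  have hf : ∀ p, stalkMap f p = ψ p := by
    intro p
    ext m
    obtain ⟨U, hU, s, rfl⟩ := exists_germ P m
    rw [stalkMap_germ]
    exact ht U s p hU
  exact ⟨f, fun p hp => (hf p).trans (if_pos hp), fun p hp => (hf p).trans (if_neg hp)⟩

/-- Morphisms to a sheaf with zero generic stalk are finite families of maps of stalks. -/
def homEquivStalks {P T : C.Modules} (hT : ∀ t : stalk T (genericPoint C), t = 0)
    (D : Set C) (hD : D.Finite) (hη : genericPoint C ∉ D)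
    (h : ∀ y ∉ D, ∀ φ : stalk P y →ₗ[C.presheaf.stalk y] stalk T y, φ = 0) :
    (P ⟶ T) ≃ₗ[ℂ] (∀ p : D, (stalk P p.1 →ₗ[C.presheaf.stalk p.1] stalk T p.1)) :=
  LinearEquiv.ofBijective (LinearMap.pi fun p : D => stalkMapLinear P T p.1) <| by
    constructor
    · intro f g hfg
      apply hom_ext_stalk
      intro x
      by_cases hx : x ∈ D
      · exact congr_fun hfg ⟨x, hx⟩
      · rw [h x hx (stalkMap f x), h x hx (stalkMap g x)]
    · intro φ
      classical
      obtain ⟨f, hf, -⟩ := exists_hom_of_stalks hT D hD hη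
        (fun p => if hp : p ∈ D then φ ⟨p, hp⟩ else 0)
      refine ⟨f, funext fun p => ?_⟩
      exact (hf p.1 p.2).trans (dif_pos p.2)

end

section

section Generic

variable {X : Scheme.{0}} [IsIntegral X]

/-! ### Constant sheaves and torsion -/

/-- All germs are killed by nonzero functions. -/
def Tors (T : X.Modules) : Prop :=
  ∀ (x : X) (m : stalk T x), ∃ a : X.presheaf.stalk x, a ≠ 0 ∧ a • m = 0

lemma Tors.generic {T : X.Modules} (h : Tors T) (t : stalk T (genericPoint X)) : t = 0 := by
  obtain ⟨a, ha, h1⟩ := h _ t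
  exact (smul_eq_zero (R := X.functionField)).1 h1 |>.resolve_left ha

lemma Tors.of_mono {S T : X.Modules} (f : S ⟶ T) [Mono f] (h : Tors T) : Tors S := fun x m => by
  obtain ⟨a, ha, h1⟩ := h x (stalkMap f x m)
  refine ⟨a, ha, stalkMap_injective f x ?_⟩
  rw [map_smul, h1, map_zero]

section Sky

variable (N : Type) [AddCommGroup N] [Module X.functionField N]

/-- The identification of the stalks of a constant sheaf. -/
def skyVal (x : X) : stalk (sky (genericPoint X) N) x →+ N :=
  (skyCounit (genericPoint X) N).toAddMonoidHom.comp (sp _ x)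

lemma skyVal_germ {U : X.Opens} (x : X) (hx : x ∈ U) (s : Γ(sky (genericPoint X) N, U)) :
    skyVal N x (germ _ x hx s) = skyEval (genericPoint X) N U (genericPoint_mem hx) s := by
  change skyCounit (genericPoint X) N (sp _ x _) = _
  rw [sp_germ, skyCounit_germ]

lemma skyVal_smul (x : X) (a : X.presheaf.stalk x) (m : stalk (sky (genericPoint X) N) x) :
    skyVal N x (a • m) = algebraMap _ X.functionField a • skyVal N x m := by
  change skyCounit (genericPoint X) N (sp _ x _) = _ • skyCounit (genericPoint X) N (sp _ x _)
  rw [sp_smul, map_smul]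

/-- Every nonempty open set contains the generic point, so a skyscraper there is a constant sheaf
with the same stalk everywhere. -/
lemma skyVal_bijective (x : X) : Function.Bijective (skyVal N x) := by
  constructor
  · rw [injective_iff_map_eq_zero]
    intro m hm
    obtain ⟨U, hU, s, rfl⟩ := exists_germ _ m
    rw [skyVal_germ] at hm
    have : s = 0 := sky_ext _ _ _ fun hx => hm
    rw [this, map_zero]
  · intro n
    exact ⟨germ _ x (U := ⊤) (mem_top x) (skyMk _ _ _ fun _ => n), by rw [skyVal_germ, skyEval_skyMk]⟩

lemma skyVal_stalkMap {E : X.Modules}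
    (φ : stalk E (genericPoint X) →ₗ[X.presheaf.stalk (genericPoint X)] N) (x : X)
    (m : stalk E x) : skyVal N x (stalkMap (skyLift φ) x m) = φ (sp E x m) := by
  change skyCounit (genericPoint X) N (sp _ x _) = _
  rw [sp_stalkMap, skyCounit_stalkMap_skyLift]

lemma TF_sky : TF (sky (genericPoint X) N) := fun x => by
  have h := (skyVal_bijective N x).1
  have h2 : ⇑(skyVal N x) = skyCounit (genericPoint X) N ∘ sp _ x := rfl
  rw [h2] at h
  exact h.of_comp

end Sky

/-- The constant sheaf of the generic stalk. -/
abbrev genSheaf (M : X.Modules) : X.Modules := sky (genericPoint X) (stalk M (genericPoint X))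

/-- The canonical map to the constant sheaf of the generic stalk. -/
def toGen (M : X.Modules) : M ⟶ genSheaf M := skyLift LinearMap.id

lemma skyVal_toGen (M : X.Modules) (x : X) (m : stalk M x) :
    skyVal _ x (stalkMap (toGen M) x m) = sp M x m := by
  rw [toGen, skyVal_stalkMap, LinearMap.id_apply]

lemma mono_toGen {M : X.Modules} (h : TF M) : Mono (toGen M) := by
  apply mono_of_stalkMap_injective
  intro x a b hab
  apply h x
  rw [← skyVal_toGen, hab, skyVal_toGen]

lemma toGen_generic_bijective (M : X.Modules) :
    Function.Bijective (stalkMap (toGen M) (genericPoint X)) := by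
  have h1 : skyCounit (genericPoint X) _ ∘ stalkMap (toGen M) (genericPoint X) = id := by
    funext m
    exact skyCounit_stalkMap_skyLift _ _ _ _
  exact (Function.Bijective.of_comp_iff' (skyCounit_bijective _ _) _).1
    (h1 ▸ Function.bijective_id)

/-! ### The structure sheaf -/

/-- The germ of the function `1`. -/
def oneGerm (x : X) : stalk (structureSheaf X) x := germ _ (U := ⊤) x (mem_top x) (toSec 1)

/-- The stalk of the structure sheaf as a module. -/
def stalkStructureEquiv (x : X) :
    X.presheaf.stalk x ≃ₗ[X.presheaf.stalk x] stalk (structureSheaf X) x :=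
  (LinearEquiv.funUnique (Fin 1) _ _).symm.trans
    (LinearEquiv.ofBijective _ (isFrame_toSec_one (X := X) ⊤ x (mem_top x)))

lemma stalkStructureEquiv_apply (x : X) (a : X.presheaf.stalk x) :
    stalkStructureEquiv x a = a • oneGerm x := by
  change comb _ _ x (mem_top x) _ = _
  rw [comb_apply, Fin.sum_univ_one]
  rfl

lemma isLocallyFree_structureSheaf : IsLocallyFreeOfRank (structureSheaf X) 1 := by
  rw [isLocallyFree_iff_frame]
  exact fun x => ⟨⊤, trivial, _, isFrame_toSec_one ⊤⟩

/-- Vector spaces over the function field are injective modules. -/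
instance injective_constant (N : Type) [AddCommGroup N] [Module X.functionField N] :
    Injective (sky (genericPoint X) N) := by
  have : Module.Injective X.functionField N := Module.injective_of_isSemisimpleRing _ _
  exact sky_injective _ _

variable (X) in
/-- The quotient of the constant sheaf of rational functions by the structure sheaf. -/
abbrev polarSheaf : X.Modules := cokernel (toGen (structureSheaf X))

variable (X) in
/-- The injective resolution of the structure sheaf. -/
abbrev polarSequence : ShortComplex X.Modules :=
  ShortComplex.mk (toGen (structureSheaf X)) (cokernel.π _) (cokernel.condition _)

lemma polarSequence_shortExact : (polarSequence X).ShortExact :=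
  have : Mono (toGen (structureSheaf X)) :=
    mono_toGen (TF_of_isLocallyFree isLocallyFree_structureSheaf)
  { exact := ShortComplex.exact_cokernel _
    mono_f := this }

lemma exists_skyVal_smul_eq (N : Type) [AddCommGroup N] [Module X.functionField N] (x : X)
    (a : X.presheaf.stalk x) (ha : a ≠ 0) (m : stalk (sky (genericPoint X) N) x) :
    ∃ m', a • m' = m := by
  obtain ⟨m', hm'⟩ := (skyVal_bijective N x).2
    ((algebraMap _ X.functionField a)⁻¹ • skyVal N x m)
  refine ⟨m', (skyVal_bijective N x).1 ?_⟩
  rw [skyVal_smul, hm', smul_smul, mul_inv_cancel₀, one_smul]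
  exact fun h => ha (algebraMap_injective x (h.trans (map_zero _).symm))

lemma sky_smul_eq_zero (N : Type) [AddCommGroup N] [Module X.functionField N] (x : X)
    (a : X.presheaf.stalk x) (m : stalk (sky (genericPoint X) N) x) (h : a • m = 0) :
    a = 0 ∨ m = 0 := by
  have h1 := congrArg (skyVal N x) h
  rw [skyVal_smul, map_zero, smul_eq_zero] at h1
  refine h1.imp (fun h2 => ?_) (fun h2 => ?_)
  · exact algebraMap_injective x (h2.trans (map_zero _).symm)
  · exact (skyVal_bijective N x).1 (h2.trans (map_zero _).symm)

/-- At the generic point `𝒪` already equals `𝒦`, so nothing is left in the quotient. -/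
lemma polar_generic (t : stalk (polarSheaf X) (genericPoint X)) : t = 0 := by
  obtain ⟨t, rfl⟩ := stalkMap_surjective (cokernel.π (toGen (structureSheaf X))) _ t
  obtain ⟨m, rfl⟩ := (toGen_generic_bijective _).2 t
  rw [← stalkMap_comp, cokernel.condition, stalkMap_zero]
  rfl

lemma polar_stalk_injective (x : X) [IsPrincipalIdealRing (X.presheaf.stalk x)] :
    Module.Injective (X.presheaf.stalk x) (stalk (polarSheaf X) x) := by
  apply injective_of_divisible
  intro a q ha
  obtain ⟨q, rfl⟩ := stalkMap_surjective (cokernel.π (toGen (structureSheaf X))) _ q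
  obtain ⟨q', rfl⟩ := exists_skyVal_smul_eq _ x a ha q
  exact ⟨stalkMap _ x q', (map_smul _ _ _).symm⟩

/-- This is `nonempty_dual` for the stalk of `𝒦`, a copy of the function field, with `v` the germ of
`1`; the stalk of `𝒦/𝒪` plays the role of the dualizing module. -/
lemma polar_stalk_dual (x : X) [IsPrincipalIdealRing (X.presheaf.stalk x)]
    (M : Type) [AddCommGroup M] [Module (X.presheaf.stalk x) M] [Module.Finite (X.presheaf.stalk x) M]
    (hM : ∀ m : M, ∃ a : X.presheaf.stalk x, a ≠ 0 ∧ a • m = 0) :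
    Nonempty ((M →ₗ[X.presheaf.stalk x] stalk (polarSheaf X) x) ≃ₗ[X.presheaf.stalk x] M) := by
  have := (polarSequence_shortExact (X := X)).mono_f
  have hone : oneGerm x ≠ 0 := by
    intro h
    have h1 := stalkStructureEquiv_apply x 1
    rw [h, smul_zero, LinearEquiv.map_eq_zero_iff] at h1
    exact one_ne_zero h1
  refine nonempty_dual (stalkMap (cokernel.π (toGen (structureSheaf X))) x)
    (stalkMap (toGen _) x (oneGerm x)) (stalkMap_surjective _ _) ?_
    (fun a v ha => exists_skyVal_smul_eq _ x a ha v) (fun a v h => sky_smul_eq_zero _ x a v h)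
    ?_ M hM
  · ext m
    rw [LinearMap.mem_ker, Submodule.mem_span_singleton]
    constructor
    · intro hm
      obtain ⟨t, rfl⟩ := exact_stalk (polarSequence_shortExact (X := X)).exact x m hm
      obtain ⟨a, rfl⟩ := (stalkStructureEquiv x).surjective t
      exact ⟨a, by rw [stalkStructureEquiv_apply, map_smul]⟩
    · rintro ⟨a, rfl⟩
      rw [map_smul, ← stalkMap_comp, cokernel.condition, stalkMap_zero]
      simp
  · intro h
    exact hone (stalkMap_injective _ _ (h.trans (map_zero _).symm))

end Generic

/-! ### Extending morphisms to `𝒦/𝒪` and extension classes on a curve. -/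

variable {C : Scheme.{0}} [C.Over (Spec (.of ℂ))] [hC : IsSmoothProjectiveCurve C]

instance isPrincipalIdealRing_stalk (x : C) : IsPrincipalIdealRing (C.presheaf.stalk x) := by
  rcases eq_genericPoint_or_isClosed x with rfl | h
  · exact inferInstanceAs (IsPrincipalIdealRing C.functionField)
  · have := isDVR_stalk h
    infer_instance

lemma Tors.exists_support {T : C.Modules} (h : Tors T) (hT : FG T) :
    ∃ D : Set C, D.Finite ∧ genericPoint C ∉ D ∧ ∀ y ∉ D, ∀ t : stalk T y, t = 0 := by
  obtain ⟨D, hD, hη, h0⟩ := exists_support_hom (𝟙 T) hT (by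
    ext t
    rw [h.generic t, map_zero, map_zero])
  refine ⟨D, hD, hη, fun y hy t => ?_⟩
  rw [← stalkMap_id T y t, h0 y hy]
  rfl

/-- Morphisms from finitely generated subsheaves to `𝒦/𝒪` extend. -/
lemma exists_extend_polar {A B : C.Modules} (i : A ⟶ B) [Mono i] (hA : FG A)
    (φ : A ⟶ polarSheaf C) : ∃ ψ : B ⟶ polarSheaf C, i ≫ ψ = φ := by
  obtain ⟨D, hD, hη, h0⟩ := exists_support_hom φ hA (by
    ext m
    exact polar_generic _)
  have : ∀ p : C, ∃ ψ : stalk B p →ₗ[C.presheaf.stalk p] stalk (polarSheaf C) p,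
      ∀ a, ψ (stalkMap i p a) = stalkMap φ p a := fun p =>
    have := polar_stalk_injective (X := C) p
    Module.Injective.out (stalkMap i p) (stalkMap_injective i p) (stalkMap φ p)
  choose ψ hψ using this
  -- Off the finite set `D` the given morphism is zero, so only finitely many of the stalkwise
  -- extensions are needed; elsewhere the extension is zero.
  obtain ⟨f, hf1, hf2⟩ := exists_hom_of_stalks polar_generic D hD hη ψ
  refine ⟨f, hom_ext_stalk fun x => ?_⟩
  ext a
  rw [stalkMap_comp]
  by_cases hx : x ∈ D
  · rw [hf1 x hx, hψ]
  · rw [hf2 x hx, h0 x hx]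
    rfl

/-- `Ext¹(-, 𝒪)` is right exact. -/
lemma ext_precomp_surjective {A B : C.Modules} (i : A ⟶ B) [Mono i] (hA : FG A)
    (v : Ext1 A (structureSheaf C)) :
    ∃ w : Ext1 B (structureSheaf C), (Abelian.Ext.mk₀ i).comp w (zero_add 1) = v := by
  -- Since `𝒦` is injective, every class is the connecting image of a morphism to `𝒦/𝒪`.
  obtain ⟨x, rfl⟩ := Abelian.Ext.covariant_sequence_exact₁ A (polarSequence_shortExact (X := C)) v
    (Abelian.Ext.eq_zero_of_injective _) (zero_add 1)
  obtain ⟨φ, rfl⟩ := (Abelian.Ext.mk₀_bijective _ _).2 x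
  obtain ⟨ψ, rfl⟩ := exists_extend_polar i hA φ
  refine ⟨(Abelian.Ext.mk₀ ψ).comp polarSequence_shortExact.extClass (zero_add 1), ?_⟩
  rw [← Abelian.Ext.mk₀_comp_mk₀, Abelian.Ext.comp_assoc_of_second_deg_zero]

end

section

variable {C : Scheme.{0}} [C.Over (Spec (.of ℂ))] [hC : IsSmoothProjectiveCurve C]

/-! ### Cohomology and duality for torsion sheaves -/

/-- Evaluation of linear maps on the stalk of the structure sheaf. -/
def stalkHomEquiv (M : C.Modules) (p : C) :
    (stalk (structureSheaf C) p →ₗ[C.presheaf.stalk p] stalk M p) ≃ₗ[ℂ] stalk M p :=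
  (((stalkStructureEquiv p).congrLeft (stalk M p) (C.presheaf.stalk p)).symm.trans
    (LinearMap.ringLmapEquivSelf _ (C.presheaf.stalk p) _)).restrictScalars ℂ

lemma finite_stalk_of_tors {T : C.Modules} (hT : FG T) (hT' : Tors T) (p : C)
    (hp : p ≠ genericPoint C) : Module.Finite ℂ (stalk T p) := by
  have hp := isClosed_of_ne hp
  have := isDVR_stalk hp
  have := finite_stalk hT p
  exact finite_of_torsion (scalars_residue hp).2 _ (hT' p)

lemma tors_hom_finite {T : C.Modules} (hT : FG T) (hT' : Tors T) :
    Module.Finite ℂ (structureSheaf C ⟶ T) := by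
  obtain ⟨D, hD, hη, h0⟩ := hT'.exists_support hT
  have := hD.to_subtype
  have : ∀ p : D, Module.Finite ℂ
      (stalk (structureSheaf C) p.1 →ₗ[C.presheaf.stalk p.1] stalk T p.1) := fun p =>
    have := finite_stalk_of_tors hT hT' p.1 (fun h => hη (h ▸ p.2))
    Module.Finite.equiv (stalkHomEquiv T p.1).symm
  exact Module.Finite.equiv (homEquivStalks (P := structureSheaf C) hT'.generic D hD hη
    (fun y hy φ => LinearMap.ext fun m => h0 y hy _)).symm

/-- Both sides decompose over the finite support of `T`, where the comparison is the local duality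
`polar_stalk_dual`. -/
lemma tors_dual {T : C.Modules} (hT : FG T) (hT' : Tors T) :
    Nonempty ((T ⟶ polarSheaf C) ≃ₗ[ℂ] (structureSheaf C ⟶ T)) := by
  obtain ⟨D, hD, hη, h0⟩ := hT'.exists_support hT
  have e1 := homEquivStalks (P := structureSheaf C) hT'.generic D hD hη
    (fun y hy φ => LinearMap.ext fun m => h0 y hy _)
  have e2 := homEquivStalks (P := T) (T := polarSheaf C) polar_generic D hD hη
    (fun y hy φ => LinearMap.ext fun m => by rw [h0 y hy m, map_zero, map_zero])
  have e3 : ∀ p : D, (stalk T p.1 →ₗ[C.presheaf.stalk p.1] stalk (polarSheaf C) p.1) ≃ₗ[ℂ]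
      (stalk (structureSheaf C) p.1 →ₗ[C.presheaf.stalk p.1] stalk T p.1) := fun p =>
    have := finite_stalk hT p.1
    ((polar_stalk_dual p.1 (stalk T p.1) (hT' p.1)).some.restrictScalars ℂ).trans
      (stalkHomEquiv T p.1).symm
  exact ⟨e2.trans ((LinearEquiv.piCongrRight e3).trans e1.symm)⟩

lemma hom_constant_eq_zero {T : C.Modules} (hT' : Tors T) (N : Type) [AddCommGroup N]
    [Module C.functionField N] (f : T ⟶ sky (genericPoint C) N) : f = 0 := by
  apply sky_hom_ext
  ext t
  rw [hT'.generic t, map_zero, map_zero]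

/-- The connecting map of `𝒪 → 𝒦 → 𝒦/𝒪` is bijective: a torsion sheaf has no morphism to a constant
sheaf, and `𝒦` is injective. -/
lemma ext_tors_equiv {T : C.Modules} (hT' : Tors T) :
    Nonempty ((T ⟶ polarSheaf C) ≃ₗ[ℂ] Ext1 T (structureSheaf C)) := by
  let L : (T ⟶ polarSheaf C) →ₗ[ℂ] Ext1 T (structureSheaf C) :=
    ((polarSequence_shortExact (X := C)).extClass.postcompOfLinear ℂ T (zero_add 1)).comp
      (Abelian.Ext.linearEquiv₀ (R := ℂ)).symm.toLinearMap
  have hL : ∀ f, L f =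
      (Abelian.Ext.mk₀ f).comp polarSequence_shortExact.extClass (zero_add 1) := fun f => rfl
  refine ⟨LinearEquiv.ofBijective L ⟨?_, ?_⟩⟩
  · rw [injective_iff_map_eq_zero]
    intro f hf
    rw [hL] at hf
    obtain ⟨x, hx⟩ := Abelian.Ext.covariant_sequence_exact₃ T _ _ _ hf
    obtain ⟨g, rfl⟩ := (Abelian.Ext.mk₀_bijective _ _).2 x
    rw [Abelian.Ext.mk₀_comp_mk₀] at hx
    rw [← (Abelian.Ext.mk₀_bijective _ _).1 hx, hom_constant_eq_zero hT' _ g, zero_comp]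
  · intro v
    obtain ⟨x, rfl⟩ := Abelian.Ext.covariant_sequence_exact₁ T
      (polarSequence_shortExact (X := C)) v (Abelian.Ext.eq_zero_of_injective _) (zero_add 1)
    obtain ⟨φ, rfl⟩ := (Abelian.Ext.mk₀_bijective _ _).2 x
    exact ⟨φ, rfl⟩

/-- `Ext¹(T, 𝒪)` has the dimension of `H⁰(T)`. -/
lemma ext_tors {T : C.Modules} (hT : FG T) (hT' : Tors T) :
    Nonempty (Ext1 T (structureSheaf C) ≃ₗ[ℂ] (structureSheaf C ⟶ T)) :=
  ⟨(ext_tors_equiv hT').some.symm.trans (tors_dual hT hT').some⟩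

/-- A germ at one point of the support, extended by zero at the others, is a global section; so no
sections means no stalks. -/
lemma tors_eq_zero {T : C.Modules} (hT : FG T) (hT' : Tors T)
    (h : ∀ f : structureSheaf C ⟶ T, f = 0) (x : C) (t : stalk T x) : t = 0 := by
  classical
  obtain ⟨D, hD, hη, h0⟩ := hT'.exists_support hT
  by_cases hx : x ∈ D
  · obtain ⟨f, hf, -⟩ := exists_hom_of_stalks (P := structureSheaf C) hT'.generic D hD hη
      (fun p => if hp : p = x then
        (LinearMap.toSpanSingleton _ _ (hp ▸ t)).comp (stalkStructureEquiv p).symm.toLinearMap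
        else 0)
    have h1 := hf x hx
    rw [h f, dif_pos rfl, stalkMap_zero] at h1
    have h2 := congr($h1 (stalkStructureEquiv x 1))
    simpa using h2.symm
  · exact h0 x hx t

/-- Local lifts are unique off `D`. Neighborhoods meeting `D` at most in their centre make the only
ambiguous germs occur in a single chart, so the lifts glue. -/
lemma exists_lift_section {I J : C.Modules} (f : I ⟶ J) [Epi f] (D : Set C) (hD : D.Finite)
    (hη : genericPoint C ∉ D) (hf : ∀ y ∉ D, Function.Injective (stalkMap f y)) (j : Γ(J, ⊤)) :
    ∃ i : Γ(I, ⊤), f.app ⊤ i = j := by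
  have hloc : ∀ x : C, ∃ (V : C.Opens) (_ : x ∈ V) (t : Γ(I, V)),
      f.app V t = res J le_top j ∧ ∀ y ∈ V, y ∈ D → y = x := fun x => by
    obtain ⟨V, hV, i, t, ht⟩ := exists_lift_of_epi f j (mem_top x)
    obtain ⟨W, hW, hWD⟩ := exists_avoid D hD hη x
    exact ⟨V ⊓ W, mem_inf hV hW, res I inf_le_left t, by rw [app_res, ht, res_res],
      fun y hy => hWD y hy.2⟩
  choose V hV t ht hD' using hloc
  obtain ⟨s, hs⟩ := exists_glue I (U := ⊤) (fun x => germ I x (hV x) (t x)) (by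
    intro x _
    refine ⟨V x, hV x, le_top, t x, fun y hy => ?_⟩
    by_cases hyD : y ∈ D
    · obtain rfl := hD' x y hy hyD
      rfl
    · apply hf y hyD
      rw [stalkMap_germ, stalkMap_germ, ht, ht, germ_res, germ_res])
  refine ⟨s, section_ext J fun y hy => ?_⟩
  rw [← stalkMap_germ, hs, stalkMap_germ, ht, germ_res]

/-- Torsion sheaves have no first cohomology. -/
lemma ext_structureSheaf_tors {T : C.Modules} (hT : FG T) (hT' : Tors T)
    (v : Abelian.Ext.{1} (structureSheaf C) T 1) : v = 0 := by
  obtain ⟨D, hD, hη, h0⟩ := hT'.exists_support hT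
  have hS : (ShortComplex.mk (Injective.ι T) (cokernel.π _) (cokernel.condition _)).ShortExact :=
    { exact := ShortComplex.exact_cokernel _ }
  obtain ⟨x, rfl⟩ := Abelian.Ext.covariant_sequence_exact₁ _ hS v
    (Abelian.Ext.eq_zero_of_injective _) (zero_add 1)
  obtain ⟨φ, rfl⟩ := (Abelian.Ext.mk₀_bijective _ _).2 x
  -- The kernel of the quotient map of the injective embedding is `T`, which has zero stalks off
  -- `D`; so global sections of the cokernel lift and the connecting map vanishes.
  obtain ⟨i, hi⟩ := exists_lift_section (cokernel.π (Injective.ι T)) D hD hη (by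
    intro y hy
    rw [injective_iff_map_eq_zero]
    intro m hm
    obtain ⟨a, rfl⟩ := exact_stalk hS.exact y m hm
    rw [h0 y hy a, map_zero]) (φ.app ⊤ (toSec 1))
  have hφ : φ = ofSection i ≫ cokernel.π (Injective.ι T) := by
    apply hom_structureSheaf_ext
    rw [Scheme.Modules.Hom.comp_app]
    refine hi.symm.trans ?_
    change _ = (cokernel.π (Injective.ι T)).app ⊤ ((ofSection i).app ⊤ (toSec 1))
    rw [ofSection_app, ofSec_toSec, one_smul, res_self]
  rw [hφ, ← Abelian.Ext.mk₀_comp_mk₀, Abelian.Ext.comp_assoc_of_second_deg_zero, hS.comp_extClass,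
    Abelian.Ext.comp_zero]

end

section

variable {C : Scheme.{0}} [C.Over (Spec (.of ℂ))] [hC : IsSmoothProjectiveCurve C]

/-! ### Vector bundles on curves -/

/-- `M` is locally free of finite rank. -/
structure VB (M : C.Modules) : Prop where
  fg : FG M
  tf : TF M

lemma VB.isLocallyFree {M : C.Modules} (h : VB M) : IsLocallyFreeOfRank M (grank M) :=
  isLocallyFree_of_FG_TF h.fg h.tf

lemma VB.of_isLocallyFree {M : C.Modules} {n : ℕ} (h : IsLocallyFreeOfRank M n) : VB M :=
  ⟨FG_of_isLocallyFree h, TF_of_isLocallyFree h⟩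

lemma isLocallyFree_iff {M : C.Modules} {n : ℕ} :
    IsLocallyFreeOfRank M n ↔ VB M ∧ grank M = n :=
  ⟨fun h => ⟨VB.of_isLocallyFree h, grank_of_isLocallyFree h⟩, fun ⟨h, e⟩ => e ▸ h.isLocallyFree⟩

/-- The stalk at `x` is finitely generated because the local ring is noetherian. Its generators
generate the generic stalk of the middle term, the quotient being torsion, hence all its stalks over
a nonempty open set. Only finitely many points remain, and a smaller neighborhood avoids all of them
but `x`. -/
lemma FG.of_tors {S : ShortComplex C.Modules} (hS : S.ShortExact) (h2 : FG S.X₂)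
    (h3 : Tors S.X₃) : FG S.X₁ := by
  have := hS.mono_f
  intro x
  have hfin : Module.Finite (C.presheaf.stalk x) (stalk S.X₁ x) := by
    have := finite_stalk h2 x
    exact Module.Finite.of_injective (stalkMap S.f x) (stalkMap_injective S.f x)
  obtain ⟨n, c, hc⟩ := Module.Finite.exists_fin (R := C.presheaf.stalk x) (M := stalk S.X₁ x)
  obtain ⟨V, hV, -, g, hg⟩ := exists_common_germ S.X₁ ⊤ (mem_top x) c
  have hgx : Function.Surjective (comb S.X₁ g x hV) := by
    rw [← LinearMap.range_eq_top, eq_top_iff, ← hc, Submodule.span_le]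
    rintro _ ⟨j, rfl⟩
    refine ⟨Pi.single j 1, ?_⟩
    rw [comb, Fintype.linearCombination_apply_single, one_smul, hg]
  obtain ⟨U, hU, m, e, he⟩ := h2 x
  have hη : Function.Surjective (comb S.X₂ (fun j => S.f.app V (g j)) (genericPoint C)
      (genericPoint_mem hV)) := by
    rw [← LinearMap.range_eq_top]
    refine surjective_comb_iff (genericPoint_mem hU) (he _ _) _ fun j => ?_
    obtain ⟨a, ha, hat⟩ := h3 x (stalkMap S.g x (germ _ x hU (e j)))
    rw [← map_smul] at hat
    obtain ⟨α, hα⟩ := exact_stalk hS.exact x _ hat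
    obtain ⟨b, rfl⟩ := hgx α
    have h1 := congrArg (sp _ x) hα
    rw [← comb_app, sp_comb, sp_smul, sp_germ] at h1
    have ha' : algebraMap _ C.functionField a ≠ 0 := fun h =>
      ha (algebraMap_injective x (h.trans (map_zero _).symm))
    have h2 : germ S.X₂ (genericPoint C) (genericPoint_mem hU) (e j) =
        (algebraMap _ C.functionField a)⁻¹ • (algebraMap _ C.functionField a) •
          germ S.X₂ (genericPoint C) (genericPoint_mem hU) (e j) := by
      rw [smul_smul, inv_mul_cancel₀ ha', one_smul]
    rw [h2]
    refine Submodule.smul_mem _ _ ?_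
    exact ⟨_, h1⟩
  obtain ⟨W, hW, i, hsW⟩ := surjective_near h2 _ _ hη
  obtain ⟨Z, hZ, hZW⟩ := exists_avoid (W : Set C)ᶜ (finite_compl W hW) (fun h => h hW) x
  refine ⟨V ⊓ Z, mem_inf hV hZ, n, fun j => res S.X₁ inf_le_left (g j), fun y hy => ?_⟩
  rw [comb_res]
  by_cases hyW : y ∈ W
  · intro a
    obtain ⟨b, hb⟩ := hsW y hyW (stalkMap S.f y a)
    refine ⟨b, stalkMap_injective S.f y ?_⟩
    rw [← comb_app, hb]
  · obtain rfl := hZW y hy.2 hyW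
    exact hgx

/-- Generically each germ of the middle term comes from `S.X₁`; after clearing denominators a
nonzero multiple does so at `x`, since the middle term is torsion-free. -/
lemma Tors.of_generic {S : ShortComplex C.Modules} (hS : S.ShortExact) (h1 : FG S.X₁)
    (h2 : TF S.X₂) (h3 : ∀ t : stalk S.X₃ (genericPoint C), t = 0) : Tors S.X₃ := by
  have := hS.mono_f
  have := hS.epi_g
  intro x t
  obtain ⟨b, rfl⟩ := stalkMap_surjective S.g x t
  obtain ⟨α, hα⟩ := exact_stalk hS.exact (genericPoint C) (sp _ x b) (h3 _)
  obtain ⟨a, α', ha, hα'⟩ := exists_smul_eq_sp h1 x α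
  refine ⟨a, ha, ?_⟩
  have : a • b = stalkMap S.f x α' := by
    apply h2 x
    rw [sp_smul, sp_stalkMap, ← hα', ← hα]
    exact (LinearMap.map_smul (stalkMap S.f (genericPoint C)) _ _).symm
  rw [← map_smul, this, ← stalkMap_comp, S.zero, stalkMap_zero]
  rfl

lemma VB.sub_of_tors {S : ShortComplex C.Modules} (hS : S.ShortExact) (h2 : VB S.X₂)
    (h3 : Tors S.X₃) : VB S.X₁ :=
  have := hS.mono_f
  ⟨FG.of_tors hS h2.fg h3, TF_of_mono S.f h2.tf⟩

lemma VB.kernel {S : ShortComplex C.Modules} (hS : S.ShortExact) (h2 : VB S.X₂)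
    (h3 : VB S.X₃) : VB S.X₁ :=
  have := hS.mono_f
  ⟨FG_of_kernel hS h2.fg h3.isLocallyFree, TF_of_mono S.f h2.tf⟩

lemma VB.extension {S : ShortComplex C.Modules} (hS : S.ShortExact) (h1 : VB S.X₁)
    (h3 : VB S.X₃) : VB S.X₂ :=
  ⟨FG_of_shortExact hS h1.fg h3.fg, TF_of_shortExact hS h1.tf h3.tf⟩

lemma shortExact_image {A B : C.Modules} (f : A ⟶ B) :
    (ShortComplex.mk (kernel.ι f) (Abelian.factorThruImage f) (by
      rw [← cancel_mono (Abelian.image.ι f), Category.assoc, Abelian.image.fac,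
        kernel.condition, zero_comp])).ShortExact where
  exact := by
    apply ShortComplex.exact_of_f_is_kernel
    exact isKernelOfComp (Abelian.image.ι f) f (kernelIsKernel f) _ (Abelian.image.fac f)

lemma shortExact_cokernel {A B : C.Modules} (f : A ⟶ B) [Mono f] :
    (ShortComplex.mk f (cokernel.π f) (cokernel.condition f)).ShortExact where
  exact := ShortComplex.exact_cokernel f

lemma VB.image {A B : C.Modules} (f : A ⟶ B) (hA : VB A) (hB : TF B) : VB (Abelian.image f) :=
  ⟨FG_of_epi (Abelian.factorThruImage f) hA.fg, TF_of_mono (Abelian.image.ι f) hB⟩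

lemma VB.kernel_hom {A B : C.Modules} (f : A ⟶ B) (hA : VB A) (hB : TF B) :
    VB (Limits.kernel f) :=
  VB.kernel (shortExact_image f) hA (hA.image f hB)

lemma VB.of_iso {A B : C.Modules} (e : A ≅ B) (hA : VB A) : VB B :=
  ⟨FG_of_epi e.hom hA.fg, TF_of_mono e.inv hA.tf⟩

lemma grank_le_of_mono {A B : C.Modules} (f : A ⟶ B) [Mono f] (hB : FG B) :
    grank A ≤ grank B :=
  have := finite_generic hB
  LinearMap.finrank_le_finrank_of_injective (R := C.functionField)
    (stalkMap_injective f (genericPoint C))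

lemma grank_of_iso {A B : C.Modules} (e : A ≅ B) : grank A = grank B :=
  (LinearEquiv.ofBijective (stalkMap e.hom (genericPoint C))
    ⟨stalkMap_injective _ _, stalkMap_surjective _ _⟩).finrank_eq

/-- The quotient by a subbundle of the same rank is a torsion sheaf. -/
lemma tors_cokernel {S : ShortComplex C.Modules} (hS : S.ShortExact) (h1 : FG S.X₁)
    (h2 : VB S.X₂) (h : grank S.X₁ = grank S.X₂) : FG S.X₃ ∧ Tors S.X₃ := by
  have := hS.epi_g
  have h3 : FG S.X₃ := FG_of_epi S.g h2.fg
  refine ⟨h3, Tors.of_generic hS h1 h2.tf fun t => ?_⟩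
  have := finite_generic h3
  have h4 := grank_shortExact hS h2.fg
  have h5 : grank S.X₃ = 0 := by omega
  have h6 := (Module.finrank_zero_iff (R := C.functionField)).1 h5
  exact Subsingleton.elim _ _

lemma isZero_of_stalk {M : C.Modules} (h : ∀ (x : C) (m : stalk M x), m = 0) : IsZero M := by
  rw [IsZero.iff_id_eq_zero]
  apply hom_ext_stalk
  intro x
  ext m
  rw [h x m, map_zero, map_zero]

lemma VB.isZero {M : C.Modules} (hM : VB M) (h : grank M = 0) : IsZero M := by
  apply isZero_of_stalk
  intro x m
  have := finite_generic hM.fg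
  have h6 := (Module.finrank_zero_iff (R := C.functionField)).1 h
  exact hM.tf x (Subsingleton.elim _ _)

lemma shortExact_biprod (A B : C.Modules) :
    (ShortComplex.mk (biprod.inl : A ⟶ A ⊞ B) biprod.snd (by simp)).ShortExact :=
  (ShortComplex.Splitting.ofHasBinaryBiproduct A B).shortExact

lemma VB.biprod {A B : C.Modules} (hA : VB A) (hB : VB B) : VB (A ⊞ B) :=
  VB.extension (shortExact_biprod A B) hA hB

lemma grank_biprod {A B : C.Modules} (hA : VB A) (hB : VB B) :
    grank (A ⊞ B) = grank A + grank B := by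
  have e := grank_shortExact (shortExact_biprod A B) (hA.biprod hB).fg
  exact e

/-- Two bundles of the same rank embed into a third one of this rank. -/
lemma exists_common_overbundle {A B : C.Modules} (hA : VB A) (hB : VB B)
    (h : grank A = grank B) :
    ∃ (D : C.Modules) (i : A ⟶ D) (j : B ⟶ D), VB D ∧ Mono i ∧ Mono j ∧ grank D = grank A := by
  have := finite_generic hA.fg
  have := finite_generic hB.fg
  -- Any identification of the generic stalks places both bundles in one constant sheaf; the
  -- overbundle is their sum there.
  let θ : stalk A (genericPoint C) ≃ₗ[C.functionField] stalk B (genericPoint C) :=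
    LinearEquiv.ofFinrankEq _ _ h
  let a : A ⟶ genSheaf B := skyLift θ.toLinearMap
  have ha : Mono a := by
    apply mono_of_stalkMap_injective
    intro x m m' hm
    apply hA.tf x
    apply θ.injective
    have h1 := congrArg (skyVal _ x) hm
    rwa [skyVal_stalkMap, skyVal_stalkMap] at h1
  have hb : Mono (toGen B) := mono_toGen hB.tf
  let d := biprod.desc a (toGen B)
  have hD : VB (Abelian.image d) := (hA.biprod hB).image d (TF_sky _)
  let i : A ⟶ Abelian.image d := biprod.inl ≫ Abelian.factorThruImage d
  let j : B ⟶ Abelian.image d := biprod.inr ≫ Abelian.factorThruImage d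
  have hi : i ≫ Abelian.image.ι d = a := by simp [i, d]
  have hj : j ≫ Abelian.image.ι d = toGen B := by simp [j, d]
  have hi' : Mono i := by
    have : Mono (i ≫ Abelian.image.ι d) := hi ▸ ha
    exact mono_of_mono i (Abelian.image.ι d)
  have hj' : Mono j := by
    have : Mono (j ≫ Abelian.image.ι d) := hj ▸ hb
    exact mono_of_mono j (Abelian.image.ι d)
  refine ⟨Abelian.image d, i, j, hD, hi', hj', le_antisymm ?_ (grank_le_of_mono i hD.fg)⟩
  rw [h]
  have h1 : Function.Injective ((skyCounit (genericPoint C) (stalk B (genericPoint C))).comp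
      (stalkMap (Abelian.image.ι d) (genericPoint C))) :=
    (skyCounit_bijective _ _).1.comp (stalkMap_injective _ _)
  exact LinearMap.finrank_le_finrank_of_injective (R := C.functionField) h1

/-- Free sheaves, as iterated direct sums. -/
def freeSum (C : Scheme.{0}) : ℕ → C.Modules
  | 0 => kernel (𝟙 (structureSheaf C))
  | n + 1 => structureSheaf C ⊞ freeSum C n

lemma vb_structureSheaf : VB (structureSheaf C) := VB.of_isLocallyFree isLocallyFree_structureSheaf

lemma grank_structureSheaf : grank (structureSheaf C) = 1 :=
  grank_of_isLocallyFree isLocallyFree_structureSheaf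

lemma stalk_zero {M : C.Modules} (hM : IsZero M) (x : C) (m : stalk M x) : m = 0 := by
  rw [← stalkMap_id M x m, (IsZero.iff_id_eq_zero M).1 hM, stalkMap_zero]
  rfl

lemma VB.of_isZero {M : C.Modules} (hM : IsZero M) : VB M where
  fg x := ⟨⊤, mem_top x, 0, Fin.elim0, fun y _ m => ⟨0, (map_zero _).trans (stalk_zero hM y m).symm⟩⟩
  tf x a b _ := (stalk_zero hM x a).trans (stalk_zero hM x b).symm

lemma grank_of_isZero {M : C.Modules} (hM : IsZero M) : grank M = 0 :=
  have : Subsingleton (stalk M (genericPoint C)) :=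
    ⟨fun a b => (stalk_zero hM _ a).trans (stalk_zero hM _ b).symm⟩
  Module.finrank_zero_of_subsingleton (R := C.functionField)

lemma isZero_freeSum : IsZero (freeSum C 0) := isZero_kernel_of_mono (𝟙 (structureSheaf C))

lemma vb_freeSum (n : ℕ) : VB (freeSum C n) ∧ grank (freeSum C n) = n := by
  induction n with
  | zero => exact ⟨VB.of_isZero isZero_freeSum, grank_of_isZero isZero_freeSum⟩
  | succ n ih =>
    refine ⟨vb_structureSheaf.biprod ih.1, ?_⟩
    change grank (structureSheaf C ⊞ freeSum C n) = _
    rw [grank_biprod vb_structureSheaf ih.1, grank_structureSheaf, ih.2, add_comm]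

end

section

/-! ### Dimension counts in exact sequences -/

section LinearAlgebra

universe u

variable {k : Type} [Field k] {V₁ V₂ V₃ V₄ V₅ : Type u} [AddCommGroup V₁] [Module k V₁]
  [AddCommGroup V₂] [Module k V₂] [AddCommGroup V₃] [Module k V₃] [AddCommGroup V₄] [Module k V₄]
  [AddCommGroup V₅] [Module k V₅] (f₁ : V₁ →ₗ[k] V₂) (f₂ : V₂ →ₗ[k] V₃) (f₃ : V₃ →ₗ[k] V₄)
  (f₄ : V₄ →ₗ[k] V₅)

lemma finite_of_exact [Module.Finite k V₁] [Module.Finite k V₃]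
    (h : LinearMap.ker f₂ = LinearMap.range f₁) : Module.Finite k V₂ := by
  have : Module.Finite k (LinearMap.ker f₂) := h ▸ inferInstance
  have : Module.Finite k (V₂ ⧸ LinearMap.ker f₂) :=
    Module.Finite.equiv f₂.quotKerEquivRange.symm
  exact Module.Finite.of_submodule_quotient (LinearMap.ker f₂)

/-- `V₃` is the term of the torsion sheaf. Only exactness at `V₂` and `V₄` matters here; exactness
at `V₃` enters in `five_term_finrank`. -/
lemma five_term_finite [Module.Finite k V₃] (h₁ : Function.Injective f₁)
    (h₂ : LinearMap.ker f₂ = LinearMap.range f₁)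
    (h₄ : LinearMap.ker f₄ = LinearMap.range f₃) (h₅ : Function.Surjective f₄) :
    (Module.Finite k V₁ ∧ Module.Finite k V₄) ↔ (Module.Finite k V₂ ∧ Module.Finite k V₅) := by
  constructor
  · rintro ⟨_, _⟩
    exact ⟨finite_of_exact f₁ f₂ h₂, Module.Finite.of_surjective f₄ h₅⟩
  · rintro ⟨_, _⟩
    exact ⟨Module.Finite.of_injective f₁ h₁, finite_of_exact f₃ f₄ h₄⟩

lemma five_term_finrank [Module.Finite k V₁] [Module.Finite k V₂] [Module.Finite k V₃]
    [Module.Finite k V₄] (h₁ : Function.Injective f₁)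
    (h₂ : LinearMap.ker f₂ = LinearMap.range f₁) (h₃ : LinearMap.ker f₃ = LinearMap.range f₂)
    (h₄ : LinearMap.ker f₄ = LinearMap.range f₃) (h₅ : Function.Surjective f₄) :
    Module.finrank k V₁ + Module.finrank k V₃ + Module.finrank k V₅ =
      Module.finrank k V₂ + Module.finrank k V₄ := by
  have e2 := LinearMap.finrank_range_add_finrank_ker f₂
  have e3 := LinearMap.finrank_range_add_finrank_ker f₃
  have e4 := LinearMap.finrank_range_add_finrank_ker f₄
  rw [h₂, LinearMap.finrank_range_of_inj h₁] at e2
  rw [h₃] at e3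
  rw [h₄, LinearMap.range_eq_top.2 h₅, finrank_top] at e4
  omega

end LinearAlgebra

variable {C : Scheme.{0}} [C.Over (Spec (.of ℂ))]

/-! ### Functoriality of `Ext` -/

open Abelian (Ext)

/-- Postcomposition with a morphism on `Ext` groups. -/
abbrev post (P : C.Modules) {A B : C.Modules} (f : A ⟶ B) (i : ℕ) :
    Ext.{1} P A i →ₗ[ℂ] Ext.{1} P B i := (Ext.mk₀ f).postcompOfLinear ℂ P (add_zero i)

/-- Precomposition with a morphism on `Ext` groups. -/
abbrev pre (Q : C.Modules) {A B : C.Modules} (f : A ⟶ B) (i : ℕ) :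
    Ext.{1} B Q i →ₗ[ℂ] Ext.{1} A Q i := (Ext.mk₀ f).precompOfLinear ℂ Q (zero_add i)

lemma post_apply (P : C.Modules) {A B : C.Modules} (f : A ⟶ B) (i : ℕ) (x : Ext.{1} P A i) :
    post P f i x = x.comp (Ext.mk₀ f) (add_zero i) := rfl

lemma pre_apply (Q : C.Modules) {A B : C.Modules} (f : A ⟶ B) (i : ℕ) (x : Ext.{1} B Q i) :
    pre Q f i x = (Ext.mk₀ f).comp x (zero_add i) := rfl

section Sequences

variable {S : ShortComplex C.Modules}

/-- The connecting homomorphism in the second variable. -/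
abbrev postδ (hS : S.ShortExact) (P : C.Modules) : Ext.{1} P S.X₃ 0 →ₗ[ℂ] Ext.{1} P S.X₁ 1 :=
  hS.extClass.postcompOfLinear ℂ P (zero_add 1)

/-- The connecting homomorphism in the first variable. -/
abbrev preδ (hS : S.ShortExact) (Q : C.Modules) : Ext.{1} S.X₁ Q 0 →ₗ[ℂ] Ext.{1} S.X₃ Q 1 :=
  hS.extClass.precompOfLinear ℂ Q (add_zero 1)

lemma postδ_apply (hS : S.ShortExact) (P : C.Modules) (x : Ext.{1} P S.X₃ 0) :
    postδ hS P x = x.comp hS.extClass (zero_add 1) := rfl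

lemma preδ_apply (hS : S.ShortExact) (Q : C.Modules) (x : Ext.{1} S.X₁ Q 0) :
    preδ hS Q x = hS.extClass.comp x (add_zero 1) := rfl

lemma post_injective (hS : S.ShortExact) (P : C.Modules) : Function.Injective (post P S.f 0) := by
  have := hS.mono_f
  rw [injective_iff_map_eq_zero]
  intro x hx
  obtain ⟨a, rfl⟩ := (Ext.mk₀_bijective _ _).2 x
  rw [post_apply, Ext.mk₀_comp_mk₀, ← Ext.mk₀_zero] at hx
  have h1 := (Ext.mk₀_bijective _ _).1 hx
  rw [zero_of_comp_mono S.f h1, Ext.mk₀_zero]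

lemma post_exact (hS : S.ShortExact) (P : C.Modules) (i : ℕ) :
    LinearMap.ker (post P S.g i) = LinearMap.range (post P S.f i) := by
  ext x
  constructor
  · intro hx
    obtain ⟨y, hy⟩ := Ext.covariant_sequence_exact₂ P hS x hx
    exact ⟨y, hy⟩
  · rintro ⟨y, rfl⟩
    rw [LinearMap.mem_ker, post_apply, post_apply, Ext.comp_assoc_of_second_deg_zero,
      Ext.mk₀_comp_mk₀, S.zero, Ext.mk₀_zero, Ext.comp_zero]

lemma postδ_exact (hS : S.ShortExact) (P : C.Modules) :
    LinearMap.ker (postδ hS P) = LinearMap.range (post P S.g 0) := by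
  ext x
  constructor
  · intro hx
    obtain ⟨y, hy⟩ := Ext.covariant_sequence_exact₃ P hS x (zero_add 1) hx
    exact ⟨y, hy⟩
  · rintro ⟨y, rfl⟩
    rw [LinearMap.mem_ker, post_apply, postδ_apply, Ext.comp_assoc_of_second_deg_zero,
      hS.comp_extClass, Ext.comp_zero]

lemma post_exact_δ (hS : S.ShortExact) (P : C.Modules) :
    LinearMap.ker (post P S.f 1) = LinearMap.range (postδ hS P) := by
  ext x
  constructor
  · intro hx
    obtain ⟨y, hy⟩ := Ext.covariant_sequence_exact₁ P hS x hx (zero_add 1)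
    exact ⟨y, hy⟩
  · rintro ⟨y, rfl⟩
    rw [LinearMap.mem_ker, post_apply, postδ_apply, Ext.comp_assoc_of_third_deg_zero,
      hS.extClass_comp, Ext.comp_zero]

lemma pre_exact (hS : S.ShortExact) (Q : C.Modules) (i : ℕ) :
    LinearMap.ker (pre Q S.f i) = LinearMap.range (pre Q S.g i) := by
  ext x
  constructor
  · intro hx
    obtain ⟨y, hy⟩ := Ext.contravariant_sequence_exact₂ hS Q x hx
    exact ⟨y, hy⟩
  · rintro ⟨y, rfl⟩
    rw [LinearMap.mem_ker, pre_apply, pre_apply, Ext.mk₀_comp_mk₀_assoc, S.zero, Ext.mk₀_zero,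
      Ext.zero_comp]

lemma preδ_exact (hS : S.ShortExact) (Q : C.Modules) :
    LinearMap.ker (preδ hS Q) = LinearMap.range (pre Q S.f 0) := by
  ext x
  constructor
  · intro hx
    obtain ⟨y, hy⟩ := Ext.contravariant_sequence_exact₁ hS Q x (add_zero 1) hx
    exact ⟨y, hy⟩
  · rintro ⟨y, rfl⟩
    rw [LinearMap.mem_ker, pre_apply, preδ_apply, ← Ext.comp_assoc_of_second_deg_zero,
      hS.extClass_comp, Ext.zero_comp]

lemma pre_exact_δ (hS : S.ShortExact) (Q : C.Modules) :
    LinearMap.ker (pre Q S.g 1) = LinearMap.range (preδ hS Q) := by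
  ext x
  constructor
  · intro hx
    obtain ⟨y, hy⟩ := Ext.contravariant_sequence_exact₃ hS Q x hx (add_zero 1)
    exact ⟨y, hy⟩
  · rintro ⟨y, rfl⟩
    rw [LinearMap.mem_ker, pre_apply, preδ_apply, ← Ext.comp_assoc_of_third_deg_zero,
      hS.comp_extClass, Ext.zero_comp]

end Sequences

/-- `Ext` and direct sums in the second variable. -/
def extBiprodRight (P A B : C.Modules) (i : ℕ) :
    Ext.{1} P (A ⊞ B) i ≃ₗ[ℂ] Ext.{1} P A i × Ext.{1} P B i where
  __ := Ext.addEquivBiprod (X := P) (Y₁ := A) (Y₂ := B) (n := i)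
  map_smul' c x := by
    refine Prod.ext ?_ ?_
    · exact Ext.smul_comp x (Ext.mk₀ biprod.fst) (add_zero i) c
    · exact Ext.smul_comp x (Ext.mk₀ biprod.snd) (add_zero i) c

/-- `Ext` and direct sums in the first variable. -/
def extBiprodLeft (Q A B : C.Modules) (i : ℕ) :
    Ext.{1} (A ⊞ B) Q i ≃ₗ[ℂ] Ext.{1} A Q i × Ext.{1} B Q i where
  __ := Ext.biprodAddEquiv (Y := Q) (X₁ := A) (X₂ := B) (n := i)
  map_smul' c x := by
    refine Prod.ext ?_ ?_
    · exact Ext.comp_smul (Ext.mk₀ biprod.inl) x (zero_add i) c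
    · exact Ext.comp_smul (Ext.mk₀ biprod.inr) x (zero_add i) c

/-! ### Euler characteristics -/

/-- The cohomology of `M` and the spaces `Extⁱ(M, 𝒪)` are finite-dimensional for `i = 0, 1`. -/
structure Coh (M : C.Modules) : Prop where
  right (i : Fin 2) : Module.Finite ℂ (Ext.{1} (structureSheaf C) M i)
  left (i : Fin 2) : Module.Finite ℂ (Ext.{1} M (structureSheaf C) i)

/-- `dim Hom(M, 𝒪) - dim Ext¹(M, 𝒪)`. -/
def dualChar (M : C.Modules) : ℤ :=
  (Module.finrank ℂ (Ext.{1} M (structureSheaf C) 0) : ℤ) -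
    Module.finrank ℂ (Ext.{1} M (structureSheaf C) 1)

lemma Coh.biprod {A B : C.Modules} (hA : Coh A) (hB : Coh B) : Coh (A ⊞ B) where
  right i := by
    have := hA.right i
    have := hB.right i
    exact Module.Finite.equiv (extBiprodRight _ A B i).symm
  left i := by
    have := hA.left i
    have := hB.left i
    exact Module.Finite.equiv (extBiprodLeft _ A B i).symm

lemma finrank_ext_biprod_right {A B : C.Modules} (hA : Coh A) (hB : Coh B) (i : Fin 2) :
    h i (A ⊞ B) = h i A + h i B := by
  have := hA.right i
  have := hB.right i
  rw [h, (extBiprodRight _ A B i).finrank_eq, Module.finrank_prod]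
  rfl

lemma finrank_ext_biprod_left {A B : C.Modules} (hA : Coh A) (hB : Coh B) (i : Fin 2) :
    Module.finrank ℂ (Ext.{1} (A ⊞ B) (structureSheaf C) i) =
      Module.finrank ℂ (Ext.{1} A (structureSheaf C) i) +
      Module.finrank ℂ (Ext.{1} B (structureSheaf C) i) := by
  have := hA.left i
  have := hB.left i
  rw [(extBiprodLeft _ A B i).finrank_eq, Module.finrank_prod]

lemma eulerChar_biprod {A B : C.Modules} (hA : Coh A) (hB : Coh B) :
    eulerChar (A ⊞ B) = eulerChar A + eulerChar B := by
  have h0 := finrank_ext_biprod_right hA hB 0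
  have h1 := finrank_ext_biprod_right hA hB 1
  simp only [Fin.val_zero, Fin.val_one] at h0 h1
  rw [eulerChar, eulerChar, eulerChar, h0, h1]
  push_cast
  ring

lemma dualChar_biprod {A B : C.Modules} (hA : Coh A) (hB : Coh B) :
    dualChar (A ⊞ B) = dualChar A + dualChar B := by
  have h0 := finrank_ext_biprod_left hA hB 0
  have h1 := finrank_ext_biprod_left hA hB 1
  simp only [Fin.val_zero, Fin.val_one] at h0 h1
  rw [dualChar, dualChar, dualChar, h0, h1]
  push_cast
  ring

variable [hC : IsSmoothProjectiveCurve C]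

lemma hom_tors_eq_zero {T M : C.Modules} (hT : Tors T) (hM : TF M) (f : T ⟶ M) : f = 0 := by
  apply hom_ext_stalk
  intro x
  ext t
  apply hM x
  rw [sp_stalkMap, hT.generic (sp T x t), map_zero, stalkMap_zero, LinearMap.zero_apply, map_zero]

lemma pre_injective_of_tors {S : ShortComplex C.Modules} (hS : S.ShortExact) (h3 : Tors S.X₃) :
    Function.Injective (pre (structureSheaf C) S.f 0) := by
  rw [injective_iff_map_eq_zero]
  intro x hx
  have hx' : x ∈ LinearMap.ker (pre (structureSheaf C) S.f 0) := hx
  rw [pre_exact hS] at hx'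
  obtain ⟨y, rfl⟩ := hx'
  obtain ⟨f, rfl⟩ := (Ext.mk₀_bijective _ _).2 y
  rw [hom_tors_eq_zero h3 vb_structureSheaf.tf f, Ext.mk₀_zero, map_zero]

lemma tors_finite {T : C.Modules} (hT : FG T) (hT' : Tors T) :
    Module.Finite ℂ (Ext.{1} (structureSheaf C) T 0) ∧
    Module.Finite ℂ (Ext.{1} T (structureSheaf C) 1) ∧
    Module.finrank ℂ (Ext.{1} T (structureSheaf C) 1) = h 0 T := by
  have := tors_hom_finite hT hT'
  have e := (Ext.linearEquiv₀ (R := ℂ) (X := structureSheaf C) (Y := T))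
  obtain ⟨e'⟩ := ext_tors hT hT'
  exact ⟨Module.Finite.equiv e.symm, Module.Finite.equiv e'.symm, (e'.trans e.symm).finrank_eq⟩

section Comparison

variable {S : ShortComplex C.Modules}

/-- Both long exact sequences stop after five terms: one because `H¹` of a torsion sheaf vanishes,
the other because `Ext¹(-, 𝒪)` is right exact on these bundles. -/
lemma coh_iff_of_tors (hS : S.ShortExact) (h1 : FG S.X₁)
    (h3 : FG S.X₃) (h3' : Tors S.X₃) : Coh S.X₁ ↔ Coh S.X₂ := by
  have := hS.mono_f
  have := (tors_finite h3 h3').1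
  have := (tors_finite h3 h3').2.1
  have hr := five_term_finite (post (structureSheaf C) S.f 0) (post _ S.g 0) (postδ hS _)
    (post _ S.f 1) (post_injective hS _) (post_exact hS _ 0)
    (post_exact_δ hS _) (fun x => by
      have : x ∈ LinearMap.ker (post (structureSheaf C) S.g 1) := ext_structureSheaf_tors h3 h3' _
      rw [post_exact hS] at this
      exact this)
  have hl := five_term_finite (pre (structureSheaf C) S.f 0) (preδ hS _) (pre _ S.g 1)
    (pre _ S.f 1) (pre_injective_of_tors hS h3') (preδ_exact hS _)
    (pre_exact hS _ 1) (ext_precomp_surjective S.f h1)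
  constructor
  · intro hA
    have h0 := hr.1 ⟨hA.right 0, hA.right 1⟩
    -- The contravariant sequence exchanges the roles of the two sheaves, hence the opposite
    -- direction of the equivalence.
    have h0' := hl.2 ⟨hA.left 0, hA.left 1⟩
    exact ⟨Fin.forall_fin_two.2 h0, Fin.forall_fin_two.2 h0'⟩
  · intro hA
    have h0 := hr.2 ⟨hA.right 0, hA.right 1⟩
    have h0' := hl.1 ⟨hA.left 0, hA.left 1⟩
    exact ⟨Fin.forall_fin_two.2 h0, Fin.forall_fin_two.2 h0'⟩

lemma eulerChar_of_tors (hS : S.ShortExact) (h1 : FG S.X₁)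
    (h3 : FG S.X₃) (h3' : Tors S.X₃) (hA : Coh S.X₁) :
    eulerChar S.X₂ = eulerChar S.X₁ + h 0 S.X₃ := by
  have hB := (coh_iff_of_tors hS h1 h3 h3').1 hA
  have := (tors_finite h3 h3').1
  have h0 : Module.Finite ℂ (Ext.{1} (structureSheaf C) S.X₁ 0) := hA.right 0
  have h0 : Module.Finite ℂ (Ext.{1} (structureSheaf C) S.X₁ 1) := hA.right 1
  have h0 : Module.Finite ℂ (Ext.{1} (structureSheaf C) S.X₂ 0) := hB.right 0
  have hr := five_term_finrank (post (structureSheaf C) S.f 0) (post _ S.g 0) (postδ hS _)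
    (post _ S.f 1) (post_injective hS _) (post_exact hS _ 0) (postδ_exact hS _)
    (post_exact_δ hS _) (fun x => by
      have : x ∈ LinearMap.ker (post (structureSheaf C) S.g 1) := ext_structureSheaf_tors h3 h3' _
      rw [post_exact hS] at this
      exact this)
  simp only [eulerChar, h]
  omega

/-- The torsion term is now `Ext¹(T, 𝒪)`, which by duality has dimension `h⁰(T)`: the same
correction as for `eulerChar_of_tors`, with the opposite sign. -/
lemma dualChar_of_tors (hS : S.ShortExact) (h1 : FG S.X₁)
    (h3 : FG S.X₃) (h3' : Tors S.X₃) (hA : Coh S.X₁) :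
    dualChar S.X₁ = dualChar S.X₂ + h 0 S.X₃ := by
  have := hS.mono_f
  have hB := (coh_iff_of_tors hS h1 h3 h3').1 hA
  have := (tors_finite h3 h3').2.1
  have h0 : Module.Finite ℂ (Ext.{1} S.X₁ (structureSheaf C) 0) := hA.left 0
  have h0 : Module.Finite ℂ (Ext.{1} S.X₂ (structureSheaf C) 0) := hB.left 0
  have h0 : Module.Finite ℂ (Ext.{1} S.X₂ (structureSheaf C) 1) := hB.left 1
  have hl := five_term_finrank (pre (structureSheaf C) S.f 0) (preδ hS _) (pre _ S.g 1)
    (pre _ S.f 1) (pre_injective_of_tors hS h3') (preδ_exact hS _) (pre_exact_δ hS _)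
    (pre_exact hS _ 1) (ext_precomp_surjective S.f h1)
  rw [(tors_finite h3 h3').2.2] at hl
  simp only [dualChar]
  omega

end Comparison

end

section

open Abelian (Ext)

variable {C : Scheme.{0}} [C.Over (Spec (.of ℂ))] [hC : IsSmoothProjectiveCurve C]

/-! ### Global functions -/

/-- Properness makes the ring of global functions finite over `ℂ`; it is a domain and `ℂ` is
algebraically closed. -/
lemma scalars_surjective : Function.Surjective (scalars C) := by
  have h1 : (C ↘ Spec (.of ℂ)).appTop.hom.Finite := finite_appTop_of_universallyClosed ℂ _
  have h2 : (scalars C).Finite :=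
    h1.comp (RingHom.Finite.of_surjective _ (ConcreteCategory.bijective_of_isIso
      (Scheme.ΓSpecIso (.of ℂ)).inv).2)
  algebraize [scalars C]
  have : Algebra.IsIntegral ℂ Γ(C, ⊤) := inferInstance
  exact (IsAlgClosed.algebraMap_bijective_of_isIntegral (k := ℂ) (K := Γ(C, ⊤))).2

lemma exists_smul_id (f : structureSheaf C ⟶ structureSheaf C) : ∃ c : ℂ, c • 𝟙 _ = f := by
  obtain ⟨c, hc⟩ := scalars_surjective (ofSec (f.app ⊤ (toSec 1)))
  refine ⟨c, hom_structureSheaf_ext ?_⟩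
  rw [smul_hom_app, hc]
  change resO _ (ofSec _) • toSec 1 = _
  rw [← toSec_eq_smul, ← ofSec_res, res_self, toSec_ofSec]

lemma id_structureSheaf_ne_zero : 𝟙 (structureSheaf C) ≠ 0 := by
  intro h0
  have h1 := (grank_of_isZero ((IsZero.iff_id_eq_zero _).2 h0)).symm.trans
    (grank_structureSheaf (C := C))
  exact zero_ne_one h1

lemma h_zero_structureSheaf : h 0 (structureSheaf C) = 1 := by
  rw [h, (Ext.linearEquiv₀ (R := ℂ)).finrank_eq]
  exact finrank_eq_one (𝟙 _) id_structureSheaf_ne_zero exists_smul_id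

/-! ### Riemann-Roch -/

lemma ext_eq_zero_right {M : C.Modules} (hM : IsZero M) (P : C.Modules) (i : ℕ)
    (x : Ext.{1} P M i) : x = 0 := by
  rw [← Ext.comp_mk₀_id x, (IsZero.iff_id_eq_zero M).1 hM, Ext.mk₀_zero, Ext.comp_zero]

lemma ext_eq_zero_left {M : C.Modules} (hM : IsZero M) (P : C.Modules) (i : ℕ)
    (x : Ext.{1} M P i) : x = 0 := by
  rw [← Ext.mk₀_id_comp x, (IsZero.iff_id_eq_zero M).1 hM, Ext.mk₀_zero, Ext.zero_comp]

lemma chars_of_isZero {M : C.Modules} (hM : IsZero M) :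
    Coh M ∧ eulerChar M = 0 ∧ dualChar M = 0 := by
  have h1 : ∀ i, Subsingleton (Ext.{1} (structureSheaf C) M i) := fun i =>
    ⟨fun a b => (ext_eq_zero_right hM _ i a).trans (ext_eq_zero_right hM _ i b).symm⟩
  have h2 : ∀ i, Subsingleton (Ext.{1} M (structureSheaf C) i) := fun i =>
    ⟨fun a b => (ext_eq_zero_left hM _ i a).trans (ext_eq_zero_left hM _ i b).symm⟩
  refine ⟨⟨fun i => inferInstance, fun i => inferInstance⟩, ?_, ?_⟩
  · rw [eulerChar, h, h, Module.finrank_zero_of_subsingleton, Module.finrank_zero_of_subsingleton]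
    rfl
  · rw [dualChar, Module.finrank_zero_of_subsingleton, Module.finrank_zero_of_subsingleton]
    rfl

-- Finiteness of `H¹(𝒪)` is the one input from which finiteness for all bundles is derived.
variable [hO : Module.Finite ℂ (Ext1 (structureSheaf C) (structureSheaf C))]

lemma coh_structureSheaf : Coh (structureSheaf C) := by
  have h0 : Module.Finite ℂ (Ext.{1} (structureSheaf C) (structureSheaf C) 0) :=
    Module.finite_of_finrank_eq_succ (h_zero_structureSheaf (C := C))
  exact ⟨Fin.forall_fin_two.2 ⟨h0, hO⟩, Fin.forall_fin_two.2 ⟨h0, hO⟩⟩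

lemma chars_freeSum (n : ℕ) : Coh (freeSum C n) ∧
    eulerChar (freeSum C n) = n * eulerChar (structureSheaf C) ∧
    dualChar (freeSum C n) = n * eulerChar (structureSheaf C) := by
  induction n with
  | zero => simpa using chars_of_isZero (isZero_freeSum (C := C))
  | succ n ih =>
    have e : freeSum C (n + 1) = (structureSheaf C ⊞ freeSum C n) := rfl
    rw [e, eulerChar_biprod coh_structureSheaf ih.1, dualChar_biprod coh_structureSheaf ih.1]
    refine ⟨coh_structureSheaf.biprod ih.1, ?_, ?_⟩
    · rw [ih.2.1]; push_cast; ring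
    · rw [ih.2.2]
      have : dualChar (structureSheaf C) = eulerChar (structureSheaf C) := rfl
      rw [this]; push_cast; ring

lemma coh_iff_of_mono {A B : C.Modules} (i : A ⟶ B) [Mono i] (hA : VB A) (hB : VB B)
    (hAB : grank A = grank B) : Coh A ↔ Coh B :=
  have h3 := tors_cokernel (shortExact_cokernel i) hA.fg hB hAB
  coh_iff_of_tors (shortExact_cokernel i) hA.fg h3.1 h3.2

lemma sum_chars_of_mono {A B : C.Modules} (i : A ⟶ B) [Mono i] (hA : VB A) (hB : VB B)
    (hAB : grank A = grank B) (h : Coh A) :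
    dualChar A + eulerChar A = dualChar B + eulerChar B := by
  have h3 := tors_cokernel (shortExact_cokernel i) hA.fg hB hAB
  have e1 := eulerChar_of_tors (shortExact_cokernel i) hA.fg h3.1 h3.2 h
  have e2 := dualChar_of_tors (shortExact_cokernel i) hA.fg h3.1 h3.2 h
  dsimp only at e1 e2
  rw [e1, e2]
  ring

/-- Finiteness travels from the free bundle up to a common overbundle of the same rank and down to
`M`. -/
lemma VB.coh {M : C.Modules} (hM : VB M) : Coh M := by
  obtain ⟨h1, h2⟩ := vb_freeSum (C := C) (grank M)
  obtain ⟨D, i, j, hD, hi, hj, h3⟩ := exists_common_overbundle hM h1 h2.symm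
  rw [coh_iff_of_mono i hM hD h3.symm, ← coh_iff_of_mono j h1 hD (h2.trans h3.symm)]
  exact (chars_freeSum _).1

/-- The degree of a vector bundle. -/
def deg (M : C.Modules) : ℤ := eulerChar M - grank M * eulerChar (structureSheaf C)

/-- Riemann-Roch for the dual, without forming the dual bundle: the sum of the two characteristics
is the same as for the free bundle of rank `n`, namely `2n χ(𝒪)`. -/
lemma VB.dualChar {M : C.Modules} (hM : VB M) :
    ThetaCurve.dualChar M = grank M * eulerChar (structureSheaf C) - deg M := by
  obtain ⟨h1, h2⟩ := vb_freeSum (C := C) (grank M)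
  obtain ⟨D, i, j, hD, hi, hj, h3⟩ := exists_common_overbundle hM h1 h2.symm
  have e1 := sum_chars_of_mono i hM hD h3.symm hM.coh
  have e2 := sum_chars_of_mono j h1 hD (h2.trans h3.symm) h1.coh
  have e3 := chars_freeSum (C := C) (grank M)
  rw [e3.2.1, e3.2.2] at e2
  rw [deg]
  linarith

lemma isVectorBundle_iff {M : C.Modules} {n : ℕ} {d : ℤ} :
    IsVectorBundle M n d ↔ VB M ∧ grank M = n ∧ deg M = d := by
  rw [IsVectorBundle, isLocallyFree_iff, and_assoc]
  refine and_congr_right fun _ => and_congr_right fun e => ?_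
  rw [deg, e, eq_comm]

lemma deg_of_tors {S : ShortComplex C.Modules} (hS : S.ShortExact) (h1 : VB S.X₁)
    (h2 : VB S.X₂) (h : grank S.X₁ = grank S.X₂) :
    deg S.X₂ = deg S.X₁ + ThetaCurve.h 0 S.X₃ := by
  have h3 := tors_cokernel hS h1.fg h2 h
  rw [deg, deg, eulerChar_of_tors hS h1.fg h3.1 h3.2 h1.coh, h]
  ring

lemma deg_le_of_mono {A B : C.Modules} (i : A ⟶ B) [Mono i] (hA : VB A) (hB : VB B)
    (hAB : grank A = grank B) : deg A ≤ deg B := by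
  have := deg_of_tors (shortExact_cokernel i) hA hB hAB
  dsimp only at this
  omega

lemma isZero_of_tors {T : C.Modules} (hT : FG T) (hT' : Tors T) (h0 : h 0 T = 0) : IsZero T := by
  apply isZero_of_stalk
  apply tors_eq_zero hT hT'
  have := (tors_finite hT hT').1
  have hs : Subsingleton (Ext.{1} (structureSheaf C) T 0) := Module.finrank_zero_iff.1 h0
  intro f
  apply (Ext.mk₀_bijective _ _).1
  exact Subsingleton.elim _ _

lemma isIso_of_deg_eq {A B : C.Modules} (i : A ⟶ B) [Mono i] (hA : VB A) (hB : VB B)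
    (hAB : grank A = grank B) (hd : deg A = deg B) : IsIso i := by
  have h1 := deg_of_tors (shortExact_cokernel i) hA hB hAB
  have h3 := tors_cokernel (shortExact_cokernel i) hA.fg hB hAB
  dsimp only at h1 h3
  have h4 := isZero_of_tors h3.1 h3.2 (by omega)
  have : Epi i := Preadditive.epi_of_isZero_cokernel i h4
  exact isIso_of_mono_of_epi i

lemma deg_of_iso {A B : C.Modules} (e : A ≅ B) (hA : VB A) : deg A = deg B :=
  le_antisymm (deg_le_of_mono e.hom hA (hA.of_iso e) (grank_of_iso e))
    (deg_le_of_mono e.inv (hA.of_iso e) hA (grank_of_iso e.symm))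

/-- Instead of the long exact sequence, which would require `H²`, compare with a split sequence. A
generic retraction of `S.f` has as image a bundle `A` containing `S.X₁` with torsion quotient, and
`S.X₂` embeds in `A ⊞ S.X₃` with the same torsion quotient. Both corrections to the Euler
characteristic are equal and cancel. -/
lemma eulerChar_shortExact {S : ShortComplex C.Modules} (hS : S.ShortExact) (h1 : VB S.X₁)
    (h2 : VB S.X₂) (h3 : VB S.X₃) : eulerChar S.X₂ = eulerChar S.X₁ + eulerChar S.X₃ := by
  have := hS.mono_f
  have := hS.epi_g
  -- Over the function field the sequence splits.
  obtain ⟨ρ, hρ⟩ := LinearMap.exists_leftInverse_of_injective (K := C.functionField)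
    (stalkMap S.f (genericPoint C)) (LinearMap.ker_eq_bot.2 (stalkMap_injective _ _))
  let r : S.X₂ ⟶ genSheaf S.X₁ := skyLift ρ
  have hr : S.f ≫ r = toGen S.X₁ := by
    rw [comp_skyLift, toGen]
    congr 1
  let A := Abelian.image r
  have hA : VB A := h2.image r (TF_sky _)
  let q := Abelian.factorThruImage r
  let i : S.X₁ ⟶ A := S.f ≫ q
  have hi : i ≫ Abelian.image.ι r = toGen S.X₁ := by
    rw [Category.assoc, Abelian.image.fac, hr]
  have hi' : Mono i := by
    have : Mono (i ≫ Abelian.image.ι r) := hi ▸ mono_toGen h1.tf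
    exact mono_of_mono i (Abelian.image.ι r)
  have hgA : grank S.X₁ = grank A := by
    refine le_antisymm (grank_le_of_mono i hA.fg) ?_
    have := finite_generic h1.fg
    have h1 : Function.Injective ((skyCounit (genericPoint C) (stalk S.X₁ (genericPoint C))).comp
        (stalkMap (Abelian.image.ι r) (genericPoint C))) :=
      (skyCounit_bijective _ _).1.comp (stalkMap_injective _ _)
    exact LinearMap.finrank_le_finrank_of_injective (R := C.functionField) h1
  let j : S.X₂ ⟶ A ⊞ S.X₃ := biprod.lift q S.g
  have hw : i ≫ biprod.inl = S.f ≫ j := by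
    apply biprod.hom_ext
    · simp [i, j]
    · simp [i, j]
  have hjs : ∀ (x : C) (b : stalk S.X₂ x), stalkMap biprod.snd x (stalkMap j x b) =
      stalkMap S.g x b := fun x b => by
    rw [← stalkMap_comp, biprod.lift_snd]
  have hinl : ∀ (x : C) (m : stalk (A ⊞ S.X₃) x), stalkMap biprod.snd x m = 0 →
      stalkMap biprod.inl x (stalkMap biprod.fst x m) = m := fun x m hm => by
    have h1 := stalkMap_id _ x m
    rw [← biprod.total, stalkMap_add, LinearMap.add_apply, stalkMap_comp, stalkMap_comp, hm,
      map_zero, add_zero] at h1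
    exact h1
  have hinj : ∀ (x : C), Function.Injective (stalkMap (biprod.inl : A ⟶ A ⊞ S.X₃) x) :=
    fun x => stalkMap_injective _ x
  have hj : Mono j := by
    apply mono_of_stalkMap_injective
    intro x
    rw [injective_iff_map_eq_zero]
    intro b hb
    have h2 := hjs x b
    rw [hb, map_zero] at h2
    obtain ⟨a, rfl⟩ := exact_stalk hS.exact x b h2.symm
    rw [← stalkMap_comp, ← hw, stalkMap_comp] at hb
    have h4 := hinj x (hb.trans (map_zero _).symm)
    rw [stalkMap_injective i x (h4.trans (map_zero _).symm), map_zero]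
  -- The cokernels of `i` and `j` agree because `S.X₂` and `A ⊞ S.X₃` have the same quotient `S.X₃`;
  -- this is a diagram chase on stalks.
  have hT : IsIso (cokernel.map i j S.f biprod.inl hw) := by
    apply isIso_of_stalkMap_bijective
    intro x
    have hc : ∀ a : stalk A x, stalkMap (cokernel.map i j S.f biprod.inl hw) x
        (stalkMap (cokernel.π i) x a) =
        stalkMap (cokernel.π j) x (stalkMap biprod.inl x a) := fun a => by
      rw [← stalkMap_comp, ← stalkMap_comp]
      congr 2
      exact cokernel.π_desc _ _ _
    constructor
    · rw [injective_iff_map_eq_zero]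
      intro t ht
      obtain ⟨a, rfl⟩ := stalkMap_surjective (cokernel.π i) x t
      rw [hc] at ht
      obtain ⟨b, hb⟩ := exact_stalk (shortExact_cokernel j).exact x _ ht
      dsimp only at b hb
      have h5 : stalkMap S.g x b = 0 := by
        rw [← hjs, hb, ← stalkMap_comp, biprod.inl_snd, stalkMap_zero]
        rfl
      obtain ⟨a', rfl⟩ := exact_stalk hS.exact x b h5
      rw [← stalkMap_comp, ← hw, stalkMap_comp] at hb
      rw [← hinj x hb, ← stalkMap_comp, cokernel.condition, stalkMap_zero]
      rfl
    · intro t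
      obtain ⟨m, rfl⟩ := stalkMap_surjective (cokernel.π j) x t
      obtain ⟨b, hb⟩ := stalkMap_surjective S.g x (stalkMap biprod.snd x m)
      refine ⟨stalkMap (cokernel.π i) x (stalkMap biprod.fst x (m - stalkMap j x b)), ?_⟩
      rw [hc, hinl x _ (by rw [map_sub, hjs, hb, sub_self]), map_sub, ← stalkMap_comp j,
        cokernel.condition, stalkMap_zero, LinearMap.zero_apply, sub_zero]
  have hB : VB (A ⊞ S.X₃) := hA.biprod h3
  have hgB : grank S.X₂ = grank (A ⊞ S.X₃) := by
    rw [grank_biprod hA h3, ← hgA, grank_shortExact hS h2.fg]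
  have t1 := tors_cokernel (shortExact_cokernel i) h1.fg hA hgA
  have t2 := tors_cokernel (shortExact_cokernel j) h2.fg hB hgB
  have e1 := eulerChar_of_tors (shortExact_cokernel i) h1.fg t1.1 t1.2 h1.coh
  have e2 := eulerChar_of_tors (shortExact_cokernel j) h2.fg t2.1 t2.2 h2.coh
  have e3 : h 0 (cokernel i) = h 0 (cokernel j) := by
    have e : cokernel i ≅ cokernel j := asIso (cokernel.map i j S.f biprod.inl hw)
    rw [h, h, (Ext.linearEquiv₀ (R := ℂ)).finrank_eq, (Ext.linearEquiv₀ (R := ℂ)).finrank_eq]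
    exact (Linear.homCongr ℂ (Iso.refl _) e).finrank_eq
  dsimp only at e1 e2
  rw [eulerChar_biprod hA.coh h3.coh, e1, e3] at e2
  linarith

lemma deg_shortExact {S : ShortComplex C.Modules} (hS : S.ShortExact) (h1 : VB S.X₁)
    (h2 : VB S.X₂) (h3 : VB S.X₃) : deg S.X₂ = deg S.X₁ + deg S.X₃ := by
  rw [deg, deg, deg, eulerChar_shortExact hS h1 h2 h3, grank_shortExact hS h2.fg]
  push_cast
  ring

end

section

open Abelian (Ext)

section Extensions

variable {C : Scheme.{0}} [C.Over (Spec (.of ℂ))]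

/-! ### Extensions -/

/-- Every class in `Ext¹` is the class of an extension. -/
lemma exists_extensionWithClass {F G : C.Modules} (v : Ext1 F G) :
    Nonempty (ExtensionWithClass v) := by
  have hS : (ShortComplex.mk (Injective.ι G) (cokernel.π _) (cokernel.condition _)).ShortExact :=
    { exact := ShortComplex.exact_cokernel _ }
  obtain ⟨x, rfl⟩ := Ext.covariant_sequence_exact₁ _ hS v
    (Ext.eq_zero_of_injective _) (zero_add 1)
  obtain ⟨φ, rfl⟩ := (Ext.mk₀_bijective _ _).2 x
  -- The class is the connecting image of `φ`, so the extension is the pullback along `φ` of the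
  -- injective embedding of `G`.
  let π := cokernel.π (Injective.ι G)
  let a : G ⟶ pullback φ π := pullback.lift 0 (Injective.ι G)
    (by rw [zero_comp, cokernel.condition])
  have ha1 : a ≫ pullback.fst φ π = 0 := pullback.lift_fst _ _ _
  have ha2 : a ≫ pullback.snd φ π = Injective.ι G := pullback.lift_snd _ _ _
  have ham : Mono a := by
    have : Mono (a ≫ pullback.snd φ π) := by
      rw [ha2]
      infer_instance
    exact mono_of_mono a (pullback.snd φ π)
  have hE : (ShortComplex.mk a (pullback.fst φ π) ha1).ShortExact :=
    { exact := by
        apply ShortComplex.exact_of_f_is_kernel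
        refine KernelFork.IsLimit.ofι' a ha1 fun {A} k hk => ?_
        have h1 : (k ≫ pullback.snd φ π) ≫ π = 0 := by
          rw [Category.assoc, ← pullback.condition, ← Category.assoc, hk, zero_comp]
        have hex : (ShortComplex.mk (Injective.ι G) π (cokernel.condition _)).Exact := hS.exact
        refine ⟨hex.lift (k ≫ pullback.snd φ π) h1, ?_⟩
        apply pullback.hom_ext
        · rw [Category.assoc, ha1, comp_zero, hk]
        · rw [Category.assoc, ha2]
          exact hex.lift_f _ h1 }
  refine ⟨⟨_, a, pullback.fst φ π, ha1, hE, ?_⟩⟩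
  have := ShortComplex.ShortExact.extClass_naturality hE hS
    { τ₁ := 𝟙 _, τ₂ := pullback.snd φ π, τ₃ := φ
      comm₁₂ := by simpa using ha2.symm
      comm₂₃ := pullback.condition.symm }
  simpa using this

/-- The obstruction to lifting `f` is its image under the connecting map of the extension, that is,
the pullback of `v` along `f`. -/
lemma liftsTo_iff {S F G : C.Modules} (f : S ⟶ F) (v : Ext1 F G) :
    LiftsTo f v ↔ (Ext.mk₀ f).comp v (zero_add 1) = 0 := by
  constructor
  · rintro ⟨⟨E, i, p, w, hE, rfl⟩, l, rfl⟩
    rw [← Ext.mk₀_comp_mk₀, Ext.comp_assoc_of_second_deg_zero]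
    have : (Ext.mk₀ p).comp hE.extClass (zero_add 1) = 0 := hE.comp_extClass
    rw [this, Ext.comp_zero]
  · intro hv
    obtain ⟨E⟩ := exists_extensionWithClass v
    obtain ⟨x, hx⟩ := Ext.covariant_sequence_exact₃ S E.exact (Ext.mk₀ f) (zero_add 1)
      (by rw [E.class_eq, hv])
    obtain ⟨l, rfl⟩ := (Ext.mk₀_bijective _ _).2 x
    rw [Ext.mk₀_comp_mk₀] at hx
    exact ⟨E, l, (Ext.mk₀_bijective _ _).1 hx⟩

/-- The lifting property does not depend on the choice of the extension. -/
lemma exists_lift_of_liftsTo {S F G : C.Modules} {f : S ⟶ F} {v : Ext1 F G} (h : LiftsTo f v)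
    (E : ExtensionWithClass v) : ∃ l : S ⟶ E.E, l ≫ E.proj = f := by
  rw [liftsTo_iff] at h
  obtain ⟨x, hx⟩ := Ext.covariant_sequence_exact₃ S E.exact (Ext.mk₀ f) (zero_add 1)
    (by rw [E.class_eq, h])
  obtain ⟨l, rfl⟩ := (Ext.mk₀_bijective _ _).2 x
  rw [Ext.mk₀_comp_mk₀] at hx
  exact ⟨l, (Ext.mk₀_bijective _ _).1 hx⟩

lemma eq_zero_of_section {F G : C.Modules} {v : Ext1 F G} (E : ExtensionWithClass v)
    (s : F ⟶ E.E) (hs : s ≫ E.proj = 𝟙 F) : v = 0 := by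
  rw [← Ext.mk₀_id_comp v]
  exact (liftsTo_iff (𝟙 F) v).1 ⟨E, s, hs⟩

/-- The lifting condition is linear in `v`, so it does not depend on the representative of the
projective point. -/
lemma mk_mem_extendingClasses {S F : C.Modules} (f : S ⟶ F) (v : Ext1 F (structureSheaf C))
    (hv : v ≠ 0) : Projectivization.mk ℂ v hv ∈ extendingClasses f ↔
      v ∈ LinearMap.ker (pre (structureSheaf C) f 1) := by
  rw [LinearMap.mem_ker, pre_apply, ← liftsTo_iff]
  constructor
  · rintro ⟨w, hw, e, hl⟩
    rw [Projectivization.mk_eq_mk_iff'] at e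
    obtain ⟨a, rfl⟩ := e
    have ha : a ≠ 0 := by
      rintro rfl
      exact hw (zero_smul _ _)
    rw [liftsTo_iff, Ext.comp_smul, smul_eq_zero] at hl
    rw [liftsTo_iff]
    exact hl.resolve_left ha
  · exact fun hl => ⟨v, hv, rfl, hl⟩

lemma exists_subspace {S F : C.Modules} (f : S ⟶ F) :
    ∃ W : Projectivization.Subspace ℂ (Ext1 F (structureSheaf C)),
      (W : Set _) = extendingClasses f ∧ Projectivization.Subspace.submodule W =
        LinearMap.ker (pre (structureSheaf C) f 1) := by
  refine ⟨Projectivization.Subspace.submodule.symm (LinearMap.ker (pre (structureSheaf C) f 1)),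
    ?_, OrderIso.apply_symm_apply _ _⟩
  ext x
  induction x using Projectivization.ind with
  | h v hv =>
    rw [mk_mem_extendingClasses, SetLike.mem_coe, ← Projectivization.Subspace.mem_submodule_iff,
      OrderIso.apply_symm_apply]

end Extensions

variable {C : Scheme.{0}} [C.Over (Spec (.of ℂ))] [hC : IsSmoothProjectiveCurve C]

variable [hO : Module.Finite ℂ (Ext1 (structureSheaf C) (structureSheaf C))]

lemma finrank_ext_of_hom_eq_zero {M : C.Modules} (hM : VB M)
    (h0 : ∀ f : M ⟶ structureSheaf C, f = 0) :
    (Module.finrank ℂ (Ext1 M (structureSheaf C)) : ℤ) =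
      deg M - grank M * eulerChar (structureSheaf C) := by
  have h1 := hM.dualChar
  have : Subsingleton (Ext.{1} M (structureSheaf C) 0) := by
    refine ⟨fun a b => ?_⟩
    obtain ⟨f, rfl⟩ := (Ext.mk₀_bijective _ _).2 a
    obtain ⟨g, rfl⟩ := (Ext.mk₀_bijective _ _).2 b
    rw [h0 f, h0 g]
  rw [ThetaCurve.dualChar, Module.finrank_zero_of_subsingleton (M := Ext M _ 0)] at h1
  push_cast at h1
  linarith

/-- The dimension of the space of extensions of `F` by `𝒪` to which a subsheaf lifts. -/
lemma finrank_ker_pre {A F : C.Modules} (i : A ⟶ F) [Mono i] (hA : VB A) (hF : VB F)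
    (hA0 : ∀ f : A ⟶ structureSheaf C, f = 0) (hF0 : ∀ f : F ⟶ structureSheaf C, f = 0) :
    Module.Finite ℂ (LinearMap.ker (pre (structureSheaf C) i 1)) ∧
    (Module.finrank ℂ (LinearMap.ker (pre (structureSheaf C) i 1)) : ℤ) =
      deg F - grank F * eulerChar (structureSheaf C) -
        (deg A - grank A * eulerChar (structureSheaf C)) := by
  have : Module.Finite ℂ (Ext.{1} F (structureSheaf C) 1) := hF.coh.left 1
  have h1 := LinearMap.finrank_range_add_finrank_ker (pre (structureSheaf C) i 1)
  have h2 : Function.Surjective (pre (structureSheaf C) i 1) := ext_precomp_surjective i hA.fg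
  rw [LinearMap.range_eq_top.2 h2, finrank_top] at h1
  change Module.finrank ℂ (Ext1 A (structureSheaf C)) + _ =
    Module.finrank ℂ (Ext1 F (structureSheaf C)) at h1
  refine ⟨inferInstance, ?_⟩
  rw [← finrank_ext_of_hom_eq_zero hA hA0, ← finrank_ext_of_hom_eq_zero hF hF0]
  omega

lemma deg_structureSheaf : deg (structureSheaf C) = 0 := by
  rw [deg, grank_structureSheaf]
  push_cast
  ring

lemma deg_of_isZero {M : C.Modules} (hM : IsZero M) : deg M = 0 := by
  rw [deg, grank_of_isZero hM, (chars_of_isZero hM).2.1]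
  simp

/-- Subsheaves of `𝒪` have nonpositive degree. -/
lemma deg_nonpos {L : C.Modules} (i : L ⟶ structureSheaf C) [Mono i] (hL : VB L) : deg L ≤ 0 := by
  have h1 := grank_le_of_mono i vb_structureSheaf.fg
  rw [grank_structureSheaf] at h1
  rcases Nat.le_one_iff_eq_zero_or_eq_one.1 h1 with h2 | h2
  · exact (deg_of_isZero (hL.isZero h2)).le
  · have := deg_le_of_mono i hL vb_structureSheaf (h2.trans grank_structureSheaf.symm)
    rwa [deg_structureSheaf] at this

lemma grank_pos_of_ne_zero {A B : C.Modules} {f : A ⟶ B} (hf : f ≠ 0) (hA : VB A) (hB : TF B) :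
    0 < grank (Abelian.image f) := by
  rw [Nat.pos_iff_ne_zero]
  intro h0
  have h1 := (hA.image f hB).isZero h0
  apply hf
  rw [← Abelian.image.fac f, h1.eq_zero_of_src (Abelian.image.ι f), comp_zero]

lemma VB.kernel_image {A B : C.Modules} (f : A ⟶ B) (hA : VB A) (hB : TF B) :
    grank A = grank (Limits.kernel f) + grank (Abelian.image f) ∧
    deg A = deg (Limits.kernel f) + deg (Abelian.image f) := by
  have e1 := grank_shortExact (shortExact_image f) hA.fg
  have e2 := deg_shortExact (shortExact_image f) (hA.kernel_hom f hB) hA (hA.image f hB)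
  exact ⟨e1, e2⟩

/-- If subsheaves of `F` have slope at most `d / n`, then a subsheaf of `F` with a nonzero morphism
to `𝒪` has small degree. -/
lemma deg_le_of_hom_ne_zero {A F : C.Modules} (i : A ⟶ F) [Mono i] (hA : VB A)
    (n : ℕ) (d : ℤ)
    (hF : ∀ (S : C.Modules) (j : S ⟶ F), Mono j → VB S → 0 < grank S → deg S * n ≤ d * grank S)
    {f : A ⟶ structureSheaf C} (hf : f ≠ 0) : deg A * n ≤ d * (grank A - 1) := by
  have hL := hA.image f vb_structureSheaf.tf
  have hN := hA.kernel_hom f vb_structureSheaf.tf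
  obtain ⟨h1, h2⟩ := hA.kernel_image f vb_structureSheaf.tf
  have h3 := deg_nonpos (Abelian.image.ι f) hL
  have h4 := grank_pos_of_ne_zero hf hA vb_structureSheaf.tf
  have h5 := grank_le_of_mono (Abelian.image.ι f) vb_structureSheaf.fg
  rw [grank_structureSheaf] at h5
  -- The image in `𝒪` has rank one and nonpositive degree, so the kernel has rank one less than `A`
  -- and at least its degree.
  have h6 : (grank A : ℤ) - 1 = grank (Limits.kernel f) := by omega
  rw [h6]
  have h7 : deg (Limits.kernel f) * n ≤ d * grank (Limits.kernel f) := by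
    rcases Nat.eq_zero_or_pos (grank (Limits.kernel f)) with h8 | h8
    · rw [h8, deg_of_isZero (hN.isZero h8)]
      simp
    · exact hF _ (kernel.ι f ≫ i) (mono_comp _ _) hN h8
  refine le_trans ?_ h7
  gcongr
  omega

end

section

open Abelian (Ext)

variable {C : Scheme.{0}}

/-! ### Skyscraper sheaves and elementary transformations -/

/-- `evalForm γ` is the adjoint transpose of `γ`, and transposition is injective. -/
lemma evalForm_ne_zero {F : C.Modules} {p : C}
    {γ : fiber F p ⟶ structureSheaf (Spec (C.residueField p))} (hγ : γ ≠ 0) : evalForm γ ≠ 0 := by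
  intro h0
  let adj := Scheme.Modules.pullbackPushforwardAdjunction (C.fromSpecResidueField p)
  have h1 : adj.homEquiv _ _ γ = evalForm γ := adj.homEquiv_unit ..
  have h2 : adj.homEquiv F (structureSheaf (Spec (C.residueField p))) 0 = 0 := by
    rw [adj.homEquiv_unit, Functor.map_zero, comp_zero]
  exact hγ ((adj.homEquiv _ _).injective (h1.trans (h0.trans h2.symm)))

/-- A section of the skyscraper sheaf as a function on `Spec κ(p)`. -/
def skyscraperSec {p : C} {U : C.Opens} (s : Γ(skyscraper p, U)) :
    Γ(Spec (C.residueField p), (C.fromSpecResidueField p) ⁻¹ᵁ U) := s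

lemma skyscraperSec_smul {p : C} {U : C.Opens} (a : Γ(C, U)) (s : Γ(skyscraper p, U)) :
    skyscraperSec (a • s) = (C.fromSpecResidueField p).app U a * skyscraperSec s := rfl

lemma skyscraperSec_injective {p : C} {U : C.Opens} {s t : Γ(skyscraper p, U)}
    (h : skyscraperSec s = skyscraperSec t) : s = t := h

lemma skyscraper_section_eq_zero {p : C} {U : C.Opens} (hp : p ∉ U) (s : Γ(skyscraper p, U)) :
    s = 0 := by
  have h1 : (C.fromSpecResidueField p) ⁻¹ᵁ U = ⊥ := by
    ext x
    simp only [Opens.map_coe, Set.mem_preimage, SetLike.mem_coe, Opens.coe_bot,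
      Set.mem_empty_iff_false, iff_false]
    rw [Scheme.fromSpecResidueField_apply]
    exact hp
  have h2 : Subsingleton Γ(Spec (C.residueField p), (C.fromSpecResidueField p) ⁻¹ᵁ U) := by
    rw [h1]
    infer_instance
  exact skyscraperSec_injective (Subsingleton.elim _ _)

/-- The pulled-back function is nowhere invertible on the reduced scheme `Spec κ(p)`. -/
lemma fromSpecResidueField_app_eq_zero {p : C} {U : C.Opens} (hU : p ∈ U) (a : Γ(C, U))
    (ha : ¬ IsUnit (germO p hU a)) : (C.fromSpecResidueField p).app U a = 0 := by
  have h1 : (Spec (C.residueField p)).basicOpen ((C.fromSpecResidueField p).app U a) = ⊥ := by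
    rw [← Scheme.preimage_basicOpen]
    ext x
    simp only [Opens.map_coe, Set.mem_preimage, SetLike.mem_coe, Opens.coe_bot,
      Set.mem_empty_iff_false, iff_false]
    rw [Scheme.fromSpecResidueField_apply, Scheme.mem_basicOpen _ _ _ hU]
    exact ha
  exact (basicOpen_eq_bot_iff _).1 h1

lemma skyscraper_smul_eq_zero {p : C} (a : C.presheaf.stalk p) (ha : ¬ IsUnit a)
    (m : stalk (skyscraper p) p) : a • m = 0 := by
  obtain ⟨U, hU, a, rfl⟩ := exists_germO a
  obtain ⟨V, hV, s, rfl⟩ := exists_germ _ m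
  have hW : p ∈ U ⊓ V := mem_inf hU hV
  rw [← germO_resO inf_le_left p hW a] at ha ⊢
  rw [← germ_res _ inf_le_right p hW s, ← germ_smul]
  have : resO (inf_le_left : U ⊓ V ≤ U) a •
      res (skyscraper p) (inf_le_right : U ⊓ V ≤ V) s = 0 := by
    apply skyscraperSec_injective
    rw [skyscraperSec_smul, fromSpecResidueField_app_eq_zero hW _ ha, zero_mul]
    rfl
  rw [this, map_zero]

lemma fromSpecResidueField_appTop (p : C) :
    (C.fromSpecResidueField p).appTop =
      C.presheaf.germ ⊤ p trivial ≫ C.residue p ≫ (Scheme.ΓSpecIso (C.residueField p)).inv := by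
  rw [Scheme.fromSpecResidueField, Scheme.Hom.comp_appTop, Scheme.fromSpecStalk_appTop,
    Category.assoc, Scheme.ΓSpecIso_inv_naturality]
  simp

variable [C.Over (Spec (.of ℂ))] [hC : IsSmoothProjectiveCurve C]

/-- A uniformizer kills the stalk at `p`; at other points the stalk is zero. -/
lemma skyscraper_tors {p : C} (hp : IsClosed ({p} : Set C)) : Tors (skyscraper p) := by
  intro x m
  by_cases hx : x = p
  · subst hx
    have := isDVR_stalk hp
    obtain ⟨t, ht⟩ := IsDiscreteValuationRing.exists_irreducible (C.presheaf.stalk x)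
    exact ⟨t, ht.ne_zero, skyscraper_smul_eq_zero t ht.not_isUnit m⟩
  · obtain ⟨U, hU, s, rfl⟩ := exists_germ _ m
    let V : C.Opens := ⟨{p}ᶜ, hp.isOpen_compl⟩
    have hV : x ∈ V := hx
    refine ⟨1, one_ne_zero, ?_⟩
    rw [one_smul, ← germ_res _ (inf_le_left : U ⊓ V ≤ U) x (mem_inf hU hV),
      skyscraper_section_eq_zero (U := U ⊓ V) (fun h => h.2 rfl) (res _ _ s), map_zero]

lemma resO_self {X : Scheme.{0}} {U : X.Opens} (i : U ≤ U) (s : Γ(X, U)) : resO i s = s := by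
  change (X.presheaf.map (𝟙 _)) s = _
  rw [X.presheaf.map_id]
  rfl

/-- Sections are elements of `κ(p)`, and these are complex multiples of `1` by `scalars_residue`. -/
lemma skyscraper_hom (p : C) (hp : IsClosed ({p} : Set C)) :
    Module.finrank ℂ (structureSheaf C ⟶ skyscraper p) ≤ 1 ∧
      Module.Finite ℂ (structureSheaf C ⟶ skyscraper p) := by
  let one : Γ(skyscraper p, ⊤) := (1 : Γ(Spec (C.residueField p), (C.fromSpecResidueField p) ⁻¹ᵁ ⊤))
  have key : ∀ f : structureSheaf C ⟶ skyscraper p, ∃ c : ℂ, c • ofSection one = f := by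
    intro f
    let s : Γ(Spec (C.residueField p), ⊤) := skyscraperSec (f.app ⊤ (toSec 1))
    obtain ⟨c, hc⟩ := (scalars_residue hp).2 ((Scheme.ΓSpecIso (C.residueField p)).hom s)
    refine ⟨c, hom_structureSheaf_ext (skyscraperSec_injective ?_)⟩
    rw [smul_hom_app, ofSection_app, ofSec_toSec, one_smul, skyscraperSec_smul, resO_self]
    have h1 : skyscraperSec (res (skyscraper p) (le_top : (⊤ : C.Opens) ≤ ⊤) one) = 1 := by
      rw [res_self]
      rfl
    rw [h1, mul_one]
    have h2 := congrArg (Scheme.ΓSpecIso (C.residueField p)).inv hc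
    rw [Iso.hom_inv_id_apply] at h2
    refine Eq.trans ?_ h2
    exact ConcreteCategory.congr_hom (fromSpecResidueField_appTop p) (scalars C c)
  exact ⟨finrank_le_one _ key, ⟨⟨{ofSection one}, by
    rw [eq_top_iff]
    rintro f -
    obtain ⟨c, rfl⟩ := key f
    exact Submodule.smul_mem _ _ (Submodule.subset_span (by simp))⟩⟩⟩

variable [hO : Module.Finite ℂ (Ext1 (structureSheaf C) (structureSheaf C))]

/-- The kernel of a nonzero morphism to a torsion sheaf with one section. -/
lemma kernel_vb_of_tors {F K : C.Modules} (hF : VB F) (hK : Tors K)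
    (h1 : Module.finrank ℂ (structureSheaf C ⟶ K) ≤ 1) (h2 : Module.Finite ℂ (structureSheaf C ⟶ K))
    {φ : F ⟶ K} (hφ : φ ≠ 0) :
    VB (kernel φ) ∧ grank (kernel φ) = grank F ∧ deg (kernel φ) = deg F - 1 := by
  have hS := shortExact_image φ
  have hT : Tors (Abelian.image φ) := hK.of_mono (Abelian.image.ι φ)
  have hT' : FG (Abelian.image φ) := FG_of_epi (Abelian.factorThruImage φ) hF.fg
  have h3 : VB (kernel φ) := VB.sub_of_tors hS hF hT
  have h4 : grank (Abelian.image φ) = 0 :=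
    have : Subsingleton (stalk (Abelian.image φ) (genericPoint C)) :=
      ⟨fun a b => (hT.generic a).trans (hT.generic b).symm⟩
    Module.finrank_zero_of_subsingleton (R := C.functionField)
  have h5 := grank_shortExact hS hF.fg
  dsimp only at h5
  rw [h4, add_zero] at h5
  have h6 := deg_of_tors hS h3 hF h5.symm
  dsimp only at h6
  refine ⟨h3, h5.symm, ?_⟩
  -- The image has exactly one section up to scalars: at most one as a subsheaf of `K`, at least one
  -- because a torsion sheaf without sections is zero. Hence the drop in degree is exactly one.
  have h7 : h 0 (Abelian.image φ) ≤ 1 := by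
    rw [h, (Ext.linearEquiv₀ (R := ℂ)).finrank_eq]
    refine le_trans ?_ h1
    exact LinearMap.finrank_le_finrank_of_injective
      (f := Linear.rightComp ℂ (structureSheaf C) (Abelian.image.ι φ))
      (fun a b hab => (cancel_mono (Abelian.image.ι φ)).1 hab)
  have h8 : h 0 (Abelian.image φ) ≠ 0 := by
    intro h0
    have h9 := isZero_of_tors hT' hT h0
    apply hφ
    rw [← Abelian.image.fac φ, h9.eq_zero_of_src (Abelian.image.ι φ), comp_zero]
  omega

/-- An elementary transformation is a bundle of the same rank, and the degree drops by one. -/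
lemma elemTransf_vb {F : C.Modules} (hF : VB F) {p : C} (hp : IsClosed ({p} : Set C))
    {γ : fiber F p ⟶ structureSheaf (Spec (C.residueField p))} (hγ : γ ≠ 0) :
    VB (elemTransf γ) ∧ grank (elemTransf γ) = grank F ∧ deg (elemTransf γ) = deg F - 1 :=
  kernel_vb_of_tors hF (skyscraper_tors hp) (skyscraper_hom p hp).1 (skyscraper_hom p hp).2
    (evalForm_ne_zero hγ)

end

section

open Abelian (Ext)

variable {C : Scheme.{0}} [C.Over (Spec (.of ℂ))] [hC : IsSmoothProjectiveCurve C]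

/-! ### Saturated subsheaves -/

/-- Every subbundle is contained in a subbundle of the same rank whose quotient is a bundle. -/
lemma exists_saturation {S E : C.Modules} (i : S ⟶ E) [Mono i] (hE : VB E) :
    ∃ (K B : C.Modules) (k : K ⟶ E) (b : E ⟶ B) (w : k ≫ b = 0) (j : S ⟶ K),
      (ShortComplex.mk k b w).ShortExact ∧ VB K ∧ VB B ∧ j ≫ k = i ∧ grank K = grank S := by
  -- Mapping to the constant sheaf kills the torsion of the cokernel, so the kernel of `φ` is the
  -- saturation.
  let φ : E ⟶ genSheaf (cokernel i) := cokernel.π i ≫ toGen (cokernel i)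
  have hB : VB (Abelian.image φ) := hE.image φ (TF_sky _)
  have hS := shortExact_image φ
  have e1 := grank_shortExact hS hE.fg
  have e2 := grank_shortExact (shortExact_cokernel i) hE.fg
  dsimp only at e1 e2
  have e3 : grank (Abelian.image φ) = grank (cokernel i) := by
    have h1 : Function.Surjective (stalkMap φ (genericPoint C)) := by
      have : ⇑(stalkMap φ (genericPoint C)) = stalkMap (toGen (cokernel i)) (genericPoint C) ∘
          stalkMap (cokernel.π i) (genericPoint C) := by
        funext m
        exact stalkMap_comp _ _ _ _
      rw [this]
      exact (toGen_generic_bijective _).2.comp (stalkMap_surjective _ _)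
    have h2 : Function.Surjective (stalkMap (Abelian.image.ι φ) (genericPoint C)) := by
      intro m
      obtain ⟨t, rfl⟩ := h1 m
      refine ⟨stalkMap (Abelian.factorThruImage φ) _ t, ?_⟩
      rw [← stalkMap_comp, Abelian.image.fac]
    exact (LinearEquiv.ofBijective _ ⟨stalkMap_injective (Abelian.image.ι φ) _, h2⟩).finrank_eq.trans
      (LinearEquiv.ofBijective _ (toGen_generic_bijective (cokernel i))).finrank_eq.symm
  refine ⟨_, _, _, _, _, kernel.lift φ i ?_, hS, hE.kernel_hom φ (TF_sky _), hB,
    kernel.lift_ι _ _ _, by omega⟩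
  rw [cokernel.condition_assoc, zero_comp]

lemma shortExact_pullback {K E B T : C.Modules} {k : K ⟶ E} {b : E ⟶ B} {w : k ≫ b = 0}
    (hS : (ShortComplex.mk k b w).ShortExact) (t : T ⟶ B) :
    (ShortComplex.mk (pullback.lift k 0 (by rw [w, zero_comp]) : K ⟶ pullback b t)
      (pullback.snd b t) (pullback.lift_snd _ _ _)).ShortExact := by
  have hk : Mono k := hS.mono_f
  have hb : Epi b := hS.epi_g
  have hm : Mono (pullback.lift k 0 (by rw [w, zero_comp]) : K ⟶ pullback b t) := by
    have : Mono ((pullback.lift k 0 (by rw [w, zero_comp]) : K ⟶ pullback b t) ≫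
      pullback.fst b t) := by rwa [pullback.lift_fst]
    exact mono_of_mono _ (pullback.fst b t)
  refine { exact := ?_, mono_f := hm, epi_g := ?_ }
  · apply ShortComplex.exact_of_f_is_kernel
    refine KernelFork.IsLimit.ofι' _ _ fun {W} a ha => ?_
    have h1 : (a ≫ pullback.fst b t) ≫ b = 0 := by
      rw [Category.assoc, pullback.condition, ← Category.assoc]
      have ha' : a ≫ pullback.snd b t = 0 := ha
      rw [ha', zero_comp]
    refine ⟨hS.exact.lift (a ≫ pullback.fst b t) h1, ?_⟩
    apply pullback.hom_ext
    · rw [Category.assoc, pullback.lift_fst]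
      exact hS.exact.lift_f _ _
    · rw [Category.assoc, pullback.lift_snd, comp_zero]
      exact ha.symm
  · dsimp only
    infer_instance

variable [hO : Module.Finite ℂ (Ext1 (structureSheaf C) (structureSheaf C))]

/-! ### Slopes in terms of ranks and degrees -/

lemma hasSlope_iff {E : C.Modules} {μ : ℚ} :
    HasSlope E μ ↔ VB E ∧ 0 < grank E ∧ μ = deg E / grank E := by
  constructor
  · rintro ⟨n, d, hn, hE, hμ⟩
    obtain ⟨h1, rfl, rfl⟩ := isVectorBundle_iff.1 hE
    exact ⟨h1, hn, hμ⟩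
  · rintro ⟨h1, h2, h3⟩
    exact ⟨_, _, h2, isVectorBundle_iff.2 ⟨h1, rfl, rfl⟩, h3⟩

lemma div_le_div_iff_int {e d : ℤ} {m n : ℕ} (hm : 0 < m) (hn : 0 < n) :
    (e : ℚ) / m ≤ (d : ℚ) / n ↔ e * n ≤ d * m := by
  rw [div_le_div_iff₀ (by exact_mod_cast hm) (by exact_mod_cast hn)]
  exact_mod_cast Iff.rfl

lemma div_lt_div_iff_int {e d : ℤ} {m n : ℕ} (hm : 0 < m) (hn : 0 < n) :
    (e : ℚ) / m < (d : ℚ) / n ↔ e * n < d * m := by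
  rw [div_lt_div_iff₀ (by exact_mod_cast hm) (by exact_mod_cast hn)]
  exact_mod_cast Iff.rfl

lemma isSemistable_iff {E : C.Modules} :
    IsSemistable E ↔ VB E ∧ 0 < grank E ∧ ∀ (S : C.Modules) (i : S ⟶ E), Mono i → VB S →
      0 < grank S → deg S * grank E ≤ deg E * grank S := by
  constructor
  · rintro ⟨n, d, hn, hE, h1⟩
    obtain ⟨h2, rfl, rfl⟩ := isVectorBundle_iff.1 hE
    exact ⟨h2, hn, fun S i hi hS hp => (div_le_div_iff_int hp hn).1
      (h1 S i _ _ hi (isVectorBundle_iff.2 ⟨hS, rfl, rfl⟩) hp)⟩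
  · rintro ⟨h1, hn, h2⟩
    refine ⟨_, _, hn, isVectorBundle_iff.2 ⟨h1, rfl, rfl⟩, fun S i m e hi hS hp => ?_⟩
    obtain ⟨h3, rfl, rfl⟩ := isVectorBundle_iff.1 hS
    exact (div_le_div_iff_int hp hn).2 (h2 S i hi h3 hp)

lemma isStable_iff {E : C.Modules} :
    IsStable E ↔ VB E ∧ 0 < grank E ∧ ∀ (S : C.Modules) (i : S ⟶ E), Mono i → VB S →
      0 < grank S → grank S < grank E → deg S * grank E < deg E * grank S := by
  constructor
  · rintro ⟨n, d, hn, hE, h1⟩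
    obtain ⟨h2, rfl, rfl⟩ := isVectorBundle_iff.1 hE
    exact ⟨h2, hn, fun S i hi hS hp hlt => (div_lt_div_iff_int hp hn).1
      (h1 S i _ _ hi (isVectorBundle_iff.2 ⟨hS, rfl, rfl⟩) hp hlt)⟩
  · rintro ⟨h1, hn, h2⟩
    refine ⟨_, _, hn, isVectorBundle_iff.2 ⟨h1, rfl, rfl⟩, fun S i m e hi hS hp hlt => ?_⟩
    obtain ⟨h3, rfl, rfl⟩ := isVectorBundle_iff.1 hS
    exact (div_lt_div_iff_int hp hn).2 (h2 S i hi h3 hp hlt)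

lemma slope_eq_iff {E S : C.Modules} {μ : ℚ} (hE : HasSlope E μ) (hS : HasSlope S μ) :
    deg S * grank E = deg E * grank S := by
  obtain ⟨_, h1, h2⟩ := hasSlope_iff.1 hE
  obtain ⟨_, h3, h4⟩ := hasSlope_iff.1 hS
  rw [h2, eq_comm, div_eq_div_iff (by positivity) (by positivity)] at h4
  exact_mod_cast h4

lemma hasSlope_of_eq {E S : C.Modules} {μ : ℚ} (hE : HasSlope E μ) (hS : VB S) (hS' : 0 < grank S)
    (h : deg S * grank E = deg E * grank S) : HasSlope S μ := by
  obtain ⟨_, h1, h2⟩ := hasSlope_iff.1 hE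
  refine hasSlope_iff.2 ⟨hS, hS', ?_⟩
  rw [h2, eq_comm, div_eq_div_iff (by positivity) (by positivity)]
  exact_mod_cast h

lemma IsStable.of_iso {E E' : C.Modules} (hE : IsStable E) (e : E ≅ E') : IsStable E' := by
  obtain ⟨h1, h2, h3⟩ := isStable_iff.1 hE
  refine isStable_iff.2 ⟨h1.of_iso e, by rwa [← grank_of_iso e], fun S i hi hS hp hlt => ?_⟩
  rw [← grank_of_iso e] at hlt ⊢
  rw [← deg_of_iso e h1]
  exact h3 S (i ≫ e.inv) (mono_comp _ _) hS hp hlt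

/-! ### Jordan-Hölder filtrations -/

/-- The preimage in `E` of a subsheaf of `B` is its extension by `K`. As `K` has the slope of `E`,
subtracting its contribution from the inequality for the preimage leaves the one for the subsheaf.
-/
lemma IsSemistable.quotient {K E B : C.Modules} {k : K ⟶ E} {b : E ⟶ B} {w : k ≫ b = 0}
    (hS : (ShortComplex.mk k b w).ShortExact) (hE : IsSemistable E) (hK : VB K) (hB : VB B)
    (hKE : deg K * grank E = deg E * grank K) (hB0 : 0 < grank B) :
    IsSemistable B ∧ deg B * grank E = deg E * grank B := by
  obtain ⟨h1, h2, h3⟩ := isSemistable_iff.1 hE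
  have e1 := grank_shortExact hS h1.fg
  have e2 := deg_shortExact hS hK h1 hB
  dsimp only at e1 e2
  have e3 : deg B * grank E = deg E * grank B := by
    have e1' : (grank E : ℤ) = grank K + grank B := by exact_mod_cast e1
    have : (deg K + deg B) * grank E = deg E * (grank K + grank B) := by rw [← e1', ← e2]
    linarith
  refine ⟨isSemistable_iff.2 ⟨hB, hB0, fun T t ht hT hp => ?_⟩, e3⟩
  have hP := shortExact_pullback hS t
  have hP1 : VB (pullback b t) := VB.extension hP hK hT
  have f1 := grank_shortExact hP hP1.fg
  have f2 := deg_shortExact hP hK hP1 hT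
  dsimp only at f1 f2
  have f3 := h3 _ (pullback.fst b t) inferInstance hP1 (by omega)
  rw [f1, f2] at f3
  push_cast at f3
  have f4 : deg T * grank E ≤ deg E * grank T := by linarith
  have hE0 : (0 : ℤ) < grank E := by exact_mod_cast h2
  refine le_of_mul_le_mul_right ?_ hE0
  calc deg T * grank B * grank E = deg T * grank E * grank B := by ring
    _ ≤ deg E * grank T * grank B := by gcongr
    _ = deg E * grank B * grank T := by ring
    _ = deg B * grank E * grank T := by rw [e3]
    _ = deg B * grank T * grank E := by ring

/-- A semistable bundle that is not stable has a stable subbundle of the same slope, with a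
bundle as quotient. -/
lemma IsSemistable.exists_stable_sub {E : C.Modules} (hE : IsSemistable E) (hE' : ¬ IsStable E) :
    ∃ (K B : C.Modules) (k : K ⟶ E) (b : E ⟶ B) (w : k ≫ b = 0),
      (ShortComplex.mk k b w).ShortExact ∧ IsStable K ∧ VB K ∧ VB B ∧ 0 < grank K ∧
      grank K < grank E ∧ deg K * grank E = deg E * grank K := by
  classical
  obtain ⟨h1, h2, h3⟩ := isSemistable_iff.1 hE
  have hE0 : (0 : ℤ) < grank E := by exact_mod_cast h2
  -- A subsheaf of minimal rank among the proper ones of the same slope is stable once it is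
  -- saturated.
  let P : ℕ → Prop := fun m => ∃ (S : C.Modules) (i : S ⟶ E), Mono i ∧ VB S ∧ grank S = m ∧
    0 < m ∧ m < grank E ∧ deg S * grank E = deg E * grank S
  have hP : ∃ m, P m := by
    by_contra hn
    refine hE' (isStable_iff.2 ⟨h1, h2, fun S i hi hS hp hlt => lt_of_le_of_ne (h3 S i hi hS hp) ?_⟩)
    exact fun he => hn ⟨_, S, i, hi, hS, rfl, hp, hlt, he⟩
  obtain ⟨S, i, hi, hS, hSm, hm0, hmE, hSE⟩ := Nat.find_spec hP
  have hmin : ∀ m < Nat.find hP, ¬ P m := fun m => Nat.find_min hP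
  rw [← hSm] at hmin hm0 hmE
  obtain ⟨K, B, k, b, w, j, hKB, hK, hB, hjk, hKS⟩ := exists_saturation i h1
  have hk : Mono k := hKB.mono_f
  have hj : Mono j := by
    have : Mono (j ≫ k) := hjk ▸ hi
    exact mono_of_mono j k
  rw [← hKS] at hmin hm0 hmE hSE
  -- Saturation can only raise the degree, and semistability of `E` forbids an increase beyond its
  -- slope.
  have hKE : deg K * grank E = deg E * grank K := by
    refine le_antisymm (h3 K k hk hK hm0) ?_
    rw [← hSE]
    have := deg_le_of_mono j hS hK hKS.symm
    gcongr
  refine ⟨K, B, k, b, w, hKB, isStable_iff.2 ⟨hK, hm0, fun T t ht hT hp hlt => ?_⟩, hK, hB, hm0,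
    hmE, hKE⟩
  have hT1 := h3 T (t ≫ k) (mono_comp _ _) hT hp
  have hT2 : deg T * grank E ≠ deg E * grank T := fun he =>
    hmin _ hlt ⟨T, t ≫ k, mono_comp _ _, hT, rfl, hp, hlt.trans hmE, he⟩
  have hT3 := lt_of_le_of_ne hT1 hT2
  have hK0 : (0 : ℤ) < grank K := by exact_mod_cast hm0
  refine lt_of_mul_lt_mul_right ?_ hE0.le
  calc deg T * grank K * grank E = deg T * grank E * grank K := by ring
    _ < deg E * grank T * grank K := by gcongr
    _ = deg E * grank K * grank T := by ring
    _ = deg K * grank E * grank T := by rw [hKE]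
    _ = deg K * grank T * grank E := by ring

/-- Induction on the rank: split off a stable subbundle of the same slope; the quotient is again
semistable. -/
lemma exists_isGraded {μ : ℚ} {E : C.Modules} (hE : IsSemistable E) (hμ : HasSlope E μ) :
    ∃ G, IsGraded μ E G := by
  induction hn : grank E using Nat.strong_induction_on generalizing E with
  | _ n ih =>
    by_cases hE' : IsStable E
    · exact ⟨E, .stable E hE' hμ⟩
    · obtain ⟨K, B, k, b, w, hS, hKs, hK, hB, hK0, hKE, hKd⟩ := hE.exists_stable_sub hE'
      have hE1 := isSemistable_iff.1 hE
      have e1 := grank_shortExact hS hE1.1.fg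
      dsimp only at e1
      obtain ⟨hBs, hBd⟩ := IsSemistable.quotient hS hE hK hB hKd (by omega)
      obtain ⟨G, hG⟩ := ih (grank B) (by omega) hBs (hasSlope_of_eq hμ hB (by omega) hBd) rfl
      exact ⟨_, .extension K E B G k b w hS hKs (hasSlope_of_eq hμ hK hK0 hKd) hG⟩

lemma IsGraded.source {μ : ℚ} {E G : C.Modules} (hG : IsGraded μ E G) : VB E ∧ 0 < grank E := by
  induction hG with
  | stable E hE hμ =>
    obtain ⟨h1, h2, -⟩ := isStable_iff.1 hE
    exact ⟨h1, h2⟩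
  | extension A E B G a b w hex hA hμ hB ih =>
    have hE : VB E := VB.extension hex (isStable_iff.1 hA).1 ih.1
    have e1 := grank_shortExact hex hE.fg
    dsimp only at e1
    exact ⟨hE, by omega⟩

lemma IsGraded.target {μ : ℚ} {E G : C.Modules} (hG : IsGraded μ E G) : VB G ∧ 0 < grank G := by
  induction hG with
  | stable E hE hμ =>
    obtain ⟨h1, h2, -⟩ := isStable_iff.1 hE
    exact ⟨h1, h2⟩
  | extension A E B G a b w hex hA hμ hB ih =>
    have hA' := (isStable_iff.1 hA).1
    refine ⟨hA'.biprod ih.1, ?_⟩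
    rw [grank_biprod hA' ih.1]
    omega

/-- A nonzero morphism either factors through the stable subbundle or stays nonzero in the quotient,
so some graded piece receives one. With `L = 𝒪` this gives a section of `gr(E)`. -/
lemma IsGraded.exists_hom_ne_zero {μ : ℚ} {E G L : C.Modules} (hG : IsGraded μ E G)
    (hE : ∃ f : L ⟶ E, f ≠ 0) : ∃ f : L ⟶ G, f ≠ 0 := by
  induction hG with
  | stable E hE' hμ => exact hE
  | extension A E B G a b w hex hA hμ hB ih =>
    obtain ⟨f, hf⟩ := hE
    by_cases hfb : f ≫ b = 0
    · have : Mono a := hex.mono_f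
      let f' : L ⟶ A := hex.exact.lift f hfb
      have hf' : f' ≫ a = f := hex.exact.lift_f f hfb
      refine ⟨f' ≫ biprod.inl, fun h0 => hf ?_⟩
      have h1 : f' = 0 := by
        rw [← cancel_mono (biprod.inl : A ⟶ A ⊞ G), h0, zero_comp]
      rw [← hf', h1, zero_comp]
    · obtain ⟨g, hg⟩ := ih ⟨_, hfb⟩
      refine ⟨g ≫ biprod.inr, fun h0 => hg ?_⟩
      rw [← cancel_mono (biprod.inr : G ⟶ A ⊞ G), h0, zero_comp]

lemma IsGraded.one_le_h {μ : ℚ} {E G : C.Modules} (hG : IsGraded μ E G)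
    (hE : ∃ f : structureSheaf C ⟶ E, f ≠ 0) : 1 ≤ h 0 G := by
  obtain ⟨f, hf⟩ := hG.exists_hom_ne_zero hE
  have : Module.Finite ℂ (Ext.{1} (structureSheaf C) G 0) := hG.target.1.coh.right 0
  have : Nontrivial (Ext.{1} (structureSheaf C) G 0) := by
    refine ⟨Ext.mk₀ f, Ext.mk₀ 0, fun h0 => hf ((Ext.mk₀_bijective _ _).1 h0)⟩
  exact Module.finrank_pos

/-- A stable bundle has no proper subbundle of the same slope. -/
lemma IsStable.not_mono {μ : ℚ} {A E : C.Modules} (hE : IsStable E) (hEμ : HasSlope E μ)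
    (hA : HasSlope A μ) (a : A ⟶ E) [ha : Mono a] : ¬ grank A < grank E := fun hlt => by
  obtain ⟨h1, h2, -⟩ := hasSlope_iff.1 hA
  exact ((isStable_iff.1 hE).2.2 A a ha h1 h2 hlt).ne (slope_eq_iff hEμ hA)

lemma IsGraded.eq_of_isStable_source {μ : ℚ} {E G : C.Modules} (hG : IsGraded μ E G)
    (hE : IsStable E) (hμ : HasSlope E μ) : G = E := by
  cases hG with
  | stable _ => rfl
  | extension A _ B G a b w hex hA hAμ hB =>
    have := hex.mono_f
    have e1 := grank_shortExact hex (hasSlope_iff.1 hμ).1.fg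
    have e2 := hB.source.2
    dsimp only at e1
    exact (hE.not_mono hμ hAμ a (by omega)).elim

/-- A graded bundle with at least two factors has a proper summand of the same slope and cannot be
stable. -/
lemma IsGraded.eq_of_isStable_target {μ : ℚ} {E G : C.Modules} (hG : IsGraded μ E G)
    (hE : IsStable G) (hμ : HasSlope G μ) : G = E := by
  cases hG with
  | stable _ => rfl
  | extension A _ B G a b w hex hA hAμ hB =>
    have e1 := grank_biprod (isStable_iff.1 hA).1 hB.target.1
    have e2 := hB.target.2
    exact (hE.not_mono hμ hAμ biprod.inl (by omega)).elim

lemma SemistableBundle.hasSlope {n : ℕ} {d : ℤ} (E : SemistableBundle C n d) :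
    HasSlope E.sheaf (d / n) := by
  obtain ⟨h1, h2, h3⟩ := isVectorBundle_iff.1 E.isVectorBundle
  obtain ⟨-, h4, -⟩ := isSemistable_iff.1 E.isSemistable
  exact hasSlope_iff.2 ⟨h1, h4, by rw [h2, h3]⟩

lemma isStable_of_isGraded_iso {n : ℕ} {d : ℤ} {E E' : SemistableBundle C n d} {G G' : C.Modules}
    (hG : IsGraded (d / n : ℚ) E.sheaf G) (hG' : IsGraded (d / n : ℚ) E'.sheaf G') (e : G ≅ G')
    (hE : IsStable E.sheaf) : IsStable E'.sheaf := by
  have h1 := hG.eq_of_isStable_source hE E.hasSlope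
  subst h1
  have h2 := hE.of_iso e
  have h3 : HasSlope G' (d / n) := by
    obtain ⟨h4, h5, h6⟩ := hasSlope_iff.1 E.hasSlope
    refine hasSlope_iff.2 ⟨h4.of_iso e, ?_, ?_⟩
    · rwa [← grank_of_iso e]
    · rwa [← grank_of_iso e, ← deg_of_iso e h4]
  exact hG'.eq_of_isStable_target h2 h3 ▸ h2

lemma SEquivalent.isStable_iff {n : ℕ} {d : ℤ} {E E' : SemistableBundle C n d}
    (hEE : SEquivalent E E') : IsStable E.sheaf ↔ IsStable E'.sheaf := by
  obtain ⟨G, G', hG, hG', ⟨e⟩⟩ := hEE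
  exact ⟨isStable_of_isGraded_iso hG hG' e, isStable_of_isGraded_iso hG' hG e.symm⟩

/-- Stability only depends on the point of the moduli space. -/
lemma SemistableBundle.isStable_of_point_eq {n : ℕ} {d : ℤ} {E E' : SemistableBundle C n d}
    (hp : E.point = E'.point) (hE : IsStable E.sheaf) : IsStable E'.sheaf := by
  -- Invariance under the generating relation suffices for stability to descend to the quotient;
  -- transitivity of S-equivalence is not needed.
  let P : ModuliPoints C n d → Prop :=
    Quot.lift (fun E => IsStable E.sheaf) fun _ _ hEE => propext hEE.isStable_iff
  have h1 : P E.point = P E'.point := congrArg P hp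
  exact h1.mp hE

/-! ### Extensions of semistable bundles by the structure sheaf -/

lemma kernel_hom_structureSheaf {F S : C.Modules} {v : Ext1 F (structureSheaf C)}
    (X : ExtensionWithClass v) (i : S ⟶ X.E) [Mono i] :
    ∃ j : kernel (i ≫ X.proj) ⟶ structureSheaf C, Mono j := by
  have : Mono X.incl := X.exact.mono_f
  have hz : (kernel.ι (i ≫ X.proj) ≫ i) ≫ X.proj = 0 := by
    rw [Category.assoc, kernel.condition]
  let j := X.exact.exact.lift (kernel.ι (i ≫ X.proj) ≫ i) hz
  have hj : j ≫ X.incl = kernel.ι (i ≫ X.proj) ≫ i := X.exact.exact.lift_f _ hz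
  refine ⟨j, ?_⟩
  have : Mono (j ≫ X.incl) := hj ▸ mono_comp _ _
  exact mono_of_mono j X.incl

lemma ExtensionWithClass.vb {F : C.Modules} {v : Ext1 F (structureSheaf C)}
    (X : ExtensionWithClass v) (hF : VB F) :
    VB X.E ∧ grank X.E = grank F + 1 ∧ deg X.E = deg F := by
  have h1 : VB X.E := VB.extension X.exact vb_structureSheaf hF
  have e1 := grank_shortExact X.exact h1.fg
  have e2 := deg_shortExact X.exact vb_structureSheaf h1 hF
  dsimp only at e1 e2
  rw [grank_structureSheaf] at e1
  rw [deg_structureSheaf, zero_add] at e2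
  exact ⟨h1, by rw [e1, add_comm], e2⟩

/-- `E_v` has slope `1`, so the claim is `deg S ≤ rk S`. Write `S` as an extension of its image `I`
in `F` by `N`, a subsheaf of `𝒪`. The bound on `I` alone is `rk I + 1`; the excess of one is
absorbed if `N` has rank one, and otherwise can only occur when `S` maps isomorphically onto `F`. -/
lemma ExtensionWithClass.isSemistable {F : C.Modules} (hF : IsSemistable F)
    (hd : deg F = grank F + 1) {v : Ext1 F (structureSheaf C)} (hv : v ≠ 0)
    (X : ExtensionWithClass v) : IsSemistable X.E := by
  obtain ⟨hF1, hF2, hF3⟩ := isSemistable_iff.1 hF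
  obtain ⟨hE1, hE2, hE3⟩ := X.vb hF1
  refine isSemistable_iff.2 ⟨hE1, by omega, fun S i hi hS hp => ?_⟩
  suffices hle : deg S ≤ grank S by
    rw [hE2, hE3, hd, mul_comm]
    push_cast
    exact mul_le_mul_of_nonneg_left hle (by positivity)
  have hj := kernel_hom_structureSheaf X i
  obtain ⟨f, hf⟩ : ∃ f, f = i ≫ X.proj := ⟨_, rfl⟩
  rw [← hf] at hj
  obtain ⟨j, hj⟩ := hj
  have hN := hS.kernel_hom f hF1.tf
  have hI := hS.image f hF1.tf
  obtain ⟨e1, e2⟩ := hS.kernel_image f hF1.tf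
  have hN1 := grank_le_of_mono j vb_structureSheaf.fg
  rw [grank_structureSheaf] at hN1
  have hN2 := deg_nonpos j hN
  have hI1 := grank_le_of_mono (Abelian.image.ι f) hF1.fg
  rcases Nat.eq_zero_or_pos (grank (Abelian.image f)) with hI0 | hI0
  · have := deg_of_isZero (hI.isZero hI0)
    omega
  have hI2 := hF3 _ (Abelian.image.ι f) inferInstance hI hI0
  rw [hd] at hI2
  have hF0 : (0 : ℤ) < grank F := by exact_mod_cast hF2
  -- The slope of `F` is `1 + 1 / rk F`, and `rk I / rk F` is at most one.
  have hI3 : deg (Abelian.image f) ≤ grank (Abelian.image f) + 1 := by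
    refine le_of_mul_le_mul_right (hI2.trans ?_) hF0
    have : (grank (Abelian.image f) : ℤ) ≤ grank F := by exact_mod_cast hI1
    linarith
  rcases Nat.le_one_iff_eq_zero_or_eq_one.1 hN1 with hN0 | hN0
  swap
  · omega
  have hNz := hN.isZero hN0
  have hNd := deg_of_isZero hNz
  -- Now `S` and `I` have the same rank and degree. If the rank is smaller than that of `F`, the
  -- bound is strict and integrality removes the excess; otherwise `I` and `F` have equal degree, so
  -- `S ≅ F` would split the extension.
  rcases hI1.lt_or_eq with hlt | heq
  · have : deg (Abelian.image f) < grank (Abelian.image f) + 1 := by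
      refine lt_of_mul_lt_mul_right (hI2.trans_lt ?_) hF0.le
      have : (grank (Abelian.image f) : ℤ) < grank F := by exact_mod_cast hlt
      linarith
    omega
  · by_contra hgt
    have hdI : deg (Abelian.image f) = deg F := by omega
    have h1 : IsIso (Abelian.image.ι f) := isIso_of_deg_eq _ hI hF1 heq hdI
    have h2 : Mono f := Preadditive.mono_of_isZero_kernel f hNz
    have h3 : Epi f := by
      rw [← Abelian.image.fac f]
      exact epi_comp _ _
    have h4 : IsIso f := isIso_of_mono_of_epi f
    refine hv (eq_zero_of_section X (inv f ≫ i) ?_)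
    rw [Category.assoc, ← hf, IsIso.inv_hom_id]

lemma ExtensionWithClass.incl_ne_zero {F : C.Modules} {v : Ext1 F (structureSheaf C)}
    (X : ExtensionWithClass v) : X.incl ≠ 0 := fun h0 => by
  have : Mono X.incl := X.exact.mono_f
  have h1 : IsZero (structureSheaf C) := by
    rw [IsZero.iff_id_eq_zero, ← cancel_mono X.incl, h0, comp_zero, comp_zero]
  have h2 := grank_of_isZero h1
  rw [grank_structureSheaf] at h2
  exact one_ne_zero h2

open scoped LinearAlgebra.Projectivization in
/-- If a subbundle of slope `1` of `F` lifts to `E_v`, then `[E_v]` is a strictly semistable point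
of the theta divisor. -/
lemma givesStrictlySemistablePoint {F A : C.Modules} {r : ℕ} (hF : IsSemistable F)
    (hr : grank F + 1 = r) (hd : deg F = r) (i : A ⟶ F) [Mono i] (hA : VB A) (hA0 : 0 < grank A)
    (hAd : deg A = grank A) {x : ℙ ℂ (Ext1 F (structureSheaf C))} (hx : x ∈ extendingClasses i) :
    GivesStrictlySemistablePoint r x := by
  intro v hv hvx
  subst hvx
  have hpre := (mk_mem_extendingClasses i v hv).1 hx
  have hlift : LiftsTo i v := (liftsTo_iff i v).2 hpre
  refine ⟨exists_extensionWithClass v, fun X => ?_⟩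
  obtain ⟨hF1, hF2, -⟩ := isSemistable_iff.1 hF
  obtain ⟨hE1, hE2, hE3⟩ := X.vb hF1
  have hss : IsSemistable X.E := X.isSemistable hF (by rw [hd, ← hr]; push_cast; rfl) hv
  let E : SemistableBundle C r r :=
    ⟨X.E, isVectorBundle_iff.2 ⟨hE1, hE2.trans hr, hE3.trans hd⟩, hss⟩
  obtain ⟨G, hG⟩ := exists_isGraded hss E.hasSlope
  refine ⟨E, rfl, ⟨E, G, rfl, hG, hG.one_le_h ⟨X.incl, X.incl_ne_zero⟩⟩, ?_⟩
  rintro ⟨-, E', hE', hst⟩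
  have hst' : IsStable X.E := SemistableBundle.isStable_of_point_eq hE' hst
  obtain ⟨l, hl⟩ := exists_lift_of_liftsTo hlift X
  have hm : Mono l := by
    have : Mono (l ≫ X.proj) := hl ▸ inferInstance
    exact mono_of_mono l X.proj
  have h1 := grank_le_of_mono i hF1.fg
  -- The lift of `A` has rank at most `r - 1` and the slope of `E_v`, so the strict inequality
  -- fails.
  have h2 := (isStable_iff.1 hst').2.2 A l hm hA hA0 (by omega)
  rw [hAd, hE3, hd, hE2, hr, mul_comm] at h2
  exact lt_irrefl _ h2

end

/-! ### Dimension counts in genus two. -/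

section

variable {C : Scheme.{0}} [C.Over (Spec (.of ℂ))] [hC : IsSmoothProjectiveCurve C]

/-- `finrank` is zero on infinite-dimensional spaces, so a nonzero genus already implies finiteness.
-/
lemma finite_ext_of_genus_eq_two (hg : genus C = 2) :
    Module.Finite ℂ (Ext1 (structureSheaf C) (structureSheaf C)) :=
  Module.finite_of_finrank_pos (by
    change 0 < h 1 (structureSheaf C)
    rw [show h 1 (structureSheaf C) = 2 from hg]
    exact two_pos)

lemma eulerChar_of_genus_eq_two (hg : genus C = 2) : eulerChar (structureSheaf C) = -1 := by
  rw [eulerChar, h_zero_structureSheaf, show h 1 (structureSheaf C) = 2 from hg]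
  rfl

variable [hO : Module.Finite ℂ (Ext1 (structureSheaf C) (structureSheaf C))]

open scoped LinearAlgebra.Projectivization

/-- A bundle of degree `rank + 1` with enough semistability has no nonzero linear form, and the
same holds for its subbundles of large degree. -/
lemma hom_structureSheaf_eq_zero {A F : C.Modules} (hF : IsSemistable F)
    (hd : deg F = grank F + 1) (i : A ⟶ F) [Mono i] (hA : VB A) (hAd : grank A ≤ deg A)
    (f : A ⟶ structureSheaf C) : f = 0 := by
  obtain ⟨h1, h2, h3⟩ := isSemistable_iff.1 hF
  by_contra hf
  -- With `deg F = rk F + 1` and `deg A ≥ rk A`, this inequality would force `rk A ≥ rk F + 1`.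
  have h4 := deg_le_of_hom_ne_zero i hA (grank F) (deg F) h3 hf
  have h5 : (grank A : ℤ) ≤ grank F := by exact_mod_cast grank_le_of_mono i h1.fg
  have h6 : (grank A : ℤ) * grank F ≤ deg A * grank F := by gcongr
  rw [hd] at h4
  linarith

/-- The dimension of the space of extensions to which a subbundle lifts. -/
lemma finrank_ker_pre_of_isSemistable {A F : C.Modules} (hg : genus C = 2) (hF : IsSemistable F)
    (hd : deg F = grank F + 1) (i : A ⟶ F) [Mono i] (hA : VB A) (hAd : deg A = grank A) :
    Module.Finite ℂ (LinearMap.ker (pre (structureSheaf C) i 1)) ∧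
    (Module.finrank ℂ (LinearMap.ker (pre (structureSheaf C) i 1)) : ℤ) =
      2 * grank F + 1 - 2 * grank A := by
  have hF1 := (isSemistable_iff.1 hF).1
  obtain ⟨h1, h2⟩ := finrank_ker_pre i hA hF1
    (hom_structureSheaf_eq_zero hF hd i hA hAd.ge)
    (hom_structureSheaf_eq_zero hF hd (𝟙 F) hF1 (by omega))
  refine ⟨h1, h2.trans ?_⟩
  -- As `χ(𝒪) = -1`, each space of extensions has dimension degree plus rank.
  rw [eulerChar_of_genus_eq_two hg, hd, hAd]
  ring

lemma existsUnique_extendingClass {S F : C.Modules} (f : S ⟶ F)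
    (h1 : Module.finrank ℂ (LinearMap.ker (pre (structureSheaf C) f 1)) = 1) :
    ∃! x, x ∈ extendingClasses f := by
  obtain ⟨⟨v, hv⟩, hv0, hvs⟩ := finrank_eq_one_iff'.1 h1
  have hv0' : v ≠ 0 := fun h0 => hv0 (Subtype.ext h0)
  refine ⟨Projectivization.mk ℂ v hv0', (mk_mem_extendingClasses f v hv0').2 hv, fun y hy => ?_⟩
  induction y using Projectivization.ind with
  | h w hw =>
    obtain ⟨c, hc⟩ := hvs ⟨w, (mk_mem_extendingClasses f w hw).1 hy⟩
    exact (Projectivization.mk_eq_mk_iff' ℂ _ _ _ _).2 ⟨c, congrArg Subtype.val hc⟩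

lemma extendingClasses_nonempty {S F : C.Modules} (f : S ⟶ F)
    (h1 : 0 < Module.finrank ℂ (LinearMap.ker (pre (structureSheaf C) f 1))) :
    (extendingClasses f).Nonempty := by
  have := Module.nontrivial_of_finrank_pos h1
  obtain ⟨⟨v, hv⟩, hv0⟩ := exists_ne (0 : LinearMap.ker (pre (structureSheaf C) f 1))
  have hv0' : v ≠ 0 := fun h0 => hv0 (Subtype.ext h0)
  exact ⟨_, (mk_mem_extendingClasses f v hv0').2 hv⟩

lemma SemistableBundle.grank_deg {n : ℕ} {d : ℤ} (F : SemistableBundle C n d) :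
    VB F.sheaf ∧ grank F.sheaf = n ∧ deg F.sheaf = d := isVectorBundle_iff.1 F.isVectorBundle

lemma IsMaximalSubbundle.vb {r s : ℕ} {S F : C.Modules} {ι : S ⟶ F}
    (hι : IsMaximalSubbundle r s ι) : VB S ∧ grank S = s ∧ deg S = grank S := by
  obtain ⟨h1, h2⟩ := isLocallyFree_iff.1 hι.isLocallyFree
  obtain ⟨-, h3, h4⟩ := hasSlope_iff.1 hι.slope
  refine ⟨h1, h2, ?_⟩
  rw [eq_comm, div_eq_one_iff_eq (by positivity)] at h4
  exact_mod_cast h4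

end

end ThetaCurve

end

/-! ### The main theorem. -/

open scoped LinearAlgebra.Projectivization in
theorem proposition2p5 (C : AlgebraicGeometry.Scheme.{0})
    [C.Over (AlgebraicGeometry.Spec (.of ℂ))] [ThetaCurve.IsSmoothProjectiveCurve C]
    (hg : ThetaCurve.genus C = 2) (r : ℕ) (hr : 3 ≤ r)
    (F : ThetaCurve.SemistableBundle C (r - 1) r) :
    (∀ (p : C) (_ : IsClosed ({p} : Set C))
      (γ : ThetaCurve.fiber F.sheaf p ⟶
        ThetaCurve.structureSheaf (AlgebraicGeometry.Spec (C.residueField p))) (_ : γ ≠ 0),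
      (∃! x : ℙ ℂ (ThetaCurve.Ext1 F.sheaf (ThetaCurve.structureSheaf C)),
        x ∈ ThetaCurve.extendingClasses (ThetaCurve.elemTransfIncl γ))) ∧
    (∀ (s : ℕ) (S : C.Modules) (ι : S ⟶ F.sheaf), ThetaCurve.IsMaximalSubbundle r s ι →
      ∃ W : Projectivization.Subspace ℂ
          (ThetaCurve.Ext1 F.sheaf (ThetaCurve.structureSheaf C)),
        (W : Set (ℙ ℂ (ThetaCurve.Ext1 F.sheaf (ThetaCurve.structureSheaf C)))) =
          ThetaCurve.extendingClasses ι ∧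
        ThetaCurve.HasProjDim W (2 * (r : ℤ) - 2 * s - 2)) ∧
    (∀ (p : C) (_ : IsClosed ({p} : Set C))
      (γ : ThetaCurve.fiber F.sheaf p ⟶
        ThetaCurve.structureSheaf (AlgebraicGeometry.Spec (C.residueField p))) (_ : γ ≠ 0),
      (ThetaCurve.extendingClasses (ThetaCurve.elemTransfIncl γ)).Nonempty ∧
      ∀ x ∈ ThetaCurve.extendingClasses (ThetaCurve.elemTransfIncl γ),
        ThetaCurve.GivesStrictlySemistablePoint r x) ∧
    (∀ (s : ℕ) (S : C.Modules) (ι : S ⟶ F.sheaf), ThetaCurve.IsMaximalSubbundle r s ι →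
      (ThetaCurve.extendingClasses ι).Nonempty ∧
      ∀ x ∈ ThetaCurve.extendingClasses ι, ThetaCurve.GivesStrictlySemistablePoint r x) := by
  have hO := ThetaCurve.finite_ext_of_genus_eq_two hg
  obtain ⟨hF, hFr, hFd⟩ := F.grank_deg
  have hFs := F.isSemistable
  -- `r - 1` is a truncated subtraction, harmless since `r ≥ 3`.
  have hFr' : ThetaCurve.grank F.sheaf + 1 = r := by omega
  have hd : ThetaCurve.deg F.sheaf = ThetaCurve.grank F.sheaf + 1 := by omega
  -- The elementary transformation has rank and degree `r - 1`, so slope `1` and a kernel of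
  -- dimension `(2(r-1) + 1) - 2(r-1) = 1`.
  have hG : ∀ (p : C) (_ : IsClosed ({p} : Set C)) (γ : ThetaCurve.fiber F.sheaf p ⟶
      ThetaCurve.structureSheaf (AlgebraicGeometry.Spec (C.residueField p))) (_ : γ ≠ 0),
      ThetaCurve.VB (ThetaCurve.elemTransf γ) ∧
      ThetaCurve.grank (ThetaCurve.elemTransf γ) = ThetaCurve.grank F.sheaf ∧
      ThetaCurve.deg (ThetaCurve.elemTransf γ) = ThetaCurve.grank (ThetaCurve.elemTransf γ) ∧
      Module.finrank ℂ (LinearMap.ker (ThetaCurve.pre (ThetaCurve.structureSheaf C)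
        (ThetaCurve.elemTransfIncl γ) 1)) = 1 := by
    intro p hp γ hγ
    obtain ⟨h1, h2, h3⟩ := ThetaCurve.elemTransf_vb hF hp hγ
    have h4 : ThetaCurve.deg (ThetaCurve.elemTransf γ) =
      ThetaCurve.grank (ThetaCurve.elemTransf γ) := by omega
    have h5 := (ThetaCurve.finrank_ker_pre_of_isSemistable hg hFs hd
      (ThetaCurve.elemTransfIncl γ) h1 h4).2
    exact ⟨h1, h2, h4, by omega⟩
  refine ⟨fun p hp γ hγ => ?_, fun s S ι hι => ?_, fun p hp γ hγ => ?_, fun s S ι hι => ?_⟩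
  · exact ThetaCurve.existsUnique_extendingClass _ (hG p hp γ hγ).2.2.2
  · have := hι.mono
    obtain ⟨h1, h2, h3⟩ := hι.vb
    obtain ⟨h4, h5⟩ := ThetaCurve.finrank_ker_pre_of_isSemistable hg hFs hd ι h1 h3
    obtain ⟨W, hW, hW'⟩ := ThetaCurve.exists_subspace ι
    refine ⟨W, hW, ?_, ?_⟩
    · rw [hW']
      exact h4
    -- The vector space dimension `2(r-1) + 1 - 2s` is one more than the projective dimension.
    · rw [hW', h5]
      omega
  · obtain ⟨h1, h2, h3, h4⟩ := hG p hp γ hγ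
    exact ⟨ThetaCurve.extendingClasses_nonempty _ (by omega), fun x hx =>
      ThetaCurve.givesStrictlySemistablePoint hFs hFr' hFd (ThetaCurve.elemTransfIncl γ) h1
        (by omega) h3 hx⟩
  · have := hι.mono
    obtain ⟨h1, h2, h3⟩ := hι.vb
    have h4 := (ThetaCurve.finrank_ker_pre_of_isSemistable hg hFs hd ι h1 h3).2
    have h5 := hι.one_le
    have h6 := hι.le
    exact ⟨ThetaCurve.extendingClasses_nonempty _ (by omega), fun x hx =>
      ThetaCurve.givesStrictlySemistablePoint hFs hFr' hFd ι h1 (by omega) h3 hx⟩
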